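/- **Setting.** On a probability space $(\Omega,\mathcal F,\mathbb P)$ let $X$ and $Y$ be random vectors in $\mathbb R^d$ and $\mathbb R^p$, let $f:\mathbb R^p\to\mathbb R$ be measurable with $\mathbb E[f(Y)^2]<\infty$, and let $\varphi(\theta,\cdot):\mathbb R^d\to\mathbb R$, $\theta\in\mathbb R^q$, be measurable functions with $\mathbb E[\varphi(\theta,X)^2]<\infty$. Put $v^\infty(\theta)=\mathbb E[(\varphi(\theta,X)-\mathbb E[f(Y)|X])^2]$. Let $S\subset\mathbb R^q$ be compact with non-empty interior and assume: 1. $\mathbb E[\sup_{\theta\in S}|\varphi(\theta,X)|^2]<\infty$, and $\theta\mapsto\varphi(\theta,X)$ is a.s. continuous on $S$; 2. $v^\infty$ has a unique minimizer $\theta^\star$ on $S$, and $\theta^\star$ lies in the interior of $S$; 3. $\theta\mapsto\varphi(\theta,X)$ is a.s. twice continuously differentiable on the interior $\mathring S$, with $\mathbb E[\sup_{\theta\in\mathring S}|\nabla\varphi(\theta,X)|^2]<\infty$ and $\mathbb E[\sup_{\theta\in\mathring S}|\nabla^2\varphi(\theta,X)|^2]<\infty$ (derivatives in $\theta$); 4.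 $H:=\nabla^2v^\infty(\theta^\star)$ is positive definite. (The a.s. statements and suprema in 1 and 3 are understood under the law of $X$.) Let $$A=\mathbb E\big[(\varphi(\theta^\star,X)-\mathbb E[f(Y)|X])^2\,\nabla\varphi(\theta^\star,X)\nabla\varphi(\theta^\star,X)^T\big],\qquad B=\mathbb E\big[(f(Y)-\mathbb E[f(Y)|X])^2\,\nabla\varphi(\theta^\star,X)\nabla\varphi(\theta^\star,X)^T\big],$$ and assume $A\neq0$. Let $C_{Y|X}>0$ (the cost of one sample of $Y$ given $X$, a sample of $X$ having cost $1$). For $x>0$ let $\nu(x)$ be the unique integer $n\ge1$ with $(n-1)n<x\le n(n+1)$, and let $\nu(0)=1$. Put $$\xi=\frac{\operatorname{tr}(BH^{-1})}{C_{Y|X}\operatorname{tr}(AH^{-1})},\qquad K^\star=\nu(\xi),\qquad r^\star=r^\star(\xi)=\frac{(1+\nu(\xi)C_{Y|X})\left(1+\frac{\xi}{\nu(\xi)}C_{Y|X}\right)}{(1+C_{Y|X})(1+\xi C_{Y|X})}.$$ **Estimators.** Let $(X_i,(Y_i^{(k)})_{k\ge1})_{i\ge1}$ be independent and identically distributed,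 where $X_i$ has the law of $X$ and, given $X_i$, the $Y_i^{(k)}$, $k\ge1$, are iid with law $\mathcal L(Y|X=X_i)$. For $K\in\{1,K^\star\}$ and $N\ge1$ let the random vector $\theta_N^K$ be a.s. a minimizer over $S$ of $$v_N^K(\theta)=\frac1N\sum_{i=1}^N\Big(\varphi(\theta,X_i)-\frac1K\sum_{k=1}^Kf(Y_i^{(k)})\Big)^2 ,$$ and assume that $\mathbb E\big[\big(\varphi(\theta^\star,X_1)-\frac1K\sum_{k=1}^Kf(Y_1^{(k)})\big)^2|\nabla\varphi(\theta^\star,X_1)|^2\big]<\infty$ and that the sequence $\big(N(v^\infty(\theta_N^K)-v^\infty(\theta^\star))\big)_{N\ge1}$ is uniformly integrable. **Claim.** For a budget $c$ put $N^\star=\lfloor c/(1+K^\star C_{Y|X})\rfloor$ and $N=\lfloor c/(1+C_{Y|X})\rfloor$. Then, as $c\to\infty$, $$\mathbb E[v^\infty(\theta^{K^\star}_{N^\star})]-v^\infty(\theta^\star)\ \sim\ r^\star\,\big(\mathbb E[v^\infty(\theta^1_N)]-v^\infty(\theta^\star)\big).$$ Moreover $r^\star\in(0,1]$ and $r^\star\ge\frac{C_{Y|X}}{1+C_{Y|X}}$,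 and, with $C_{Y|X}$ fixed, $\lim_{\xi\to\infty}r^\star(\xi)=\frac{C_{Y|X}}{1+C_{Y|X}}$. -/

import Mathlib

open MeasureTheory ProbabilityTheory Filter Topology

/-- The Euclidean space `ℝⁿ`. -/
abbrev RVec (n : ℕ) : Type := EuclideanSpace ℝ (Fin n)

/-- The function `ν`: the least integer `n ≥ 1` with `x ≤ n (n + 1)`. For `x > 0` it is the unique
integer `n ≥ 1` with `(n - 1) n < x ≤ n (n + 1)`, see `nu_eq_iff`; for `x ≤ 0` its value is `1`. -/
noncomputable def nu (x : ℝ) : ℕ := sInf {n : ℕ | 1 ≤ n ∧ x ≤ (n : ℝ) * ((n : ℝ) + 1)}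

theorem nu_mem (x : ℝ) : 1 ≤ nu x ∧ x ≤ (nu x : ℝ) * ((nu x : ℝ) + 1) := by
  have hne : {n : ℕ | 1 ≤ n ∧ x ≤ (n : ℝ) * ((n : ℝ) + 1)}.Nonempty := by
    obtain ⟨m, hm⟩ := exists_nat_ge x
    refine ⟨m + 1, Nat.le_add_left 1 m, ?_⟩
    push_cast
    have h0 : (0 : ℝ) ≤ (m : ℝ) := Nat.cast_nonneg m
    nlinarith
  exact Nat.sInf_mem hne

/-- For `x > 0`, `nu x` is characterised by the usual property. -/
theorem nu_eq_iff {x : ℝ} (hx : 0 < x) (n : ℕ) :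
    nu x = n ↔ 1 ≤ n ∧ ((n : ℝ) - 1) * n < x ∧ x ≤ (n : ℝ) * ((n : ℝ) + 1) := by
  constructor
  · rintro rfl
    refine ⟨(nu_mem x).1, ?_, (nu_mem x).2⟩
    by_contra hcon
    have hcon' : x ≤ ((nu x : ℝ) - 1) * nu x := not_lt.mp hcon
    have h1 : 1 ≤ nu x := (nu_mem x).1
    rcases Nat.eq_or_lt_of_le h1 with h | h
    · rw [← h] at hcon'
      norm_num at hcon'
      linarith
    · have hle : nu x ≤ nu x - 1 := by
        apply Nat.sInf_le
        refine ⟨by omega, ?_⟩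
        rw [Nat.cast_sub h1]
        push_cast
        linarith
      omega
  · rintro ⟨h1, h2, h3⟩
    apply le_antisymm
    · exact Nat.sInf_le ⟨h1, h3⟩
    · by_contra hcon
      have hlt : nu x + 1 ≤ n := by omega
      have hm := (nu_mem x).2
      have hc : (nu x : ℝ) + 1 ≤ (n : ℝ) := by exact_mod_cast hlt
      have h0 : (0 : ℝ) ≤ (nu x : ℝ) := Nat.cast_nonneg _
      nlinarith

/-- The multiplicative gain `r⋆`, as a function of the cost `cY` and of `ξ`. -/
noncomputable def rStar (cY x : ℝ) : ℝ :=
  ((1 + (nu x : ℝ) * cY) * (1 + x / (nu x : ℝ) * cY)) / ((1 + cY) * (1 + x * cY))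

/-- The number of outer samples affordable with budget `c` when each of them comes with `K` inner
samples: `⌊c / (1 + K cY)⌋`. -/
noncomputable def sampleSize (cY : ℝ) (K : ℕ) (c : ℝ) : ℕ := ⌊c / (1 + (K : ℝ) * cY)⌋₊

/-- The Hessian matrix of `g` at `θ`, in the canonical basis. -/
noncomputable def hessianMatrix {q : ℕ} (g : RVec q → ℝ) (θ : RVec q) : Matrix (Fin q) (Fin q) ℝ :=
  Matrix.of fun i j =>
    fderiv ℝ (fderiv ℝ g) θ (EuclideanSpace.single i 1) (EuclideanSpace.single j 1)

section Regression

variable {Ω : Type*} [MeasurableSpace Ω] {d p q : ℕ}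

/-- `E[f(Y) | X]`. -/
noncomputable def condMean (P : Measure Ω) (X : Ω → RVec d) (Y : Ω → RVec p) (f : RVec p → ℝ) :
    Ω → ℝ :=
  P[fun ω => f (Y ω) | MeasurableSpace.comap X inferInstance]

/-- `v^∞(θ) = E[(φ(θ, X) - E[f(Y) | X])²]`. -/
noncomputable def vInf (P : Measure Ω) (X : Ω → RVec d) (Y : Ω → RVec p) (f : RVec p → ℝ)
    (φ : RVec q → RVec d → ℝ) (θ : RVec q) : ℝ :=
  ∫ ω, (φ θ (X ω) - condMean P X Y f ω) ^ 2 ∂P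

/-- `∇φ(θ, x)`, the gradient being taken with respect to `θ`. -/
noncomputable def gradPhi (φ : RVec q → RVec d → ℝ) (θ : RVec q) (x : RVec d) : RVec q :=
  gradient (fun η => φ η x) θ

/-- `A = E[(φ(θ, X) - E[f(Y) | X])² ∇φ(θ, X) ∇φ(θ, X)ᵀ]`. -/
noncomputable def matA (P : Measure Ω) (X : Ω → RVec d) (Y : Ω → RVec p) (f : RVec p → ℝ)
    (φ : RVec q → RVec d → ℝ) (θ : RVec q) : Matrix (Fin q) (Fin q) ℝ :=
  Matrix.of fun i j =>
    ∫ ω, (φ θ (X ω) - condMean P X Y f ω) ^ 2 * (gradPhi φ θ (X ω) i * gradPhi φ θ (X ω) j) ∂P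

/-- `B = E[(f(Y) - E[f(Y) | X])² ∇φ(θ, X) ∇φ(θ, X)ᵀ]`. -/
noncomputable def matB (P : Measure Ω) (X : Ω → RVec d) (Y : Ω → RVec p) (f : RVec p → ℝ)
    (φ : RVec q → RVec d → ℝ) (θ : RVec q) : Matrix (Fin q) (Fin q) ℝ :=
  Matrix.of fun i j =>
    ∫ ω, (f (Y ω) - condMean P X Y f ω) ^ 2 * (gradPhi φ θ (X ω) i * gradPhi φ θ (X ω) j) ∂P

/-- `H = ∇² v^∞(θ)`. -/
noncomputable def matH (P : Measure Ω) (X : Ω → RVec d) (Y : Ω → RVec p) (f : RVec p → ℝ)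
    (φ : RVec q → RVec d → ℝ) (θ : RVec q) : Matrix (Fin q) (Fin q) ℝ :=
  hessianMatrix (vInf P X Y f φ) θ

/-- `ξ = tr(B H⁻¹) / (cY tr(A H⁻¹))`. -/
noncomputable def xi (P : Measure Ω) (X : Ω → RVec d) (Y : Ω → RVec p) (f : RVec p → ℝ)
    (φ : RVec q → RVec d → ℝ) (θ : RVec q) (cY : ℝ) : ℝ :=
  (matB P X Y f φ θ * (matH P X Y f φ θ)⁻¹).trace /
    (cY * (matA P X Y f φ θ * (matH P X Y f φ θ)⁻¹).trace)

/-- `K⋆ = ν(ξ)`. -/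
noncomputable def optK (P : Measure Ω) (X : Ω → RVec d) (Y : Ω → RVec p) (f : RVec p → ℝ)
    (φ : RVec q → RVec d → ℝ) (θ : RVec q) (cY : ℝ) : ℕ :=
  nu (xi P X Y f φ θ cY)

/-- The assumptions on `X`, `Y`, `f`, the parametric family `φ`, the compact parameter set `S` and
the minimizer `θs`. Regularity of `θ ↦ φ(θ, X)` almost surely is a property of the law of `X`, so it
is stated for almost every `x` under that law. -/
structure RegressionAssumptions (P : Measure Ω) (X : Ω → RVec d) (Y : Ω → RVec p) (f : RVec p → ℝ)
    (φ : RVec q → RVec d → ℝ) (S : Set (RVec q)) (θs : RVec q) : Prop where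
  measurable_X : Measurable X
  measurable_Y : Measurable Y
  measurable_f : Measurable f
  memLp_f : MemLp (fun ω => f (Y ω)) 2 P
  measurable_phi : ∀ θ, Measurable (φ θ)
  memLp_phi : ∀ θ, MemLp (fun ω => φ θ (X ω)) 2 P
  isCompact : IsCompact S
  nonempty_interior : (interior S).Nonempty
  /-- `E[sup_{θ ∈ S} |φ(θ, X)|²] < ∞` -/
  sup_phi : ∫⁻ x, ⨆ θ ∈ S, ‖φ θ x‖ₑ ^ 2 ∂(P.map X) < ⊤
  /-- `θ ↦ φ(θ, X)` is a.s. continuous on `S` -/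
  continuousOn_phi : ∀ᵐ x ∂(P.map X), ContinuousOn (fun θ => φ θ x) S
  /-- `θs`, an interior point of `S`, is the unique minimizer of `v^∞` on `S` -/
  mem_interior : θs ∈ interior S
  unique_min : ∀ θ ∈ S, θ ≠ θs → vInf P X Y f φ θs < vInf P X Y f φ θ
  /-- `θ ↦ φ(θ, X)` is a.s. `C²`, with derivatives taken at the interior points of `S` -/
  contDiffOn_phi : ∀ᵐ x ∂(P.map X), ContDiffOn ℝ 2 (fun θ => φ θ x) (interior S)
  /-- `E[sup |∇φ(θ, X)|²] < ∞` -/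
  sup_grad : ∫⁻ x, ⨆ θ ∈ interior S, ‖gradPhi φ θ x‖ₑ ^ 2 ∂(P.map X) < ⊤
  /-- `E[sup |∇²φ(θ, X)|²] < ∞` -/
  sup_hess :
    ∫⁻ x, ⨆ θ ∈ interior S, ‖fderiv ℝ (fderiv ℝ (fun η => φ η x)) θ‖ₑ ^ 2 ∂(P.map X) < ⊤
  posDef_H : (matH P X Y f φ θs).PosDef

/-- The samples: the sequences `(Xs i, (Ys i k)_k)`, `i = 0, 1, …`, are independent, each `Xs i` has
the law of `X` and, given `Xs i`, the `Ys i k`, `k = 0, 1, …`, are iid with the conditional law of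
`Y` given `X = Xs i`. -/
structure IsNestedSample (P : Measure Ω) [IsFiniteMeasure P] (X : Ω → RVec d) (Y : Ω → RVec p)
    (Xs : ℕ → Ω → RVec d) (Ys : ℕ → ℕ → Ω → RVec p) : Prop where
  measurable_Xs : ∀ i, Measurable (Xs i)
  measurable_Ys : ∀ i k, Measurable (Ys i k)
  indep : iIndepFun (fun (i : ℕ) (ω : Ω) => (Xs i ω, fun k : ℕ => Ys i k ω)) P
  law : ∀ (i K : ℕ) (s : Set (RVec d)) (t : ℕ → Set (RVec p)), MeasurableSet s →
    (∀ k, MeasurableSet (t k)) →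
    P {ω | Xs i ω ∈ s ∧ ∀ k < K, Ys i k ω ∈ t k} =
      ∫⁻ x in s, ∏ k ∈ Finset.range K, condDistrib Y X P x (t k) ∂(P.map X)

/-- The empirical criterion
`v^K_N(θ) = (1/N) ∑_{i ≤ N} (φ(θ, X_i) - (1/K) ∑_{k ≤ K} f(Y_i^{(k)}))²`, at the outcome `ω`. -/
noncomputable def vEmp (f : RVec p → ℝ) (φ : RVec q → RVec d → ℝ) (Xs : ℕ → Ω → RVec d)
    (Ys : ℕ → ℕ → Ω → RVec p) (K N : ℕ) (θ : RVec q) (ω : Ω) : ℝ :=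
  (1 / (N : ℝ)) * ∑ i ∈ Finset.range N,
    (φ θ (Xs i ω) - (1 / (K : ℝ)) * ∑ k ∈ Finset.range K, f (Ys i k ω)) ^ 2

/-- The assumptions on the estimators `est N = θ^K_N`, `N ≥ 1`, for a given number `K` of inner
samples: they minimize the empirical criterion on `S`, the moment condition of the central limit
theorem holds, and `(N (v^∞(θ^K_N) - v^∞(θs)))_N` is uniformly integrable. -/
structure EstimatorAssumptions (P : Measure Ω) (X : Ω → RVec d) (Y : Ω → RVec p) (f : RVec p → ℝ)
    (φ : RVec q → RVec d → ℝ) (S : Set (RVec q)) (θs : RVec q) (Xs : ℕ → Ω → RVec d)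
    (Ys : ℕ → ℕ → Ω → RVec p) (K : ℕ) (est : ℕ → Ω → RVec q) : Prop where
  aemeasurable_est : ∀ N, 1 ≤ N → AEMeasurable (est N) P
  isMin_est : ∀ N, 1 ≤ N → ∀ᵐ ω ∂P, est N ω ∈ S ∧
    ∀ θ ∈ S, vEmp f φ Xs Ys K N (est N ω) ω ≤ vEmp f φ Xs Ys K N θ ω
  moment : Integrable (fun ω =>
    (φ θs (Xs 0 ω) - (1 / (K : ℝ)) * ∑ k ∈ Finset.range K, f (Ys 0 k ω)) ^ 2 *
      ‖gradPhi φ θs (Xs 0 ω)‖ ^ 2) P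
  /-- The term of index `N = 0` vanishes. -/
  unifIntegrable : UniformIntegrable
    (fun (N : ℕ) (ω : Ω) => (N : ℝ) * (vInf P X Y f φ (est N ω) - vInf P X Y f φ θs)) 1 P

end Regression

/-! The theorem reduces to the limit of `N · E[v^∞(θ_N^K) − v^∞(θ⋆)]` for fixed `K`, which is `2
(tr(A H⁻¹) + tr(B H⁻¹) / K)`.

Let `g` be the gradient of the empirical criterion at `θ⋆` and `h = θ_N − θ⋆`. Consistency places
`θ_N` in the interior of `S` eventually, so the empirical gradient vanishes there. A uniform law of
large numbers for the second derivatives then gives `g + H h = o(|h|)`, and Taylor's formula gives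
the excess risk `½ hᵀ H h + o(|h|²)`. Eliminating `h` shows that, almost surely, the excess is `½ gᵀ
H⁻¹ g + o(|g|²)` (`ae_eventually_abs_excess_sub_le`).

No convergence in law is needed to pass to expectations. The score is a mean of iid centered
vectors, so `N E[g gᵀ]` is the same for every `N ≥ 1` (`integral_normSum_mul`). The family `N |g|²`
is uniformly integrable (`unifIntegrable_normSum`), and so is `N` times the excess by assumption; a
Vitali argument (`tendsto_integral_of_eventually_abs_sub_quadForm_le`) gives the limit `½ tr(H⁻¹
Σ)`, with `Σ` the covariance of one score.

The dependence on `K` comes from one weighted bias-variance identity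
(`IsNestedSample.integral_sq_sub_mean`). With weight `1`, the risk with `K` inner samples is `v^∞`
plus a constant, so `θ⋆` and `H` do not depend on `K`. With weight `∂ᵢφ ∂ⱼφ`, it gives `Σ = 4 (A + B
/ K)`.

A budget `c` buys about `c / (1 + K C)` outer samples, so `c` times the mean excess tends to `2 tr(A
H⁻¹) (1 + K C) (1 + ξ C / K)`. The quotient of these limits at `K⋆` and at `1` is `r⋆`. The bounds
on `r⋆` are elementary: its numerator is `1 + (ν + ξ/ν) C + ξ C²`, with `ν + ξ/ν ≤ 1 + ξ` and `ν +
ξ/ν = O(√ξ)`. -/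

/-! ### Elementary bounds on `ν` and `r⋆`. -/

theorem one_le_nu_cast (x : ℝ) : (1 : ℝ) ≤ nu x := by exact_mod_cast (nu_mem x).1

/-- If `ν ≥ 2` then `ν ≤ (ν − 1) ν < x`. The dichotomy makes `(ν − 1)(x − ν)` nonnegative, which is
what `r⋆ ≤ 1` amounts to. -/
theorem nu_eq_one_or_le {x : ℝ} (hx : 0 ≤ x) : (nu x : ℝ) = 1 ∨ (nu x : ℝ) ≤ x := by
  rcases hx.eq_or_lt with rfl | hx
  · left
    have : nu 0 ≤ 1 := Nat.sInf_le ⟨le_rfl, by norm_num⟩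
    exact_mod_cast le_antisymm this (nu_mem 0).1
  · obtain ⟨h1, h2, -⟩ := (nu_eq_iff hx _).1 rfl
    rcases h1.eq_or_lt with h | h
    · exact Or.inl (by exact_mod_cast h.symm)
    · right
      have : (2 : ℝ) ≤ nu x := by exact_mod_cast h
      nlinarith

theorem rStar_pos {c x : ℝ} (hc : 0 < c) (hx : 0 ≤ x) : 0 < rStar c x := by
  have := one_le_nu_cast x
  unfold rStar
  positivity

theorem rStar_le_one {c x : ℝ} (hc : 0 < c) (hx : 0 ≤ x) : rStar c x ≤ 1 := by
  have hn := one_le_nu_cast x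
  have h := nu_eq_one_or_le hx
  unfold rStar
  generalize (nu x : ℝ) = n at *
  rw [div_le_one (by positivity)]
  have key : n + x / n ≤ 1 + x := by
    have h' : 0 ≤ (n - 1) * (x - n) := by
      rcases h with h | h
      · simp [h]
      · exact mul_nonneg (by linarith) (by linarith)
    have : (1 + x) - (n + x / n) = (n - 1) * (x - n) / n := by field_simp; ring
    have : 0 ≤ (n - 1) * (x - n) / n := by positivity
    linarith
  have e : (1 + n * c) * (1 + x / n * c) = 1 + (n + x / n) * c + x * c ^ 2 := by field_simp; ring
  rw [e]
  nlinarith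

theorem div_le_rStar {c x : ℝ} (hc : 0 < c) (hx : 0 ≤ x) : c / (1 + c) ≤ rStar c x := by
  have hn := one_le_nu_cast x
  unfold rStar
  generalize (nu x : ℝ) = n at *
  rw [div_le_div_iff₀ (by positivity) (by positivity)]
  have e : (1 + n * c) * (1 + x / n * c) = 1 + (n + x / n) * c + x * c ^ 2 := by field_simp; ring
  rw [e]
  have h1 : 0 ≤ x / n := by positivity
  have h2 : c * (1 + x * c) ≤ 1 + (n + x / n) * c + x * c ^ 2 := by nlinarith
  nlinarith [mul_le_mul_of_nonneg_right h2 (by positivity : 0 ≤ 1 + c)]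

theorem tendsto_rStar_atTop {c : ℝ} (hc : 0 < c) :
    Tendsto (fun x : ℝ => rStar c x) atTop (𝓝 (c / (1 + c))) := by
  -- From `(ν − 1)² ≤ (ν − 1) ν < x` one gets `ν ≤ √x + 1`, and `x ≤ ν (ν + 1)` gives `x / ν ≤ 2
  -- √x`. Hence `r⋆` exceeds its lower bound by `O(1 / √x)`, and a squeeze concludes.
  have hnu : ∀ x : ℝ, 1 ≤ x → (nu x : ℝ) + x / nu x ≤ 3 * √x + 1 := by
    intro x hx
    have hn := one_le_nu_cast x
    have h1 := ((nu_eq_iff (by linarith : 0 < x) _).1 rfl).2.1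
    have h2 := (nu_mem x).2
    generalize (nu x : ℝ) = n at *
    have hs : √x * √x = x := Real.mul_self_sqrt (by linarith)
    have hs0 := Real.sqrt_nonneg x
    have h3 : n ≤ √x + 1 := by nlinarith
    have h4 : x / n ≤ 2 * √x := by
      rw [div_le_iff₀ (by linarith)]
      nlinarith
    linarith
  have hlim : Tendsto (fun x : ℝ => c / (1 + c) + (1 + 1 / c) * (4 * (√x)⁻¹)) atTop
      (𝓝 (c / (1 + c))) := by
    have h := (Real.tendsto_sqrt_atTop.inv_tendsto_atTop.const_mul 4).const_mul (1 + 1 / c)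
    simpa using h.const_add (c / (1 + c))
  refine tendsto_of_tendsto_of_tendsto_of_le_of_le' tendsto_const_nhds hlim ?_ ?_
  · filter_upwards [eventually_ge_atTop 0] with x hx using div_le_rStar hc hx
  · filter_upwards [eventually_ge_atTop 1] with x hx
    have h := hnu x hx
    have hn := one_le_nu_cast x
    unfold rStar
    generalize (nu x : ℝ) = n at *
    have e : (1 + n * c) * (1 + x / n * c) = 1 + (n + x / n) * c + x * c ^ 2 := by
      field_simp; ring
    rw [e]
    have hs : √x * √x = x := Real.mul_self_sqrt (by linarith)
    have hs1 : 1 ≤ √x := Real.one_le_sqrt.2 hx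
    generalize √x = s at *
    generalize n + x / n = m at *
    subst hs
    have e2 : c / (1 + c) + (1 + 1 / c) * (4 * s⁻¹) - (1 + m * c + s * s * c ^ 2) /
        ((1 + c) * (1 + s * s * c)) = (c * (1 + s * s * c) * (s * c) + (1 + c) * 4 * ((1 + c) * (1 + s * s * c))
          - (1 + m * c + s * s * c ^ 2) * (s * c)) / ((1 + c) * (1 + s * s * c) * (s * c)) := by
      field_simp
      ring
    have : 0 ≤ (c * (1 + s * s * c) * (s * c) + (1 + c) * 4 * ((1 + c) * (1 + s * s * c))
          - (1 + m * c + s * s * c ^ 2) * (s * c)) / ((1 + c) * (1 + s * s * c) * (s * c)) := by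
      apply div_nonneg _ (by positivity)
      have h5 : (1 + m * c + s * s * c ^ 2) * (s * c) ≤
        (1 + (3 * s + 1) * c + s * s * c ^ 2) * (s * c) := by gcongr
      have : 0 < s * s * c := by positivity
      have : 0 < s * s * c * c := by positivity
      have : s * c ≤ s * s * c := by nlinarith
      nlinarith [mul_pos hc hc]
    linarith

/-! ### Deterministic elimination of the increment. -/

/-- Perturbation of the value of a coercive quadratic form at the solution of a linear equation. -/
theorem exists_pos_abs_sub_quadForm_le {E : Type*} [NormedAddCommGroup E] [NormedSpace ℝ E]
    (T : E →L[ℝ] E →L[ℝ] ℝ) (hsymm : ∀ u v, T u v = T v u) {l : ℝ} (hl : 0 < l)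
    (hT : ∀ h, l * ‖h‖ ^ 2 ≤ T h h) {ε : ℝ} (hε : 0 < ε) :
    ∃ η > 0, ∀ (h a : E) (g : E →L[ℝ] ℝ) (W : ℝ), T a = -g → ‖g + T h‖ ≤ η * ‖h‖ →
      |W - 1 / 2 * T h h| ≤ η * ‖h‖ ^ 2 → |W - 1 / 2 * T a a| ≤ ε * ‖g‖ ^ 2 := by
  -- The choice `η ≤ l / 2` forces `‖h‖ ≤ 2 ‖a‖`; the total error is then at most `η (3‖T‖/l + 4)
  -- ‖a‖²`, and `‖a‖ ≤ ‖g‖ / l` supplies the factor `1 / l²`.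
  set C : ℝ := (3 * ‖T‖ / l + 4) / l ^ 2 with hC
  have hC0 : 0 < C := by positivity
  refine ⟨min (l / 2) (ε / C), by positivity, fun h a g W hag hgh hW => ?_⟩
  set η := min (l / 2) (ε / C)
  have hη0 : 0 < η := by positivity
  have hη1 : η ≤ l / 2 := min_le_left _ _
  have hη2 : η * C ≤ ε := by rw [← le_div_iff₀ hC0]; exact min_le_right _ _
  have hg : g = -T a := by rw [hag]; simp
  have coer : ∀ u, l * ‖u‖ ≤ ‖T u‖ := by
    intro u
    rcases (norm_nonneg u).eq_or_lt with h0 | h0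
    · rw [← h0]; simp
    · have h1 := (hT u).trans ((le_abs_self _).trans ((T u).le_opNorm u))
      have : (l * ‖u‖) * ‖u‖ ≤ ‖T u‖ * ‖u‖ := by linarith [h1]
      exact le_of_mul_le_mul_right this h0
  -- Since `g = −T a`, the residual `g + T h` equals `T (h − a)`, and coercivity inverts `T`.
  have h1 : l * ‖h - a‖ ≤ η * ‖h‖ := by
    refine (coer _).trans (le_trans (le_of_eq ?_) hgh)
    rw [map_sub, hg]; congr 1; abel
  have h2 : l * ‖a‖ ≤ ‖g‖ := by
    refine (coer a).trans (le_of_eq ?_)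
    rw [hg, norm_neg]
  have h3 : ‖h‖ ≤ 2 * ‖a‖ := by
    have : ‖h‖ ≤ ‖h - a‖ + ‖a‖ := by simpa using norm_add_le (h - a) a
    have h5 : l * ‖h - a‖ ≤ l / 2 * ‖h‖ := h1.trans (by gcongr)
    have h6 : ‖h - a‖ ≤ 1 / 2 * ‖h‖ := by nlinarith
    linarith
  have h4 : |T h h - T a a| ≤ ‖T‖ * ‖h - a‖ * (‖h‖ + ‖a‖) := by
    have : T h h - T a a = T (h - a) (h + a) := by
      simp only [map_sub, map_add, sub_apply]
      rw [hsymm h a]; ring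
    rw [this]
    calc |T (h - a) (h + a)| ≤ ‖T‖ * ‖h - a‖ * ‖h + a‖ := T.le_opNorm₂ _ _
      _ ≤ _ := by gcongr; exact norm_add_le _ _
  have h5 : ‖h - a‖ ≤ 2 * η / l * ‖a‖ := by
    rw [div_mul_eq_mul_div, le_div_iff₀ hl]
    nlinarith
  have h6 : ‖T‖ * ‖h - a‖ * (‖h‖ + ‖a‖) ≤ ‖T‖ * (2 * η / l * ‖a‖) * (2 * ‖a‖ + ‖a‖) := by gcongr
  have h7 : |W - 1 / 2 * T a a| ≤ η * (3 * ‖T‖ / l + 4) * ‖a‖ ^ 2 := by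
    have e : W - 1 / 2 * T a a = (W - 1 / 2 * T h h) + 1 / 2 * (T h h - T a a) := by ring
    rw [e]
    refine (abs_add_le _ _).trans ?_
    rw [abs_mul, abs_of_pos (by norm_num : (0:ℝ) < 1 / 2)]
    have h8 : η * ‖h‖ ^ 2 ≤ η * (2 * ‖a‖) ^ 2 := by gcongr
    have e2 : ‖T‖ * (2 * η / l * ‖a‖) * (2 * ‖a‖ + ‖a‖) = η * (6 * ‖T‖ / l) * ‖a‖ ^ 2 := by ring
    have e3 : η * (3 * ‖T‖ / l + 4) * ‖a‖ ^ 2 =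
      η * (2 * ‖a‖) ^ 2 + 1 / 2 * (η * (6 * ‖T‖ / l) * ‖a‖ ^ 2) := by ring
    rw [e3]
    linarith
  have h8 : ‖a‖ ^ 2 ≤ ‖g‖ ^ 2 / l ^ 2 := by
    rw [le_div_iff₀ (by positivity), ← mul_pow, mul_comm]
    gcongr
  calc |W - 1 / 2 * T a a| ≤ η * (3 * ‖T‖ / l + 4) * (‖g‖ ^ 2 / l ^ 2) := h7.trans (by gcongr)
    _ = η * C * ‖g‖ ^ 2 := by rw [hC]; ring
    _ ≤ ε * ‖g‖ ^ 2 := by gcongr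

/-! ### Uniform law of large numbers through random continuous paths. -/

section Path

variable {𝒵 Θ E : Type*} [MetricSpace Θ] [NormedAddCommGroup E]

/-- A random field with almost surely continuous paths on a compact set, as a random variable with
values in the space of continuous functions. -/
noncomputable def pathOn (K : Set Θ) (F : Θ → 𝒵 → E) (z : 𝒵) : C(K, E) :=
  ContinuousMap.mkD (K.domRestrict fun θ => F θ z) 0

theorem pathOn_apply {K : Set Θ} {F : Θ → 𝒵 → E} {z : 𝒵} (hz : ContinuousOn (fun θ => F θ z) K)
    (θ : K) : pathOn K F z θ = F θ z := by
  unfold pathOn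
  rw [ContinuousMap.mkD_of_continuousOn hz]
  rfl

end Path

section UniformLaw

variable {Ω 𝒵 Θ E : Type*} [MeasurableSpace Ω] [MeasurableSpace 𝒵] [MetricSpace Θ]
  [SecondCountableTopology Θ] [NormedAddCommGroup E] [CompleteSpace E]
  [SecondCountableTopology E]

/-- Evaluation along a dense sequence is a continuous injection of the Polish space `C(K, E)` into
`ℕ → E`, hence a measurable embedding (Lusin–Souslin). The path is thus a measurable function of
countably many coordinates of the field. -/
theorem aestronglyMeasurable_pathOn {μ : Measure 𝒵} {K : Set Θ} (hK : IsCompact K)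
    {F : Θ → 𝒵 → E} (hF : ∀ θ ∈ K, AEStronglyMeasurable (F θ) μ)
    (hc : ∀ᵐ z ∂μ, ContinuousOn (fun θ => F θ z) K) :
    AEStronglyMeasurable (pathOn K F) μ := by
  have : CompactSpace K := isCompact_iff_compactSpace.1 hK
  borelize C(K, E)
  borelize E
  rcases isEmpty_or_nonempty K with hE | hE
  · have : pathOn K F = fun _ => 0 := by
      ext z θ
      exact hE.elim θ
    rw [this]
    exact aestronglyMeasurable_const
  let t := TopologicalSpace.denseSeq K
  let e : C(K, E) → ℕ → E := fun g n => g (t n)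
  have he : MeasurableEmbedding e := by
    refine Continuous.measurableEmbedding ?_ ?_
    · exact continuous_pi fun n => continuous_eval_const (t n)
    · intro g h hgh
      refine ContinuousMap.ext fun θ => ?_
      exact congrFun ((TopologicalSpace.denseRange_denseSeq K).equalizer g.continuous h.continuous
        (funext fun n => congrFun hgh n)) θ
  obtain ⟨r, hr, hre⟩ := he.exists_measurable_extend measurable_id fun _ => ⟨0⟩
  have hH : AEMeasurable (fun z n => F (t n : Θ) z) μ :=
    aemeasurable_pi_iff.2 fun n => (hF _ (t n).2).aemeasurable
  refine AEMeasurable.aestronglyMeasurable ?_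
  refine (hr.comp_aemeasurable hH).congr ?_
  filter_upwards [hc] with z hz
  have : (fun n => F (t n : Θ) z) = e (pathOn K F z) := by
    funext n
    exact (pathOn_apply hz (t n)).symm
  simp only [Function.comp_apply, this]
  exact congrFun hre _

/-- Square integrability of the supremum gives a square integrable dominating function. -/
theorem exists_memLp_two_bound {μ : Measure 𝒵} {K : Set Θ} (hK : IsCompact K)
    {F : Θ → 𝒵 → E} (hF : ∀ θ ∈ K, AEStronglyMeasurable (F θ) μ)
    (hc : ∀ᵐ z ∂μ, ContinuousOn (fun θ => F θ z) K)
    (hsup : ∫⁻ z, ⨆ θ ∈ K, ‖F θ z‖ₑ ^ 2 ∂μ < ⊤) :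
    ∃ b : 𝒵 → ℝ, MemLp b 2 μ ∧ ∀ᵐ z ∂μ, ∀ θ ∈ K, ‖F θ z‖ ≤ b z := by
  have : CompactSpace K := isCompact_iff_compactSpace.1 hK
  have hm := aestronglyMeasurable_pathOn hK hF hc
  refine ⟨fun z => ‖pathOn K F z‖, ?_, ?_⟩
  · refine ⟨hm.norm, ?_⟩
    rw [eLpNorm_lt_top_iff_lintegral_rpow_enorm_lt_top (by norm_num) (by norm_num)]
    refine lt_of_le_of_lt (lintegral_mono_ae ?_) hsup
    filter_upwards [hc] with z hz
    rcases isEmpty_or_nonempty K with hE | hE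
    · have : pathOn K F z = 0 := by
        ext θ
        exact hE.elim θ
      simp [this]
    -- The bound is the sup norm of the path, which is measurable; it is attained by compactness,
    -- hence dominated by the supremum in the hypothesis.
    obtain ⟨θ, -, hθ⟩ := isCompact_univ.exists_isMaxOn Set.univ_nonempty
      (pathOn K F z).continuous.norm.continuousOn
    have h1 : ‖pathOn K F z‖ ≤ ‖pathOn K F z θ‖ :=
      (ContinuousMap.norm_le _ (norm_nonneg _)).2 fun θ' => hθ (Set.mem_univ θ')
    rw [pathOn_apply hz] at h1
    have h2 : ‖pathOn K F z‖ₑ ≤ ‖F θ z‖ₑ := enorm_le_iff_norm_le.2 h1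
    simp only [enorm_norm, ENNReal.toReal_ofNat, ENNReal.rpow_ofNat]
    calc ‖pathOn K F z‖ₑ ^ 2 ≤ ‖F θ z‖ₑ ^ 2 := by gcongr
      _ ≤ _ := le_iSup₂ (f := fun θ (_ : θ ∈ K) => ‖F θ z‖ₑ ^ 2) θ.1 θ.2
  · filter_upwards [hc] with z hz θ hθ
    have := (pathOn K F z).norm_coe_le_norm ⟨θ, hθ⟩
    rwa [pathOn_apply hz] at this

/-- The uniform law of large numbers on a compact set. -/
theorem uniform_law_ae [NormedSpace ℝ E] {P : Measure Ω} [IsProbabilityMeasure P] {μ : Measure 𝒵}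
    {Z : ℕ → Ω → 𝒵} (hZp : ∀ i, MeasurePreserving (Z i) P μ)
    (hind : iIndepFun Z P) {K : Set Θ} (hK : IsCompact K)
    {F : Θ → 𝒵 → E} (hF : ∀ θ ∈ K, AEStronglyMeasurable (F θ) μ)
    (hc : ∀ᵐ z ∂μ, ContinuousOn (fun θ => F θ z) K)
    {b : 𝒵 → ℝ} (hb : Integrable b μ) (hFb : ∀ᵐ z ∂μ, ∀ θ ∈ K, ‖F θ z‖ ≤ b z) :
    ∀ᵐ ω ∂P, TendstoUniformlyOn
      (fun (n : ℕ) θ => (n : ℝ)⁻¹ • ∑ i ∈ Finset.range n, F θ (Z i ω))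
      (fun θ => ∫ z, F θ z ∂μ) atTop K := by
  have : CompactSpace K := isCompact_iff_compactSpace.1 hK
  have hZm : ∀ i, Measurable (Z i) := fun i => (hZp i).measurable
  have hZ : ∀ i, P.map (Z i) = μ := fun i => (hZp i).map_eq
  borelize C(K, E)
  borelize E
  have hm := aestronglyMeasurable_pathOn hK hF hc
  have hint : Integrable (pathOn K F) μ := by
    refine ⟨hm, ContinuousMap.hasFiniteIntegral_of_bound _ b hb.2 ?_⟩
    filter_upwards [hc, hFb] with z hz hz' θ
    rw [pathOn_apply hz]
    exact hz' θ θ.2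
  have hg := hm.aemeasurable
  have hmap : ∀ i, AEMeasurable (pathOn K F) (P.map (Z i)) := fun i => by rw [hZ i]; exact hg
  have hident : ∀ i, IdentDistrib (fun ω => pathOn K F (Z i ω)) (fun ω => pathOn K F (Z 0 ω)) P P :=
    fun i => (IdentDistrib.mk (hZm i).aemeasurable (hZm 0).aemeasurable
      ((hZ i).trans (hZ 0).symm)).comp_of_aemeasurable (hmap i)
  have hind' : Pairwise (Function.onFun (fun X Y => IndepFun X Y P)
      fun i ω => pathOn K F (Z i ω)) := fun i j hij =>
    (hind.indepFun hij).comp₀ (hZm i).aemeasurable (hZm j).aemeasurable (hmap i) (hmap j)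
  have hint0 : Integrable (fun ω => pathOn K F (Z 0 ω)) P := by
    have := hint
    rw [← hZ 0] at this
    exact this.comp_measurable (hZm 0)
  have hE0 : ∫ ω, pathOn K F (Z 0 ω) ∂P = ∫ z, pathOn K F z ∂μ := by
    rw [← hZ 0, integral_map (hZm 0).aemeasurable]
    exact (by rw [hZ 0]; exact hm)
  have hc' : ∀ᵐ ω ∂P, ∀ i, ContinuousOn (fun θ => F θ (Z i ω)) K := by
    refine ae_all_iff.2 fun i => ?_
    rw [← hZ i] at hc
    exact ae_of_ae_map (hZm i).aemeasurable hc
  -- The strong law is applied in the Banach space `C(K, E)`, where convergence in norm is uniform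
  -- convergence. Evaluation at a point is continuous and linear, so it commutes with the Bochner
  -- integral and identifies the limit.
  filter_upwards [strong_law_ae _ hint0 hind' hident, hc'] with ω hω hcω
  rw [tendstoUniformlyOn_iff_tendstoUniformly_comp_coe]
  rw [ContinuousMap.tendsto_iff_tendstoUniformly, hE0] at hω
  convert hω using 1
  · funext n θ
    simp only [ContinuousMap.coe_smul, Pi.smul_apply, ContinuousMap.coe_sum, Finset.sum_apply]
    congr 1
    exact Finset.sum_congr rfl fun i _ => (pathOn_apply (hcω i) θ).symm
  · funext θ
    have h := (ContinuousMap.evalCLM ℝ θ : C(K, E) →L[ℝ] E).integral_comp_comm hint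
    simp only [ContinuousMap.evalCLM_apply] at h
    rw [Function.comp_apply, ← h]
    refine integral_congr_ae ?_
    filter_upwards [hc] with z hz
    exact (pathOn_apply hz θ).symm

end UniformLaw

/-! ### Normalized sums: second moments and uniform square integrability. -/

/-- The normalized sum `n^{-1/2} ∑_{i < n} u(Z_i)`. -/
noncomputable def normSum {Ω 𝒵 : Type*} (Z : ℕ → Ω → 𝒵) (u : 𝒵 → ℝ) (n : ℕ) (ω : Ω) : ℝ :=
  (√n)⁻¹ * ∑ i ∈ Finset.range n, u (Z i ω)

theorem normSum_add {Ω 𝒵 : Type*} (Z : ℕ → Ω → 𝒵) (u v : 𝒵 → ℝ) (n : ℕ) :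
    normSum Z (u + v) n = normSum Z u n + normSum Z v n := by
  ext ω
  simp [normSum, Finset.sum_add_distrib, mul_add]

section NormalizedSums

variable {Ω 𝒵 : Type*} [MeasurableSpace Ω] [MeasurableSpace 𝒵]

variable {P : Measure Ω} {μ : Measure 𝒵} {Z : ℕ → Ω → 𝒵}

theorem memLp_normSum (hZ : ∀ i, MeasurePreserving (Z i) P μ) {u : 𝒵 → ℝ} (hu : MemLp u 2 μ)
    (n : ℕ) : MemLp (normSum Z u n) 2 P := by
  have h : MemLp (fun ω => ∑ i ∈ Finset.range n, u (Z i ω)) 2 P :=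
    memLp_finsetSum _ fun i _ => hu.comp_measurePreserving (hZ i)
  exact h.const_mul _

/-- Independence and the centering of `u` kill the off-diagonal terms; the `n` equal diagonal terms
cancel the factor `1 / n`. The identity is exact for each `n ≥ 1`, which is why no limit theorem in
law is needed. -/
theorem integral_normSum_mul (hZ : ∀ i, MeasurePreserving (Z i) P μ) (hind : iIndepFun Z P)
    {u v : 𝒵 → ℝ} (hu : MemLp u 2 μ) (hv : MemLp v 2 μ) (hu0 : ∫ z, u z ∂μ = 0) {n : ℕ}
    (hn : 1 ≤ n) : ∫ ω, normSum Z u n ω * normSum Z v n ω ∂P = ∫ z, u z * v z ∂μ := by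
  have huZ : ∀ i, MemLp (fun ω => u (Z i ω)) 2 P := fun i => hu.comp_measurePreserving (hZ i)
  have hvZ : ∀ i, MemLp (fun ω => v (Z i ω)) 2 P := fun i => hv.comp_measurePreserving (hZ i)
  have hint : ∀ i j, Integrable (fun ω => u (Z i ω) * v (Z j ω)) P :=
    fun i j => (huZ i).integrable_mul (hvZ j)
  have hcomp : ∀ (w : 𝒵 → ℝ) (i : ℕ), AEStronglyMeasurable w μ →
      ∫ ω, w (Z i ω) ∂P = ∫ z, w z ∂μ := by
    intro w i hw
    rw [← (hZ i).map_eq, integral_map (hZ i).measurable.aemeasurable]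
    rw [(hZ i).map_eq]; exact hw
  have hoff : ∀ i j, ∫ ω, u (Z i ω) * v (Z j ω) ∂P = if i = j then ∫ z, u z * v z ∂μ else 0 := by
    intro i j
    split_ifs with h
    · subst h
      exact hcomp (fun z => u z * v z) i (hu.1.mul hv.1)
    · have hI := (hind.indepFun h).comp₀ (φ := u) (ψ := v) (hZ i).measurable.aemeasurable
        (hZ j).measurable.aemeasurable (by rw [(hZ i).map_eq]; exact hu.1.aemeasurable)
        (by rw [(hZ j).map_eq]; exact hv.1.aemeasurable)
      have := hI.integral_fun_mul_eq_mul_integral (huZ i).1 (hvZ j).1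
      simp only [Function.comp_apply] at this
      rw [this, hcomp u i hu.1, hu0, zero_mul]
  have e : ∀ ω, normSum Z u n ω * normSum Z v n ω =
      (n : ℝ)⁻¹ * ∑ i ∈ Finset.range n, ∑ j ∈ Finset.range n, u (Z i ω) * v (Z j ω) := by
    intro ω
    have hs : (√(n : ℝ))⁻¹ * (√(n : ℝ))⁻¹ = (n : ℝ)⁻¹ := by
      rw [← mul_inv, Real.mul_self_sqrt (Nat.cast_nonneg n)]
    rw [← Finset.sum_mul_sum, ← hs]
    unfold normSum
    ring
  simp_rw [e]
  rw [integral_const_mul, integral_finsetSum _ fun i _ => integrable_finsetSum _ fun j _ => hint i j]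
  have : ∀ i ∈ Finset.range n, ∫ ω, ∑ j ∈ Finset.range n, u (Z i ω) * v (Z j ω) ∂P =
      ∫ z, u z * v z ∂μ := by
    intro i hi
    rw [integral_finsetSum _ fun j _ => hint i j]
    simp_rw [hoff]
    rw [Finset.sum_ite_eq, if_pos hi]
  rw [Finset.sum_congr rfl this, Finset.sum_const, Finset.card_range, nsmul_eq_mul, ← mul_assoc,
    inv_mul_cancel₀ (by positivity), one_mul]

theorem eLpNorm_normSum_le (hZ : ∀ i, MeasurePreserving (Z i) P μ) (hind : iIndepFun Z P)
    {u : 𝒵 → ℝ} (hu : MemLp u 2 μ) (hu0 : ∫ z, u z ∂μ = 0) (n : ℕ) :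
    eLpNorm (normSum Z u n) 2 P ≤ eLpNorm u 2 μ := by
  rcases Nat.eq_zero_or_pos n with rfl | hn
  · have : normSum Z u 0 = 0 := by ext; simp [normSum]
    simp [this]
  · rw [(memLp_normSum hZ hu n).eLpNorm_eq_integral_rpow_norm (by norm_num) (by norm_num),
      hu.eLpNorm_eq_integral_rpow_norm (by norm_num) (by norm_num)]
    have h := integral_normSum_mul hZ hind hu hu hu0 hn
    simp only [ENNReal.toReal_ofNat, Real.rpow_ofNat, Real.norm_eq_abs, sq_abs]
    simp only [← sq] at h
    rw [h]

/-- One term of the exponential series, with `4! = 24`. It converts sub-Gaussian bounds at `±1` into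
a fourth moment bound. -/
theorem pow_four_le_exp_add_exp (x : ℝ) : x ^ 4 ≤ 24 * (Real.exp x + Real.exp (-x)) := by
  have h := Real.pow_div_factorial_le_exp |x| (abs_nonneg x) 4
  have h1 : |x| ^ 4 = x ^ 4 := Even.pow_abs (by decide) x
  have h2 : Real.exp |x| ≤ Real.exp x + Real.exp (-x) := by
    rcases abs_cases x with ⟨h, -⟩ | ⟨h, -⟩ <;> rw [h]
    · linarith [Real.exp_pos (-x)]
    · linarith [Real.exp_pos x]
  rw [h1] at h
  have : (Nat.factorial 4 : ℝ) = 24 := by norm_num [Nat.factorial]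
  rw [this, div_le_iff₀ (by norm_num)] at h
  linarith

/-- Normalized sums of bounded centered variables are bounded in `L⁴`. -/
theorem exists_eLpNorm_four_normSum_le [IsProbabilityMeasure P] [IsProbabilityMeasure μ]
    (hZ : ∀ i, MeasurePreserving (Z i) P μ) (hind : iIndepFun Z P)
    {u : 𝒵 → ℝ} (hu : AEMeasurable u μ) {C : ℝ} (hC : ∀ z, |u z| ≤ C) (hu0 : ∫ z, u z ∂μ = 0) :
    ∃ B : ENNReal, B ≠ ⊤ ∧ ∀ n, eLpNorm (normSum Z u n) 4 P ≤ B := by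
  -- Hoeffding's variance proxy for a centered variable with values in `[−C, C]`. Summing `n`
  -- independent copies and scaling by `n^{-1/2}` returns the same `c`, so the bound is uniform in
  -- `n`.
  set c : NNReal := (‖C - (-C)‖₊ / 2) ^ 2
  have hsub : ∀ i, HasSubgaussianMGF (fun ω => u (Z i ω)) c P := by
    intro i
    refine hasSubgaussianMGF_of_mem_Icc_of_integral_eq_zero
      (hu.comp_quasiMeasurePreserving (hZ i).quasiMeasurePreserving)
      (ae_of_all _ fun ω => abs_le.1 (hC _)) ?_
    have := integral_map (hZ i).measurable.aemeasurable (f := u)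
      (by rw [(hZ i).map_eq]; exact hu.aestronglyMeasurable)
    rw [← this, (hZ i).map_eq, hu0]
  have hindu : iIndepFun (fun i ω => u (Z i ω)) P :=
    hind.comp₀ (fun _ => u) (fun i => (hZ i).measurable.aemeasurable)
      fun i => by rw [(hZ i).map_eq]; exact hu
  have hS : ∀ n : ℕ, 1 ≤ n → HasSubgaussianMGF (normSum Z u n) c P := by
    intro n hn
    have h := (HasSubgaussianMGF.sum_of_iIndepFun hindu (s := Finset.range n)
      fun i _ => hsub i).const_mul (√(n : ℝ))⁻¹
    have aux : ∀ k : NNReal, (k : ℝ) = ((√(n : ℝ))⁻¹) ^ 2 → c = k * ∑ _i ∈ Finset.range n, c := by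
      intro k hk
      ext
      rw [Finset.sum_const, Finset.card_range, nsmul_eq_mul, NNReal.coe_mul, NNReal.coe_mul, hk,
        NNReal.coe_natCast, inv_pow, Real.sq_sqrt (Nat.cast_nonneg n),
        inv_mul_cancel_left₀ (by positivity)]
    change HasSubgaussianMGF (fun ω => (√(n : ℝ))⁻¹ * ∑ i ∈ Finset.range n, u (Z i ω)) c P
    convert h using 1
    exact aux _ rfl
  refine ⟨ENNReal.ofReal ((48 * Real.exp (c / 2)) ^ (4 : ℝ)⁻¹), ENNReal.ofReal_ne_top, fun n => ?_⟩
  rcases Nat.eq_zero_or_pos n with rfl | hn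
  · have : normSum Z u 0 = 0 := by ext; simp [normSum]
    simp [this]
  have hs := hS n hn
  have hL : MemLp (normSum Z u n) 4 P := by simpa using hs.memLp 4
  rw [hL.eLpNorm_eq_integral_rpow_norm (by norm_num) (by norm_num)]
  simp only [ENNReal.toReal_ofNat, Real.rpow_ofNat, Real.norm_eq_abs]
  refine ENNReal.ofReal_le_ofReal (Real.rpow_le_rpow (by positivity) ?_ (by norm_num))
  have hi1 := hs.integrable_exp_mul 1
  have hi2 := hs.integrable_exp_mul (-1)
  have h1 := hs.mgf_le 1
  have h2 := hs.mgf_le (-1)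
  simp only [mgf, one_mul, neg_mul, one_pow, mul_one, even_two, Even.neg_pow] at h1 h2 hi1 hi2
  calc ∫ ω, |normSum Z u n ω| ^ 4 ∂P
      ≤ ∫ ω, 24 * (Real.exp (normSum Z u n ω) + Real.exp (-normSum Z u n ω)) ∂P := by
        refine integral_mono_of_nonneg (ae_of_all _ fun ω => by positivity)
          ((hi1.add hi2).const_mul 24) (ae_of_all _ fun ω => ?_)
        simp only [Even.pow_abs (by decide : Even 4)]
        exact pow_four_le_exp_add_exp _
    _ = 24 * (∫ ω, Real.exp (normSum Z u n ω) ∂P + ∫ ω, Real.exp (-normSum Z u n ω) ∂P) := by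
        rw [integral_const_mul, integral_add hi1 hi2]
    _ ≤ 48 * Real.exp (c / 2) := by linarith

/-- Hölder's inequality gives `‖f 1_s‖₂ ≤ ‖f‖₄ P(s)^{1/4}`, which explains the fourth power in the
choice of `δ`; the `+ 1` keeps the denominator positive. -/
theorem unifIntegrable_two_of_eLpNorm_four_le {f : ℕ → Ω → ℝ}
    (hf : ∀ n, AEStronglyMeasurable (f n) P) {B : ENNReal} (hB : B ≠ ⊤)
    (hfB : ∀ n, eLpNorm (f n) 4 P ≤ B) : UnifIntegrable f 2 P := by
  intro ε hε
  have hB0 : 0 < B.toReal + 1 := by positivity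
  refine ⟨(ε / (B.toReal + 1)) ^ 4, by positivity, fun n s hs hPs => ?_⟩
  rw [eLpNorm_indicator_eq_eLpNorm_restrict hs]
  refine (eLpNorm_le_eLpNorm_mul_rpow_measure_univ (q := 4) (by norm_num) (hf n).restrict).trans ?_
  rw [Measure.restrict_apply_univ]
  have h1 : eLpNorm (f n) 4 (P.restrict s) ≤ ENNReal.ofReal (B.toReal + 1) := by
    refine (eLpNorm_mono_measure _ Measure.restrict_le_self).trans ((hfB n).trans ?_)
    rw [ENNReal.le_ofReal_iff_toReal_le hB hB0.le]
    linarith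
  have h2 : P s ^ (1 / (2 : ENNReal).toReal - 1 / (4 : ENNReal).toReal) ≤
      ENNReal.ofReal (ε / (B.toReal + 1)) := by
    have e : (1 / (2 : ENNReal).toReal - 1 / (4 : ENNReal).toReal) = 1 / 4 := by norm_num
    rw [e]
    calc P s ^ (1 / 4 : ℝ) ≤ (ENNReal.ofReal ((ε / (B.toReal + 1)) ^ 4)) ^ (1 / 4 : ℝ) := by gcongr
      _ = _ := by
        rw [ENNReal.ofReal_rpow_of_nonneg (by positivity) (by norm_num), ← Real.rpow_natCast,
          ← Real.rpow_mul (by positivity)]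
        norm_num
  calc _ ≤ ENNReal.ofReal (B.toReal + 1) * ENNReal.ofReal (ε / (B.toReal + 1)) := by gcongr
    _ = ENNReal.ofReal ε := by
      rw [← ENNReal.ofReal_mul hB0.le]
      congr 1
      field_simp

/-- Normalized sums of centered square integrable variables are uniformly square integrable. -/
theorem unifIntegrable_normSum [IsProbabilityMeasure P] [IsProbabilityMeasure μ]
    (hZ : ∀ i, MeasurePreserving (Z i) P μ) (hind : iIndepFun Z P)
    {u : 𝒵 → ℝ} (hu : MemLp u 2 μ) (hu0 : ∫ z, u z ∂μ = 0) :
    UnifIntegrable (normSum Z u) 2 P := by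
  intro ε hε
  -- Split `u` into a bounded part and a remainder small in `L²`. The sums of the bounded part are
  -- bounded in `L⁴`; those of the remainder stay small in `L²` uniformly in `n`, by
  -- `eLpNorm_normSum_le`. Both parts must be centered, so the mean `m` of `g` is removed; `|m| ≤ ε
  -- / 4` because `u` has mean zero.
  obtain ⟨g, hg, hgL⟩ := hu.exists_simpleFunc_eLpNorm_sub_lt (by norm_num)
    (ε := ENNReal.ofReal (ε / 4)) (by simpa using hε)
  obtain ⟨C, hC⟩ := g.exists_forall_norm_le
  set m := ∫ z, g z ∂μ
  have hgi : Integrable g μ := hgL.integrable (by norm_num)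
  have hui : Integrable u μ := hu.integrable (by norm_num)
  have hb : AEMeasurable (fun z => g z - m) μ := (g.measurable.sub_const m).aemeasurable
  have hb0 : ∫ z, (g z - m) ∂μ = 0 := by
    rw [integral_sub hgi (integrable_const _)]; simp [m]
  have hbC : ∀ z, |g z - m| ≤ C + |m| := fun z => (abs_sub _ _).trans (by gcongr; exact hC z)
  have hbL : MemLp (fun z => g z - m) 2 μ := hgL.sub (memLp_const m)
  have hrL : MemLp (fun z => u z - (g z - m)) 2 μ := hu.sub hbL
  have hr0 : ∫ z, (u z - (g z - m)) ∂μ = 0 := by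
    rw [integral_sub hui (hbL.integrable (by norm_num)), hu0, hb0, sub_zero]
  have hrN : eLpNorm (fun z => u z - (g z - m)) 2 μ ≤ ENNReal.ofReal (ε / 2) := by
    have e : (fun z => u z - (g z - m)) = (u - ⇑g) + fun _ => m := by
      ext z; simp; ring
    have hm : eLpNorm (fun _ : 𝒵 => m) 2 μ ≤ ENNReal.ofReal (ε / 4) := by
      rw [eLpNorm_const _ (by norm_num) (IsProbabilityMeasure.ne_zero μ)]
      simp only [measure_univ, ENNReal.one_rpow, mul_one]
      have : m = -∫ z, (u - ⇑g) z ∂μ := by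
        simp only [Pi.sub_apply]
        rw [integral_sub hui hgi, hu0]; simp [m]
      rw [this, enorm_neg]
      refine (enorm_integral_le_lintegral_enorm _).trans ?_
      rw [← eLpNorm_one_eq_lintegral_enorm]
      exact (eLpNorm_le_eLpNorm_of_exponent_le (by norm_num) (hu.1.sub hgL.1)).trans hg.le
    rw [e]
    refine (eLpNorm_add_le (hu.1.sub hgL.1) aestronglyMeasurable_const (by norm_num)).trans ?_
    calc _ ≤ ENNReal.ofReal (ε / 4) + ENNReal.ofReal (ε / 4) := by gcongr
      _ = _ := by rw [← ENNReal.ofReal_add (by positivity) (by positivity)]; congr 1; ring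
  obtain ⟨B, hB, hBn⟩ := exists_eLpNorm_four_normSum_le hZ hind hb hbC hb0
  obtain ⟨δ, hδ, h⟩ := unifIntegrable_two_of_eLpNorm_four_le
    (fun n => (memLp_normSum hZ hbL n).1) hB hBn (half_pos hε)
  refine ⟨δ, hδ, fun n s hs hPs => ?_⟩
  have e : u = (fun z => g z - m) + fun z => u z - (g z - m) := by ext z; simp
  rw [e, normSum_add, Set.indicator_add']
  refine (eLpNorm_add_le ((memLp_normSum hZ hbL n).1.indicator hs)
    ((memLp_normSum hZ hrL n).1.indicator hs) (by norm_num)).trans ?_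
  have h2 : eLpNorm (s.indicator (normSum Z (fun z => u z - (g z - m)) n)) 2 P ≤
      ENNReal.ofReal (ε / 2) :=
    (eLpNorm_indicator_le _).trans ((eLpNorm_normSum_le hZ hind hrL hr0 n).trans hrN)
  calc _ ≤ ENNReal.ofReal (ε / 2) + ENNReal.ofReal (ε / 2) := add_le_add (h n s hs hPs) h2
    _ = _ := by rw [← ENNReal.ofReal_add (by positivity) (by positivity)]; congr 1; ring

end NormalizedSums

/-! ### Uniform integrability and passage to expectations. -/

section UnifIntegrableAlgebra

variable {Ω ι : Type*} [MeasurableSpace Ω] {P : Measure Ω}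

theorem MeasureTheory.UnifIntegrable.of_abs_le {f g : ι → Ω → ℝ} {p : ENNReal} (hg : UnifIntegrable g p P)
    (h : ∀ i ω, |f i ω| ≤ |g i ω|) : UnifIntegrable f p P := by
  intro ε hε
  obtain ⟨δ, hδ, H⟩ := hg hε
  refine ⟨δ, hδ, fun i s hs hPs => (eLpNorm_mono fun ω => ?_).trans (H i s hs hPs)⟩
  by_cases hω : ω ∈ s
  · simpa [hω] using h i ω
  · simp [hω]

theorem MeasureTheory.UnifIntegrable.norm_family {f : ι → Ω → ℝ} {p : ENNReal} (hf : UnifIntegrable f p P) :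
    UnifIntegrable (fun i ω => |f i ω|) p P :=
  hf.of_abs_le fun i ω => by simp

theorem MeasureTheory.UnifIntegrable.const_mul_real {f : ι → Ω → ℝ} {p : ENNReal} (hf : UnifIntegrable f p P)
    (c : ℝ) : UnifIntegrable (fun i ω => c * f i ω) p P := by
  intro ε hε
  have hc : 0 < |c| + 1 := by positivity
  obtain ⟨δ, hδ, H⟩ := hf (div_pos hε hc)
  refine ⟨δ, hδ, fun i s hs hPs => ?_⟩
  have e : s.indicator (fun ω => c * f i ω) = c • s.indicator (f i) := by
    ext ω; by_cases hω : ω ∈ s <;> simp [hω]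
  rw [e, eLpNorm_const_smul]
  have h1 : ‖c‖ₑ ≤ ENNReal.ofReal (|c| + 1) := by
    rw [Real.enorm_eq_ofReal_abs]; exact ENNReal.ofReal_le_ofReal (by linarith)
  calc _ ≤ ENNReal.ofReal (|c| + 1) * ENNReal.ofReal (ε / (|c| + 1)) := by
        gcongr; exact H i s hs hPs
    _ = _ := by rw [← ENNReal.ofReal_mul hc.le, mul_div_cancel₀ _ hc.ne']

/-- Cauchy–Schwarz on the small set; it suffices that one factor is at most `ε` in `L²` and the
other at most `1`. -/
theorem MeasureTheory.UnifIntegrable.mul_of_two {f g : ι → Ω → ℝ} (hf : UnifIntegrable f 2 P)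
    (hg : UnifIntegrable g 2 P) (hfm : ∀ i, AEStronglyMeasurable (f i) P)
    (hgm : ∀ i, AEStronglyMeasurable (g i) P) : UnifIntegrable (fun i ω => f i ω * g i ω) 1 P := by
  intro ε hε
  obtain ⟨δ, hδ, H⟩ := hf hε
  obtain ⟨δ', hδ', H'⟩ := hg one_pos
  refine ⟨min δ δ', lt_min hδ hδ', fun i s hs hPs => ?_⟩
  have e : s.indicator (fun ω => f i ω * g i ω) = s.indicator (f i) • s.indicator (g i) := by
    ext ω; by_cases hω : ω ∈ s <;> simp [hω]
  rw [e]
  refine (eLpNorm_smul_le_mul_eLpNorm (p := 2) (q := 2) ((hgm i).indicator hs)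
    ((hfm i).indicator hs)).trans ?_
  calc _ ≤ ENNReal.ofReal ε * ENNReal.ofReal 1 :=
        mul_le_mul' (H i s hs (hPs.trans (ENNReal.ofReal_le_ofReal (min_le_left _ _))))
          (H' i s hs (hPs.trans (ENNReal.ofReal_le_ofReal (min_le_right _ _))))
    _ = _ := by simp

theorem MeasureTheory.UnifIntegrable.sum_family {κ : Type*} (s : Finset κ) {f : κ → ι → Ω → ℝ} {p : ENNReal}
    (hp : 1 ≤ p) (hf : ∀ k ∈ s, UnifIntegrable (f k) p P)
    (hm : ∀ k ∈ s, ∀ i, AEStronglyMeasurable (f k i) P) :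
    UnifIntegrable (fun i ω => ∑ k ∈ s, f k i ω) p P := by
  classical
  induction s using Finset.induction_on with
  | empty => intro ε hε; exact ⟨1, one_pos, fun i s hs hPs => by simp⟩
  | insert a s ha ih =>
    simp_rw [Finset.sum_insert ha]
    refine UnifIntegrable.add (hf a (by simp))
      (ih (fun k hk => hf k (by simp [hk])) fun k hk => hm k (by simp [hk])) hp
      (hm a (by simp)) fun i => ?_
    exact Finset.aestronglyMeasurable_fun_sum _ fun k hk => hm k (by simp [hk]) i

end UnifIntegrableAlgebra

/-- If a uniformly integrable sequence is asymptotically a quadratic form in variables that are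
uniformly square integrable with a constant second moment matrix, its expectations converge. -/
theorem tendsto_integral_of_eventually_abs_sub_quadForm_le {Ω κ : Type*} [MeasurableSpace Ω]
    {P : Measure Ω} [IsProbabilityMeasure P] [Fintype κ] {D : ℕ → Ω → ℝ} (hD : UniformIntegrable D 1 P)
    {Z : κ → ℕ → Ω → ℝ} (hZ : ∀ i n, MemLp (Z i n) 2 P) (hZu : ∀ i, UnifIntegrable (Z i) 2 P)
    {V M : κ → κ → ℝ} (hV : ∀ i j n, 1 ≤ n → ∫ ω, Z i n ω * Z j n ω ∂P = V i j)
    (h : ∀ ε > 0, ∀ᵐ ω ∂P, ∀ᶠ n in atTop,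
      |D n ω - 1 / 2 * ∑ i, ∑ j, M i j * (Z i n ω * Z j n ω)| ≤ ε * ∑ i, Z i n ω ^ 2) :
    Tendsto (fun n => ∫ ω, D n ω ∂P) atTop (𝓝 (1 / 2 * ∑ i, ∑ j, M i j * V i j)) := by
  set Q : ℕ → Ω → ℝ := fun n ω => 1 / 2 * ∑ i, ∑ j, M i j * (Z i n ω * Z j n ω) with hQ
  have hZZ : ∀ i j n, Integrable (fun ω => Z i n ω * Z j n ω) P :=
    fun i j n => (hZ i n).integrable_mul (hZ j n)
  have hQi : ∀ n, Integrable (Q n) P := fun n =>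
    (integrable_finsetSum _ fun i _ => integrable_finsetSum _ fun j _ =>
      (hZZ i j n).const_mul _).const_mul _
  have hQE : ∀ n, 1 ≤ n → ∫ ω, Q n ω ∂P = 1 / 2 * ∑ i, ∑ j, M i j * V i j := by
    intro n hn
    rw [hQ, integral_const_mul, integral_finsetSum _ fun i _ => integrable_finsetSum _ fun j _ =>
      (hZZ i j n).const_mul _]
    congr 1
    refine Finset.sum_congr rfl fun i _ => ?_
    rw [integral_finsetSum _ fun j _ => (hZZ i j n).const_mul _]
    refine Finset.sum_congr rfl fun j _ => ?_
    rw [integral_const_mul, hV i j n hn]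
  have hQu : UnifIntegrable Q 1 P := by
    refine UnifIntegrable.const_mul_real ?_ _
    refine UnifIntegrable.sum_family _ le_rfl (fun i _ => ?_) fun i _ n => ?_
    · refine UnifIntegrable.sum_family _ le_rfl (fun j _ => ?_) fun j _ n => ?_
      · exact ((hZu i).mul_of_two (hZu j) (fun n => (hZ i n).1) fun n => (hZ j n).1).const_mul_real _
      · exact ((hZZ i j n).const_mul _).1
    · exact (integrable_finsetSum _ fun j _ => (hZZ i j n).const_mul _).1
  have hDi : ∀ n, Integrable (D n) P := fun n => memLp_one_iff_integrable.1 (hD.memLp n)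
  have hDQi : ∀ n, Integrable (fun ω => |D n ω - Q n ω|) P := fun n => ((hDi n).sub (hQi n)).abs
  set R : ℕ → Ω → ℝ := fun n ω => ∑ i, Z i n ω ^ 2 with hR
  have hRi : ∀ n, Integrable (R n) P := fun n =>
    integrable_finsetSum _ fun i _ => (hZ i n).integrable_sq
  have hRE : ∀ n, 1 ≤ n → ∫ ω, R n ω ∂P = ∑ i, V i i := by
    intro n hn
    rw [hR, integral_finsetSum _ fun i _ => (hZ i n).integrable_sq]
    refine Finset.sum_congr rfl fun i _ => ?_
    rw [← hV i i n hn]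
    simp_rw [sq]
  have hR0 : ∀ n ω, 0 ≤ R n ω := fun n ω => Finset.sum_nonneg fun i _ => sq_nonneg _
  set L := 1 / 2 * ∑ i, ∑ j, M i j * V i j
  rw [Metric.tendsto_atTop]
  intro ε hε
  set s := ∑ i, V i i
  have hs0 : 0 ≤ s := by
    rw [← hRE 1 le_rfl]; exact integral_nonneg (hR0 1)
  -- Here `s` is the constant value of `E[R_n]` for `n ≥ 1`, so the error `η R_n` costs at most `ε /
  -- 2` in expectation.
  set η := ε / (2 * (s + 1))
  have hη : 0 < η := by positivity
  -- The part of `|D − Q|` not covered by `η R`. It is almost surely eventually zero and dominated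
  -- by `|D| + |Q|`, hence uniformly integrable, so Vitali's theorem sends its expectation to zero.
  set T : ℕ → Ω → ℝ := fun n ω => max 0 (|D n ω - Q n ω| - η * R n ω) with hT
  have hTi : ∀ n, Integrable (T n) P := fun n =>
    (integrable_zero _ _ _).sup ((hDQi n).sub ((hRi n).const_mul η))
  have hTu : UnifIntegrable T 1 P := by
    have := (hD.unifIntegrable.norm_family).add hQu.norm_family le_rfl
      (fun n => (hDi n).abs.1) fun n => (hQi n).abs.1
    refine this.of_abs_le fun n ω => ?_
    have h1 := abs_sub (D n ω) (Q n ω)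
    have h2 : 0 ≤ η * R n ω := mul_nonneg hη.le (hR0 n ω)
    change |max 0 (|D n ω - Q n ω| - η * R n ω)| ≤ |(|D n ω| + |Q n ω|)|
    rw [abs_of_nonneg (le_max_left 0 (|D n ω - Q n ω| - η * R n ω)),
      abs_of_nonneg (by positivity : 0 ≤ |D n ω| + |Q n ω|)]
    exact max_le (by positivity) (by linarith)
  have hTt : Tendsto (fun n => ∫ ω, T n ω ∂P) atTop (𝓝 0) := by
    have h1 := tendsto_Lp_finite_of_tendsto_ae le_rfl (by norm_num) (g := fun _ => (0 : ℝ))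
      (fun n => (hTi n).1) (memLp_const 0) hTu (by
        filter_upwards [h η hη] with ω hω
        refine tendsto_const_nhds.congr' ?_
        filter_upwards [hω] with n hn
        simp only [hT]
        rw [max_eq_left]
        exact sub_nonpos.2 hn)
    simpa using tendsto_integral_of_L1' (fun _ => (0 : ℝ)) aestronglyMeasurable_const
      (Eventually.of_forall hTi) h1
  obtain ⟨N, hN⟩ := Metric.tendsto_atTop.1 hTt (ε / 2) (half_pos hε)
  refine ⟨max N 1, fun n hn => ?_⟩
  have hn1 : 1 ≤ n := (le_max_right _ _).trans hn
  have hN' := hN n ((le_max_left _ _).trans hn)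
  rw [Real.dist_eq, sub_zero] at hN'
  rw [Real.dist_eq, ← hQE n hn1, ← integral_sub (hDi n) (hQi n)]
  calc |∫ ω, (D n ω - Q n ω) ∂P| ≤ ∫ ω, |D n ω - Q n ω| ∂P := abs_integral_le_integral_abs
    _ ≤ ∫ ω, (T n ω + η * R n ω) ∂P := by
      refine integral_mono (hDQi n) ((hTi n).add ((hRi n).const_mul η)) fun ω => ?_
      have := le_max_right 0 (|D n ω - Q n ω| - η * R n ω)
      simp only [hT]
      linarith
    _ = ∫ ω, T n ω ∂P + η * s := by
      rw [integral_add (hTi n) ((hRi n).const_mul η), integral_const_mul, hRE n hn1]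
    _ < ε / 2 + ε / 2 := by
      refine add_lt_add_of_lt_of_le ((le_abs_self _).trans_lt hN') ?_
      rw [div_mul_eq_mul_div, div_le_div_iff₀ (by positivity) (by norm_num)]
      nlinarith
    _ = ε := by ring

/-! ### Consistency of minimizers. -/

/-- Minimizers of uniformly converging criteria converge to the unique minimizer of the limit. -/
theorem tendsto_minimizer_of_tendstoUniformlyOn {Θ : Type*} [MetricSpace Θ] {S : Set Θ}
    (hS : IsCompact S) {w : Θ → ℝ} (hw : ContinuousOn w S) {θs : Θ} (hθs : θs ∈ S)
    (hmin : ∀ θ ∈ S, θ ≠ θs → w θs < w θ) {v : ℕ → Θ → ℝ} (hv : TendstoUniformlyOn v w atTop S)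
    {est : ℕ → Θ} (hest : ∀ᶠ n in atTop, est n ∈ S ∧ ∀ θ ∈ S, v n (est n) ≤ v n θ) :
    Tendsto est atTop (𝓝 θs) := by
  rw [Metric.tendsto_nhds]
  intro ε hε
  have hK : IsCompact (S \ Metric.ball θs ε) := hS.diff Metric.isOpen_ball
  rcases (S \ Metric.ball θs ε).eq_empty_or_nonempty with he | hne
  · filter_upwards [hest] with n hn
    by_contra hcon
    have : est n ∈ S \ Metric.ball θs ε := ⟨hn.1, hcon⟩
    rw [he] at this
    exact this
  -- By compactness the minimum outside the ball exceeds `w θs` by a positive gap. A uniform error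
  -- below half the gap excludes a minimizer of `v n` there.
  · obtain ⟨θ₀, hθ₀, hmin₀⟩ := hK.exists_isMinOn hne (hw.mono Set.sdiff_subset)
    have hlt : w θs < w θ₀ := by
      refine hmin θ₀ hθ₀.1 ?_
      rintro rfl
      exact hθ₀.2 (Metric.mem_ball_self hε)
    have hd : 0 < (w θ₀ - w θs) / 2 := by linarith
    filter_upwards [hest, Metric.tendstoUniformlyOn_iff.1 hv _ hd] with n hn hvn
    by_contra hcon
    have h1 : w θ₀ ≤ w (est n) := hmin₀ ⟨hn.1, hcon⟩
    have h2 := hvn _ hn.1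
    have h3 := hvn _ hθs
    have h4 := hn.2 _ hθs
    rw [Real.dist_eq, abs_lt] at h2 h3
    linarith [h2.1, h2.2, h3.1, h3.2]

/-! ### Taylor expansions of the risk and of the empirical gradient. -/

section Taylor

variable {E : Type*} [NormedAddCommGroup E] [NormedSpace ℝ E]

/-- Second order Taylor expansion at a critical point. -/
theorem exists_ball_abs_sub_quadForm_le {w : E → ℝ} {θs : E} {T : E →L[ℝ] E →L[ℝ] ℝ}
    (hd : ∀ᶠ θ in 𝓝 θs, DifferentiableAt ℝ w θ) (hT : HasFDerivAt (fderiv ℝ w) T θs)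
    (h0 : fderiv ℝ w θs = 0) (hsymm : ∀ u v, T u v = T v u) {η : ℝ} (hη : 0 < η) :
    ∀ᶠ θ in 𝓝 θs, |w θ - w θs - 1 / 2 * T (θ - θs) (θ - θs)| ≤ η * ‖θ - θs‖ ^ 2 := by
  have h1 : ∀ᶠ θ in 𝓝 θs, ‖fderiv ℝ w θ - T (θ - θs)‖ ≤ η * ‖θ - θs‖ := by
    have := hT.isLittleO.def hη
    simpa [h0] using this
  obtain ⟨ρ, hρ, hball⟩ := Metric.eventually_nhds_iff_ball.1 (hd.and h1)
  filter_upwards [Metric.ball_mem_nhds θs hρ] with θ hθ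
  -- Only differentiability of the gradient at the single point `θs` is available. The mean value
  -- inequality is applied to the remainder on the closed ball of radius `r`, where its derivative
  -- is at most `η r`.
  set r := ‖θ - θs‖
  have hsub : Metric.closedBall θs r ⊆ Metric.ball θs ρ :=
    Metric.closedBall_subset_ball (by rwa [mem_ball_iff_norm] at hθ)
  have hder : ∀ x ∈ Metric.closedBall θs r, HasFDerivWithinAt
      (fun x => w x - 1 / 2 * T (x - θs) (x - θs)) (fderiv ℝ w x - T (x - θs))
      (Metric.closedBall θs r) x := by
    intro x hx
    have hwx := (hball x (hsub hx)).1.hasFDerivAt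
    have hx1 : HasFDerivAt (fun x => x - θs) (ContinuousLinearMap.id ℝ E) x :=
      (hasFDerivAt_id x).sub_const θs
    have hTx : HasFDerivAt (fun x => T (x - θs)) T x := by
      have : HasFDerivAt (fun x => T (x - θs)) (T.comp (ContinuousLinearMap.id ℝ E)) x :=
        T.hasFDerivAt.comp x hx1
      rwa [ContinuousLinearMap.comp_id] at this
    have hq := (hTx.clm_apply hx1).const_mul (1 / 2)
    refine HasFDerivAt.hasFDerivWithinAt ?_
    refine (hwx.sub hq).congr_fderiv ?_
    ext v
    have h1 := hsymm v x
    have h2 := hsymm v θs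
    simp only [sub_apply, smul_apply, add_apply, map_sub, ContinuousLinearMap.comp_id,
      ContinuousLinearMap.flip_apply, smul_eq_mul, h1, h2]
    ring
  have hbd : ∀ x ∈ Metric.closedBall θs r, ‖fderiv ℝ w x - T (x - θs)‖ ≤ η * r := by
    intro x hx
    refine (hball x (hsub hx)).2.trans ?_
    rw [mem_closedBall_iff_norm] at hx
    gcongr
  have := (convex_closedBall θs r).norm_image_sub_le_of_norm_hasFDerivWithin_le hder hbd
    (Metric.mem_closedBall_self (norm_nonneg _)) (y := θ) (by rw [mem_closedBall_iff_norm])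
  simp only [sub_self, map_zero, mul_zero, sub_zero, Real.norm_eq_abs] at this
  calc |w θ - w θs - 1 / 2 * T (θ - θs) (θ - θs)|
      = |w θ - 1 / 2 * T (θ - θs) (θ - θs) - w θs| := by congr 1; ring
    _ ≤ η * r * r := this
    _ = η * r ^ 2 := by ring

/-- Locally uniform convergence of the second derivatives gives a uniform first order expansion of
the first derivatives. -/
theorem exists_ball_norm_fderiv_sub_le {v : ℕ → E → ℝ} {h : E → E →L[ℝ] E →L[ℝ] ℝ} {θs : E} {δ : ℝ}
    (hδ : 0 < δ) (hv : ∀ n, ∀ θ ∈ Metric.closedBall θs δ, DifferentiableAt ℝ (fderiv ℝ (v n)) θ)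
    (hlim : TendstoUniformlyOn (fun n θ => fderiv ℝ (fderiv ℝ (v n)) θ) h atTop
      (Metric.closedBall θs δ))
    (hcont : ContinuousOn h (Metric.closedBall θs δ)) {η : ℝ} (hη : 0 < η) :
    ∃ ρ > 0, ∀ᶠ n in atTop, ∀ θ ∈ Metric.ball θs ρ,
      ‖fderiv ℝ (v n) θ - fderiv ℝ (v n) θs - h θs (θ - θs)‖ ≤ η * ‖θ - θs‖ := by
  have hc : ContinuousAt h θs := hcont.continuousAt (Metric.closedBall_mem_nhds θs hδ)
  obtain ⟨ρ, hρ, hρh⟩ := Metric.eventually_nhds_iff.1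
    (hc.eventually (Metric.ball_mem_nhds (h θs) (half_pos hη)))
  refine ⟨min ρ δ, lt_min hρ hδ, ?_⟩
  filter_upwards [(Metric.tendstoUniformlyOn_iff (α := E →L[ℝ] E →L[ℝ] ℝ)).1 hlim (η / 2) (half_pos hη)] with n hn θ hθ
  have hsub : Metric.ball θs (min ρ δ) ⊆ Metric.closedBall θs δ :=
    (Metric.ball_subset_ball (min_le_right _ _)).trans Metric.ball_subset_closedBall
  -- On this ball, whose radius does not depend on `n`, the second derivative of `v n` is within `η`
  -- of `h θs`: one half from uniform convergence, one half from continuity of `h`.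
  refine (convex_ball θs (min ρ δ)).norm_image_sub_le_of_norm_hasFDerivWithin_le'
    (f' := fun x => fderiv ℝ (fderiv ℝ (v n)) x)
    (fun x hx => (hv n x (hsub hx)).hasFDerivAt.hasFDerivWithinAt) (fun x hx => ?_)
    (Metric.mem_ball_self (lt_min hρ hδ)) hθ
  have h1 := hn x (hsub hx)
  have h2 := hρh (lt_of_lt_of_le (Metric.mem_ball.1 hx) (min_le_left _ _))
  rw [← dist_eq_norm]
  calc dist (fderiv ℝ (fderiv ℝ (v n)) x) (h θs)
      ≤ dist (h x) (fderiv ℝ (fderiv ℝ (v n)) x) + dist (h x) (h θs) := dist_triangle_left _ _ _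
    _ ≤ η := by linarith

end Taylor

/-! ### Bilinear forms in coordinates. -/

section Coordinates

variable {q : ℕ}

theorem sum_smul_single (x : RVec q) : ∑ i, x i • EuclideanSpace.single i (1 : ℝ) = x := by
  ext j
  simp [Pi.single_apply]

/-- The matrix of a bilinear form in the canonical basis. -/
noncomputable def bilinMatrix (T : RVec q →L[ℝ] RVec q →L[ℝ] ℝ) : Matrix (Fin q) (Fin q) ℝ :=
  Matrix.of fun i j => T (EuclideanSpace.single i 1) (EuclideanSpace.single j 1)

theorem bilin_eq_sum (T : RVec q →L[ℝ] RVec q →L[ℝ] ℝ) (u v : RVec q) :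
    T u v = ∑ i, ∑ j, u i * bilinMatrix T i j * v j := by
  conv_lhs => rw [← sum_smul_single u, ← sum_smul_single v]
  simp only [map_sum, map_smul, sum_apply, smul_apply,
    smul_eq_mul, bilinMatrix, Matrix.of_apply, Finset.mul_sum]
  rw [Finset.sum_comm]
  refine Finset.sum_congr rfl fun i _ => Finset.sum_congr rfl fun j _ => by ring

/-- Positive definiteness includes the Hermitian property, so symmetry of the second derivative
comes from the assumption on `H` rather than from Schwarz's theorem. -/
theorem bilin_symm {T : RVec q →L[ℝ] RVec q →L[ℝ] ℝ} (hT : (bilinMatrix T).PosDef) (u v : RVec q) :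
    T u v = T v u := by
  rw [bilin_eq_sum, bilin_eq_sum, Finset.sum_comm]
  refine Finset.sum_congr rfl fun i _ => Finset.sum_congr rfl fun j _ => ?_
  have : bilinMatrix T j i = bilinMatrix T i j := by simpa using hT.isHermitian.apply i j
  rw [this]; ring

theorem exists_pos_coercive {T : RVec q →L[ℝ] RVec q →L[ℝ] ℝ} (hT : (bilinMatrix T).PosDef) :
    ∃ l > 0, ∀ h, l * ‖h‖ ^ 2 ≤ T h h := by
  have hpos : ∀ u : RVec q, u ≠ 0 → 0 < T u u := by
    intro u hu
    have h := hT.dotProduct_mulVec_pos (x := fun i => u i) (fun h => hu (by ext i; exact congrFun h i))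
    rw [bilin_eq_sum]
    refine h.trans_le (le_of_eq ?_)
    simp only [dotProduct, Matrix.mulVec, Finset.mul_sum, Pi.star_apply, star_trivial]
    exact Finset.sum_congr rfl fun i _ => Finset.sum_congr rfl fun j _ => by ring
  -- The sphere is empty only for `q = 0`, where every constant works; otherwise the constant is the
  -- minimum of the form on the sphere.
  rcases (Metric.sphere (0 : RVec q) 1).eq_empty_or_nonempty with he | hne
  · refine ⟨1, one_pos, fun h => ?_⟩
    rcases eq_or_ne h 0 with rfl | hh
    · simp
    · exfalso
      have : ‖h‖⁻¹ • h ∈ Metric.sphere (0 : RVec q) 1 := by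
        simp [norm_smul, hh]
      rw [he] at this
      exact this
  · obtain ⟨u, hu, hmin⟩ := (isCompact_sphere (0 : RVec q) 1).exists_isMinOn hne
      (f := fun u => T u u) (by fun_prop)
    have hu0 : u ≠ 0 := by
      rintro rfl
      simp at hu
    refine ⟨T u u, hpos u hu0, fun h => ?_⟩
    rcases eq_or_ne h 0 with rfl | hh
    · simp
    · have hh' : 0 < ‖h‖ := norm_pos_iff.2 hh
      have h1 : T u u ≤ T (‖h‖⁻¹ • h) (‖h‖⁻¹ • h) := hmin (by simp [norm_smul, hh])
      simp only [map_smul, smul_apply, smul_eq_mul] at h1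
      calc T u u * ‖h‖ ^ 2 ≤ (‖h‖⁻¹ * (‖h‖⁻¹ * T h h)) * ‖h‖ ^ 2 := by gcongr
        _ = T h h := by field_simp

/-- The solution of the linear equation attached to a positive definite bilinear form. -/
theorem exists_bilin_solution {T : RVec q →L[ℝ] RVec q →L[ℝ] ℝ} (hT : (bilinMatrix T).PosDef)
    (g : RVec q →L[ℝ] ℝ) : ∃ a, T a = -g ∧ T a a = ∑ i, ∑ j, (bilinMatrix T)⁻¹ i j *
      (g (EuclideanSpace.single i 1) * g (EuclideanSpace.single j 1)) := by
  set H := bilinMatrix T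
  set γ : Fin q → ℝ := fun i => g (EuclideanSpace.single i 1)
  have hg : ∀ v : RVec q, g v = ∑ i, v i * γ i := by
    intro v
    conv_lhs => rw [← sum_smul_single v]
    simp [γ]
  have hdet : IsUnit H.det := (Matrix.isUnit_iff_isUnit_det _).1 hT.isUnit
  -- With `γ` the coordinates of `g`, the solution is `a = −H⁻¹ γ`, and `T a a = −g a = γᵀ H⁻¹ γ`.
  set α : Fin q → ℝ := H⁻¹.mulVec γ
  set a : RVec q := WithLp.toLp 2 (-α)
  have ha : ∀ i, a i = -α i := fun i => rfl
  have hHα : ∀ j, ∑ i, α i * H i j = γ j := by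
    intro j
    have h1 : H.mulVec α = γ := by
      rw [Matrix.mulVec_mulVec, Matrix.mul_nonsing_inv _ hdet, Matrix.one_mulVec]
    rw [← congrFun h1 j]
    simp only [Matrix.mulVec, dotProduct]
    refine Finset.sum_congr rfl fun i _ => ?_
    have : H j i = H i j := by simpa using hT.isHermitian.apply i j
    rw [this, mul_comm]
  have hTa : T a = -g := by
    ext v
    rw [bilin_eq_sum, Finset.sum_comm, neg_apply, hg, ← Finset.sum_neg_distrib]
    refine Finset.sum_congr rfl fun j _ => ?_
    rw [← Finset.sum_mul, ← hHα j]
    simp only [ha, neg_mul, Finset.sum_neg_distrib]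
    ring
  refine ⟨a, hTa, ?_⟩
  rw [hTa, neg_apply, hg, ← Finset.sum_neg_distrib]
  refine Finset.sum_congr rfl fun i _ => ?_
  simp only [ha, α, Matrix.mulVec, dotProduct]
  rw [neg_mul, neg_neg, Finset.sum_mul]
  exact Finset.sum_congr rfl fun j _ => by simp only [γ]; ring

theorem norm_sq_functional_le (g : RVec q →L[ℝ] ℝ) :
    ‖g‖ ^ 2 ≤ ∑ i, g (EuclideanSpace.single i 1) ^ 2 := by
  set s := ∑ i, g (EuclideanSpace.single i 1) ^ 2
  have hs : 0 ≤ s := Finset.sum_nonneg fun i _ => sq_nonneg _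
  have : ‖g‖ ≤ √s := by
    refine g.opNorm_le_bound (Real.sqrt_nonneg _) fun x => ?_
    have h1 : g x = ∑ i, x i * g (EuclideanSpace.single i 1) := by
      conv_lhs => rw [← sum_smul_single x]
      simp
    have h2 := Finset.sum_mul_sq_le_sq_mul_sq Finset.univ (fun i => x i)
      fun i => g (EuclideanSpace.single i 1)
    rw [← h1] at h2
    have h3 : ∑ i, x i ^ 2 = ‖x‖ ^ 2 := by rw [EuclideanSpace.norm_sq_eq]; simp
    rw [h3] at h2
    refine abs_le_of_sq_le_sq ?_ (by positivity) |>.trans_eq rfl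
    rw [mul_pow, Real.sq_sqrt hs]
    linarith
  calc ‖g‖ ^ 2 ≤ √s ^ 2 := by gcongr
    _ = s := Real.sq_sqrt hs

end Coordinates

/-! ### Smooth losses and differentiation under the integral. -/

/-- Measurability of the derivative with respect to a parameter. -/
theorem aestronglyMeasurable_fderiv_param {𝒵 F : Type*} [MeasurableSpace 𝒵] [NormedAddCommGroup F]
    [NormedSpace ℝ F] {q : ℕ} {μ : Measure 𝒵} {G : RVec q → 𝒵 → F} {U : Set (RVec q)}
    (hG : ∀ θ ∈ U, AEStronglyMeasurable (G θ) μ) {θ : RVec q} (hU : U ∈ 𝓝 θ)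
    (hd : ∀ᵐ z ∂μ, DifferentiableAt ℝ (fun η => G η z) θ) :
    AEStronglyMeasurable (fun z => fderiv ℝ (fun η => G η z) θ) μ := by
  classical
  have hdir : ∀ v : RVec q, AEStronglyMeasurable (fun z => fderiv ℝ (fun η => G η z) θ v) μ := by
    intro v
    have hc : Tendsto (fun n : ℕ => ‖(n : ℝ)‖) atTop atTop := by
      simpa using tendsto_natCast_atTop_atTop (R := ℝ)
    have hθv : ∀ᶠ n : ℕ in atTop, θ + (n : ℝ)⁻¹ • v ∈ U := by
      have h1 : Tendsto (fun n : ℕ => θ + (n : ℝ)⁻¹ • v) atTop (𝓝 θ) := by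
        have := (tendsto_inv_atTop_nhds_zero_nat (𝕜 := ℝ)).smul_const v
        simpa using this.const_add θ
      exact h1.eventually hU
    -- Directional derivatives are limits of difference quotients with step `1 / n`. The value `0`
    -- covers the finitely many `n` for which the shifted point leaves `U`, where measurability is
    -- not known.
    refine aestronglyMeasurable_of_tendsto_ae atTop
      (f := fun (n : ℕ) z => if θ + (n : ℝ)⁻¹ • v ∈ U then
        (n : ℝ) • (G (θ + (n : ℝ)⁻¹ • v) z - G θ z) else 0) (fun n => ?_) ?_
    · split_ifs with h
      · exact ((hG _ h).sub (hG θ (mem_of_mem_nhds hU))).const_smul _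
      · exact aestronglyMeasurable_const
    · filter_upwards [hd] with z hz
      refine (hz.hasFDerivAt.lim v hc).congr' ?_
      filter_upwards [hθv] with n hn
      rw [if_pos hn]
  have e : (fun z => fderiv ℝ (fun η => G η z) θ) = fun z => ∑ i : Fin q,
      ContinuousLinearMap.smulRightL ℝ (RVec q) F (EuclideanSpace.proj i)
        (fderiv ℝ (fun η => G η z) θ (EuclideanSpace.single i 1)) := by
    ext z v
    conv_lhs => rw [← sum_smul_single v]
    simp [sum_apply]
  rw [e]
  exact Finset.aestronglyMeasurable_fun_sum _ fun i _ =>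
    (ContinuousLinearMap.continuous _).comp_aestronglyMeasurable (hdir _)

/-- A loss function that is almost surely continuous on `S` and `C²` in the interior of `S`, with
integrable bounds on the loss and, near `θs`, on its first two derivatives. -/
structure SmoothLoss {𝒵 : Type*} [MeasurableSpace 𝒵] {q : ℕ} (μ : Measure 𝒵)
    (ψ : RVec q → 𝒵 → ℝ) (S : Set (RVec q)) (θs : RVec q) (δ : ℝ) : Prop where
  aestronglyMeasurable : ∀ θ, AEStronglyMeasurable (ψ θ) μ
  isCompact : IsCompact S
  pos : 0 < δ
  closedBall_subset : Metric.closedBall θs δ ⊆ interior S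
  continuousOn : ∀ᵐ z ∂μ, ContinuousOn (fun θ => ψ θ z) S
  contDiffOn : ∀ᵐ z ∂μ, ContDiffOn ℝ 2 (fun θ => ψ θ z) (interior S)
  bound : ∃ b : 𝒵 → ℝ, Integrable b μ ∧ (∀ᵐ z ∂μ, ∀ θ ∈ S, ‖ψ θ z‖ ≤ b z) ∧
    (∀ᵐ z ∂μ, ∀ θ ∈ Metric.closedBall θs δ, ‖fderiv ℝ (fun η => ψ η z) θ‖ ≤ b z) ∧
    ∀ᵐ z ∂μ, ∀ θ ∈ Metric.closedBall θs δ, ‖fderiv ℝ (fderiv ℝ fun η => ψ η z) θ‖ ≤ b z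

section ContDiffTwo

variable {E : Type*} [NormedAddCommGroup E] [NormedSpace ℝ E] {g : E → ℝ} {U : Set E}

theorem ContDiffOn.differentiableAt_of_two (hg : ContDiffOn ℝ 2 g U) (hU : IsOpen U) {θ : E}
    (hθ : θ ∈ U) : DifferentiableAt ℝ g θ :=
  (hg.contDiffAt (hU.mem_nhds hθ)).differentiableAt (by norm_num)

theorem ContDiffOn.differentiableAt_fderiv_of_two (hg : ContDiffOn ℝ 2 g U) (hU : IsOpen U) {θ : E}
    (hθ : θ ∈ U) : DifferentiableAt ℝ (fderiv ℝ g) θ :=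
  ((hg.contDiffAt (hU.mem_nhds hθ)).fderiv_right (m := 1) (by norm_num)).differentiableAt
    (by norm_num)

theorem ContDiffOn.continuousOn_fderiv_fderiv_of_two (hg : ContDiffOn ℝ 2 g U) (hU : IsOpen U) :
    ContinuousOn (fderiv ℝ (fderiv ℝ g)) U := by
  intro θ hθ
  have h1 := (hg.contDiffAt (hU.mem_nhds hθ)).fderiv_right (m := 1) (by norm_num)
  exact (h1.fderiv_right (m := 0) (by norm_num)).continuousAt.continuousWithinAt

end ContDiffTwo

namespace SmoothLoss

variable {𝒵 : Type*} [MeasurableSpace 𝒵] {q : ℕ} {μ : Measure 𝒵} {ψ : RVec q → 𝒵 → ℝ}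
  {S : Set (RVec q)} {θs : RVec q} {δ : ℝ}

theorem aestronglyMeasurable_fderiv (h : SmoothLoss μ ψ S θs δ) {θ : RVec q}
    (hθ : θ ∈ interior S) : AEStronglyMeasurable (fun z => fderiv ℝ (fun η => ψ η z) θ) μ := by
  refine aestronglyMeasurable_fderiv_param (U := Set.univ) (fun θ _ => h.aestronglyMeasurable θ)
    univ_mem ?_
  filter_upwards [h.contDiffOn] with z hz using hz.differentiableAt_of_two isOpen_interior hθ

theorem aestronglyMeasurable_fderiv_fderiv (h : SmoothLoss μ ψ S θs δ) {θ : RVec q}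
    (hθ : θ ∈ interior S) :
    AEStronglyMeasurable (fun z => fderiv ℝ (fderiv ℝ fun η => ψ η z) θ) μ := by
  refine aestronglyMeasurable_fderiv_param (G := fun θ z => fderiv ℝ (fun η => ψ η z) θ)
    (U := interior S) (fun θ hθ => h.aestronglyMeasurable_fderiv hθ)
    (isOpen_interior.mem_nhds hθ) ?_
  filter_upwards [h.contDiffOn] with z hz using
    hz.differentiableAt_fderiv_of_two isOpen_interior hθ

theorem hasFDerivAt_integral (h : SmoothLoss μ ψ S θs δ) {θ : RVec q}
    (hθ : θ ∈ Metric.ball θs δ) :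
    HasFDerivAt (fun θ => ∫ z, ψ θ z ∂μ) (∫ z, fderiv ℝ (fun η => ψ η z) θ ∂μ) θ := by
  obtain ⟨b, hb, hb0, hb1, -⟩ := h.bound
  have hθS := h.closedBall_subset (Metric.ball_subset_closedBall hθ)
  refine hasFDerivAt_integral_of_dominated_of_fderiv_le (bound := b)
    (F' := fun θ z => fderiv ℝ (fun η => ψ η z) θ) (Metric.isOpen_ball.mem_nhds hθ)
    (Eventually.of_forall h.aestronglyMeasurable) ?_ (h.aestronglyMeasurable_fderiv hθS) ?_ hb ?_
  · refine hb.mono' (h.aestronglyMeasurable θ) ?_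
    filter_upwards [hb0] with z hz using hz θ (interior_subset hθS)
  · filter_upwards [hb1] with z hz x hx using hz x (Metric.ball_subset_closedBall hx)
  · filter_upwards [h.contDiffOn] with z hz x hx
    exact (hz.differentiableAt_of_two isOpen_interior
      (h.closedBall_subset (Metric.ball_subset_closedBall hx))).hasFDerivAt

theorem hasFDerivAt_integral_fderiv (h : SmoothLoss μ ψ S θs δ) {θ : RVec q}
    (hθ : θ ∈ Metric.ball θs δ) :
    HasFDerivAt (fun θ => ∫ z, fderiv ℝ (fun η => ψ η z) θ ∂μ)
      (∫ z, fderiv ℝ (fderiv ℝ fun η => ψ η z) θ ∂μ) θ := by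
  obtain ⟨b, hb, -, hb1, hb2⟩ := h.bound
  have hθS := h.closedBall_subset (Metric.ball_subset_closedBall hθ)
  refine hasFDerivAt_integral_of_dominated_of_fderiv_le (bound := b)
    (F' := fun θ z => fderiv ℝ (fderiv ℝ fun η => ψ η z) θ) (Metric.isOpen_ball.mem_nhds hθ)
    ?_ ?_ (h.aestronglyMeasurable_fderiv_fderiv hθS) ?_ hb ?_
  · filter_upwards [Metric.isOpen_ball.mem_nhds hθ] with x hx using
      h.aestronglyMeasurable_fderiv (h.closedBall_subset (Metric.ball_subset_closedBall hx))
  · refine hb.mono' (h.aestronglyMeasurable_fderiv hθS) ?_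
    filter_upwards [hb1] with z hz using hz θ (Metric.ball_subset_closedBall hθ)
  · filter_upwards [hb2] with z hz x hx using hz x (Metric.ball_subset_closedBall hx)
  · filter_upwards [h.contDiffOn] with z hz x hx
    exact (hz.differentiableAt_fderiv_of_two isOpen_interior
      (h.closedBall_subset (Metric.ball_subset_closedBall hx))).hasFDerivAt

theorem mem_ball (h : SmoothLoss μ ψ S θs δ) : θs ∈ Metric.ball θs δ := Metric.mem_ball_self h.pos

theorem mem_interior (h : SmoothLoss μ ψ S θs δ) : θs ∈ interior S :=
  h.closedBall_subset (Metric.mem_closedBall_self h.pos.le)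

theorem fderiv_eventuallyEq (h : SmoothLoss μ ψ S θs δ) :
    fderiv ℝ (fun θ => ∫ z, ψ θ z ∂μ) =ᶠ[𝓝 θs] fun θ => ∫ z, fderiv ℝ (fun η => ψ η z) θ ∂μ := by
  filter_upwards [Metric.isOpen_ball.mem_nhds h.mem_ball] with θ hθ using
    (h.hasFDerivAt_integral hθ).fderiv

/-- Differentiating twice under the integral: the Hessian of the risk is the mean Hessian, which is
also the limit in the uniform law for the empirical Hessians. -/
theorem hasFDerivAt_fderiv (h : SmoothLoss μ ψ S θs δ) :
    HasFDerivAt (fderiv ℝ fun θ => ∫ z, ψ θ z ∂μ)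
      (∫ z, fderiv ℝ (fderiv ℝ fun η => ψ η z) θs ∂μ) θs :=
  (h.hasFDerivAt_integral_fderiv h.mem_ball).congr_of_eventuallyEq h.fderiv_eventuallyEq

theorem continuousOn_integral (h : SmoothLoss μ ψ S θs δ) :
    ContinuousOn (fun θ => ∫ z, ψ θ z ∂μ) S := by
  obtain ⟨b, hb, hb0, -⟩ := h.bound
  refine continuousOn_of_dominated (fun θ _ => h.aestronglyMeasurable θ) (fun θ hθ => ?_) hb
    h.continuousOn
  filter_upwards [hb0] with z hz using hz θ hθ

theorem continuousOn_integral_fderiv_fderiv (h : SmoothLoss μ ψ S θs δ) :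
    ContinuousOn (fun θ => ∫ z, fderiv ℝ (fderiv ℝ fun η => ψ η z) θ ∂μ)
      (Metric.closedBall θs δ) := by
  obtain ⟨b, hb, -, -, hb2⟩ := h.bound
  refine continuousOn_of_dominated (bound := b)
    (fun θ hθ => h.aestronglyMeasurable_fderiv_fderiv (h.closedBall_subset hθ))
    (fun θ hθ => ?_) hb ?_
  · filter_upwards [hb2] with z hz using hz θ hθ
  · filter_upwards [h.contDiffOn] with z hz using
      (hz.continuousOn_fderiv_fderiv_of_two isOpen_interior).mono h.closedBall_subset

end SmoothLoss

/-! ### Empirical risk and the excess risk of its minimizers. -/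

section Empirical

variable {𝒵 : Type*} {q : ℕ}

/-- The empirical mean of the loss over a sample. -/
noncomputable def empRisk (ψ : RVec q → 𝒵 → ℝ) (z : ℕ → 𝒵) (n : ℕ) (θ : RVec q) : ℝ :=
  (n : ℝ)⁻¹ • ∑ i ∈ Finset.range n, ψ θ (z i)

variable {ψ : RVec q → 𝒵 → ℝ} {z : ℕ → 𝒵} {U : Set (RVec q)}

theorem hasFDerivAt_empRisk (hU : IsOpen U)
    (hz : ∀ i, ContDiffOn ℝ 2 (fun θ => ψ θ (z i)) U) (n : ℕ) {θ : RVec q} (hθ : θ ∈ U) :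
    HasFDerivAt (empRisk ψ z n)
      ((n : ℝ)⁻¹ • ∑ i ∈ Finset.range n, fderiv ℝ (fun η => ψ η (z i)) θ) θ :=
  (HasFDerivAt.fun_sum fun i _ =>
    ((hz i).differentiableAt_of_two hU hθ).hasFDerivAt).const_smul (n : ℝ)⁻¹

theorem hasFDerivAt_fderiv_empRisk (hU : IsOpen U)
    (hz : ∀ i, ContDiffOn ℝ 2 (fun θ => ψ θ (z i)) U) (n : ℕ) {θ : RVec q} (hθ : θ ∈ U) :
    HasFDerivAt (fderiv ℝ (empRisk ψ z n))
      ((n : ℝ)⁻¹ • ∑ i ∈ Finset.range n, fderiv ℝ (fderiv ℝ fun η => ψ η (z i)) θ) θ := by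
  have h1 : HasFDerivAt
      (fun θ => (n : ℝ)⁻¹ • ∑ i ∈ Finset.range n, fderiv ℝ (fun η => ψ η (z i)) θ)
      ((n : ℝ)⁻¹ • ∑ i ∈ Finset.range n, fderiv ℝ (fderiv ℝ fun η => ψ η (z i)) θ) θ :=
    (HasFDerivAt.fun_sum fun i _ =>
      ((hz i).differentiableAt_fderiv_of_two hU hθ).hasFDerivAt).const_smul (n : ℝ)⁻¹
  refine h1.congr_of_eventuallyEq ?_
  filter_upwards [hU.mem_nhds hθ] with x hx using (hasFDerivAt_empRisk hU hz n hx).fderiv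

end Empirical

section MEstimator

variable {Ω 𝒵 : Type*} [MeasurableSpace Ω] [MeasurableSpace 𝒵] {q : ℕ} {P : Measure Ω}
  [IsProbabilityMeasure P] {μ : Measure 𝒵} {ψ : RVec q → 𝒵 → ℝ} {S : Set (RVec q)} {θs : RVec q}
  {δ : ℝ} {Z : ℕ → Ω → 𝒵}

/-- The excess risk of a minimizer of the empirical risk is asymptotically a quadratic form in the
score. -/
theorem ae_eventually_abs_excess_sub_le (h : SmoothLoss μ ψ S θs δ)
    (hZ : ∀ i, MeasurePreserving (Z i) P μ) (hind : iIndepFun Z P)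
    (hmin : ∀ θ ∈ S, θ ≠ θs → ∫ z, ψ θs z ∂μ < ∫ z, ψ θ z ∂μ)
    (hH : (hessianMatrix (fun θ => ∫ z, ψ θ z ∂μ) θs).PosDef) {est : ℕ → Ω → RVec q}
    (hest : ∀ n, 1 ≤ n → ∀ᵐ ω ∂P, est n ω ∈ S ∧
      ∀ θ ∈ S, empRisk ψ (fun i => Z i ω) n (est n ω) ≤ empRisk ψ (fun i => Z i ω) n θ)
    {ε : ℝ} (hε : 0 < ε) :
    ∀ᵐ ω ∂P, ∀ᶠ n : ℕ in atTop,
      |(∫ z, ψ (est n ω) z ∂μ) - (∫ z, ψ θs z ∂μ) - 1 / 2 * ∑ i, ∑ j,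
        (hessianMatrix (fun θ => ∫ z, ψ θ z ∂μ) θs)⁻¹ i j *
          (fderiv ℝ (empRisk ψ (fun i => Z i ω) n) θs (EuclideanSpace.single i 1) *
            fderiv ℝ (empRisk ψ (fun i => Z i ω) n) θs (EuclideanSpace.single j 1))| ≤
        ε * ‖fderiv ℝ (empRisk ψ (fun i => Z i ω) n) θs‖ ^ 2 := by
  set w : RVec q → ℝ := fun θ => ∫ z, ψ θ z ∂μ with hw
  set T : RVec q →L[ℝ] RVec q →L[ℝ] ℝ := ∫ z, fderiv ℝ (fderiv ℝ fun η => ψ η z) θs ∂μ with hT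
  have hHT : hessianMatrix w θs = bilinMatrix T := by
    unfold hessianMatrix bilinMatrix
    rw [h.hasFDerivAt_fderiv.fderiv]
  rw [hHT] at hH ⊢
  have hsymm := bilin_symm hH
  obtain ⟨l, hl, hcoer⟩ := exists_pos_coercive hH
  obtain ⟨η, hη, key⟩ := exists_pos_abs_sub_quadForm_le T hsymm hl hcoer hε
  obtain ⟨b, hb, hb0, hb1, hb2⟩ := h.bound
  have hS0 : θs ∈ S := interior_subset h.mem_interior
  have hwmin : IsLocalMin w θs := by
    filter_upwards [mem_interior_iff_mem_nhds.1 h.mem_interior] with θ hθ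
    rcases eq_or_ne θ θs with rfl | hne
    · exact le_rfl
    · exact (hmin θ hθ hne).le
  have hTaylor := exists_ball_abs_sub_quadForm_le (w := w) (T := T) (θs := θs)
    (by filter_upwards [Metric.isOpen_ball.mem_nhds h.mem_ball] with θ hθ using
      (h.hasFDerivAt_integral hθ).differentiableAt)
    h.hasFDerivAt_fderiv hwmin.fderiv_eq_zero hsymm hη
  have hsm : ∀ᵐ ω ∂P, ∀ i, ContDiffOn ℝ 2 (fun θ => ψ θ (Z i ω)) (interior S) :=
    ae_all_iff.2 fun i => (hZ i).quasiMeasurePreserving.ae h.contDiffOn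
  have hest' : ∀ᵐ ω ∂P, ∀ n, 1 ≤ n → est n ω ∈ S ∧
      ∀ θ ∈ S, empRisk ψ (fun i => Z i ω) n (est n ω) ≤ empRisk ψ (fun i => Z i ω) n θ := by
    refine ae_all_iff.2 fun n => ?_
    by_cases hn : 1 ≤ n
    · filter_upwards [hest n hn] with ω hω _ using hω
    · exact ae_of_all _ fun ω hn' => absurd hn' hn
  -- The uniform law is used twice: for the loss on `S`, giving consistency, and for its Hessian on
  -- a closed ball, giving the expansion of the empirical gradient.
  have hU0 := uniform_law_ae hZ hind h.isCompact (F := ψ)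
    (fun θ _ => h.aestronglyMeasurable θ) h.continuousOn hb hb0
  have hU2 := uniform_law_ae hZ hind (isCompact_closedBall θs δ)
    (F := fun θ z => fderiv ℝ (fderiv ℝ fun η => ψ η z) θ)
    (fun θ hθ => h.aestronglyMeasurable_fderiv_fderiv (h.closedBall_subset hθ))
    (by filter_upwards [h.contDiffOn] with z hz using
      (hz.continuousOn_fderiv_fderiv_of_two isOpen_interior).mono h.closedBall_subset) hb hb2
  filter_upwards [hsm, hest', hU0, hU2] with ω hsmω hestω hU0ω hU2ω
  set v : ℕ → RVec q → ℝ := empRisk ψ (fun i => Z i ω) with hv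
  have hcons : Tendsto (fun n => est n ω) atTop (𝓝 θs) := by
    refine tendsto_minimizer_of_tendstoUniformlyOn h.isCompact h.continuousOn_integral hS0 hmin
      (v := v) hU0ω ?_
    filter_upwards [eventually_ge_atTop 1] with n hn using hestω n hn
  have hint : ∀ n, ∀ θ ∈ interior S, HasFDerivAt (fderiv ℝ (v n)) _ θ :=
    fun n θ hθ => hasFDerivAt_fderiv_empRisk isOpen_interior hsmω n hθ
  obtain ⟨ρ, hρ, hexp⟩ := exists_ball_norm_fderiv_sub_le h.pos (v := v)
    (h := fun θ => ∫ z, fderiv ℝ (fderiv ℝ fun η => ψ η z) θ ∂μ)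
    (fun n θ hθ => (hint n θ (h.closedBall_subset hθ)).differentiableAt)
    (hU2ω.congr (Eventually.of_forall fun n θ hθ =>
      (hint n θ (h.closedBall_subset hθ)).fderiv.symm))
    h.continuousOn_integral_fderiv_fderiv hη
  filter_upwards [hcons.eventually hTaylor, hcons.eventually (Metric.ball_mem_nhds θs hρ), hexp,
    hcons.eventually (isOpen_interior.mem_nhds h.mem_interior), eventually_ge_atTop 1]
    with n h1 h2 h3 h4 hn
  -- Consistency puts the minimizer in the interior of `S`, hence it is a critical point. The
  -- gradient expansion then reads `‖g + T h‖ ≤ η ‖h‖`, as the elimination lemma requires.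
  have hcrit : fderiv ℝ (v n) (est n ω) = 0 := by
    refine IsLocalMin.fderiv_eq_zero ?_
    filter_upwards [mem_interior_iff_mem_nhds.1 h4] with θ hθ using (hestω n hn).2 θ hθ
  have h5 := h3 _ h2
  rw [hcrit, zero_sub, ← neg_add', norm_neg] at h5
  obtain ⟨a, ha, haa⟩ := exists_bilin_solution hH (fderiv ℝ (v n) θs)
  rw [← haa]
  exact key _ a _ _ ha h5 h1

/-- Asymptotics of the expected excess risk of a minimizer of the empirical risk. -/
theorem tendsto_integral_excess [IsProbabilityMeasure μ] (h : SmoothLoss μ ψ S θs δ)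
    (hZ : ∀ i, MeasurePreserving (Z i) P μ) (hind : iIndepFun Z P)
    (hmin : ∀ θ ∈ S, θ ≠ θs → ∫ z, ψ θs z ∂μ < ∫ z, ψ θ z ∂μ)
    (hH : (hessianMatrix (fun θ => ∫ z, ψ θ z ∂μ) θs).PosDef) {est : ℕ → Ω → RVec q}
    (hest : ∀ n, 1 ≤ n → ∀ᵐ ω ∂P, est n ω ∈ S ∧
      ∀ θ ∈ S, empRisk ψ (fun i => Z i ω) n (est n ω) ≤ empRisk ψ (fun i => Z i ω) n θ)
    (hscore : ∀ i, MemLp (fun z => fderiv ℝ (fun η => ψ η z) θs (EuclideanSpace.single i 1)) 2 μ)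
    (hUI : UniformIntegrable
      (fun (n : ℕ) ω => (n : ℝ) * ((∫ z, ψ (est n ω) z ∂μ) - ∫ z, ψ θs z ∂μ)) 1 P) :
    Tendsto (fun n : ℕ => ∫ ω, (n : ℝ) * ((∫ z, ψ (est n ω) z ∂μ) - ∫ z, ψ θs z ∂μ) ∂P) atTop
      (𝓝 (1 / 2 * ∑ i, ∑ j, (hessianMatrix (fun θ => ∫ z, ψ θ z ∂μ) θs)⁻¹ i j *
        ∫ z, fderiv ℝ (fun η => ψ η z) θs (EuclideanSpace.single i 1) *
          fderiv ℝ (fun η => ψ η z) θs (EuclideanSpace.single j 1) ∂μ)) := by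
  set M := (hessianMatrix (fun θ => ∫ z, ψ θ z ∂μ) θs)⁻¹
  set u : Fin q → 𝒵 → ℝ := fun i z => fderiv ℝ (fun η => ψ η z) θs (EuclideanSpace.single i 1)
  obtain ⟨b, hb, -, hb1, -⟩ := h.bound
  have hDint : Integrable (fun z => fderiv ℝ (fun η => ψ η z) θs) μ := by
    refine hb.mono' (h.aestronglyMeasurable_fderiv h.mem_interior) ?_
    filter_upwards [hb1] with z hz using hz θs (Metric.mem_closedBall_self h.pos.le)
  -- The score is centered because its mean is the gradient of the risk at an interior minimum.
  have hu0 : ∀ i, ∫ z, u i z ∂μ = 0 := by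
    intro i
    have hwmin : IsLocalMin (fun θ => ∫ z, ψ θ z ∂μ) θs := by
      filter_upwards [mem_interior_iff_mem_nhds.1 h.mem_interior] with θ hθ
      rcases eq_or_ne θ θs with rfl | hne
      · exact le_rfl
      · exact (hmin θ hθ hne).le
    have h0 := (h.hasFDerivAt_integral h.mem_ball).fderiv
    rw [hwmin.fderiv_eq_zero] at h0
    have := ContinuousLinearMap.integral_apply hDint (EuclideanSpace.single i (1 : ℝ))
    rw [← h0] at this
    exact this.symm
  refine tendsto_integral_of_eventually_abs_sub_quadForm_le hUI (Z := fun i => normSum Z (u i))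
    (V := fun i j => ∫ z, u i z * u j z ∂μ) (M := M) (fun i n => memLp_normSum hZ (hscore i) n)
    (fun i => unifIntegrable_normSum hZ hind (hscore i) (hu0 i))
    (fun i j n hn => integral_normSum_mul hZ hind (hscore i) (hscore j) (hu0 i) hn) fun ε hε => ?_
  have hsm : ∀ᵐ ω ∂P, ∀ i, ContDiffOn ℝ 2 (fun θ => ψ θ (Z i ω)) (interior S) :=
    ae_all_iff.2 fun i => (hZ i).quasiMeasurePreserving.ae h.contDiffOn
  filter_upwards [ae_eventually_abs_excess_sub_le h hZ hind hmin hH hest hε, hsm] with ω hω hsmω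
  filter_upwards [hω, eventually_ge_atTop 1] with n hn hn1
  set g := fderiv ℝ (empRisk ψ (fun i => Z i ω) n) θs with hg
  have hn0 : (0 : ℝ) < n := by exact_mod_cast hn1
  have hs0 : 0 < √(n : ℝ) := Real.sqrt_pos.2 hn0
  -- A normalized sum of scores is `√n` times a coordinate of the empirical gradient, so multiplying
  -- the almost sure estimate by `n` gives exactly the quadratic form in normalized sums.
  have hgu : ∀ i, normSum Z (u i) n ω = √n * g (EuclideanSpace.single i 1) := by
    intro i
    rw [hg, (hasFDerivAt_empRisk isOpen_interior hsmω n h.mem_interior).fderiv]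
    simp only [smul_apply, sum_apply, smul_eq_mul, normSum, u]
    rw [← mul_assoc]
    congr 1
    nth_rewrite 3 [← Real.mul_self_sqrt hn0.le]
    field_simp
  have hsq : √(n : ℝ) * √(n : ℝ) = n := Real.mul_self_sqrt hn0.le
  have e1 : ∀ i j, normSum Z (u i) n ω * normSum Z (u j) n ω =
      n * (g (EuclideanSpace.single i 1) * g (EuclideanSpace.single j 1)) := by
    intro i j
    rw [hgu, hgu, mul_mul_mul_comm, hsq]
  have e2 : ∑ i, normSum Z (u i) n ω ^ 2 = n * ∑ i, g (EuclideanSpace.single i 1) ^ 2 := by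
    rw [Finset.mul_sum]
    exact Finset.sum_congr rfl fun i _ => by rw [sq, e1, sq]
  have e3 : ∑ i, ∑ j, M i j * (normSum Z (u i) n ω * normSum Z (u j) n ω) =
      n * ∑ i, ∑ j, M i j * (g (EuclideanSpace.single i 1) * g (EuclideanSpace.single j 1)) := by
    simp_rw [e1, Finset.mul_sum]
    exact Finset.sum_congr rfl fun i _ => Finset.sum_congr rfl fun j _ => by ring
  rw [e2, e3]
  have hn' := hn.trans (mul_le_mul_of_nonneg_left (norm_sq_functional_le g) hε.le)
  have := mul_le_mul_of_nonneg_left hn' hn0.le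
  rw [← abs_of_pos hn0, ← abs_mul, abs_of_pos hn0] at this
  refine le_trans (le_of_eq ?_) (this.trans (le_of_eq ?_))
  · congr 1; ring
  · ring

end MEstimator

/-! ### The law of a nested sample. -/

/-- A measure on `α × (ℕ → β)` is determined by its values on finite-dimensional boxes. -/
theorem measure_prod_seq_ext {α β : Type*} [MeasurableSpace α] [MeasurableSpace β]
    {μ ν : Measure (α × (ℕ → β))} [IsFiniteMeasure μ]
    (h : ∀ (K : ℕ) (s : Set α) (t : ℕ → Set β), MeasurableSet s → (∀ k, MeasurableSet (t k)) →
      μ {z | z.1 ∈ s ∧ ∀ k < K, z.2 k ∈ t k} = ν {z | z.1 ∈ s ∧ ∀ k < K, z.2 k ∈ t k}) : μ = ν := by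
  classical
  set D : Set (Set (ℕ → β)) := squareCylinders fun _ => {s | MeasurableSet s}
  have hD : IsPiSystem D :=
    isPiSystem_squareCylinders (fun _ => MeasurableSpace.isPiSystem_measurableSet)
      fun _ => MeasurableSet.univ
  have hDu : Set.univ ∈ D := ⟨∅, fun _ => Set.univ, by simp⟩
  refine ext_of_generate_finite (Set.image2 (· ×ˢ ·) {s : Set α | MeasurableSet s} D) ?_
    (MeasurableSpace.isPiSystem_measurableSet.prod hD) ?_ ?_
  · have := generateFrom_prod_eq (C := {s : Set α | MeasurableSet s}) (D := D)
      isCountablySpanning_measurableSet ⟨fun _ => Set.univ, fun _ => hDu, Set.iUnion_const _⟩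
    rw [← this, generateFrom_squareCylinders]
    congr 1
    exact MeasurableSpace.generateFrom_measurableSet.symm
  · rintro _ ⟨s, hs, _, ⟨F, t, ht, rfl⟩, rfl⟩
    -- A cylinder over a finite index set becomes a box over an initial segment by taking the whole
    -- space at the missing indices.
    have hF : ∃ K, ∀ k ∈ F, k < K := ⟨F.sup id + 1, fun k hk => Nat.lt_succ_of_le (Finset.le_sup (f := id) hk)⟩
    obtain ⟨K, hK⟩ := hF
    have e : s ×ˢ (F : Set ℕ).pi t = {z : α × (ℕ → β) | z.1 ∈ s ∧
        ∀ k < K, z.2 k ∈ if k ∈ F then t k else Set.univ} := by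
      ext z
      simp only [Set.mem_prod, Set.mem_pi, Finset.mem_coe, Set.mem_ofPred_eq]
      refine and_congr_right fun _ => ⟨fun H k _ => ?_, fun H k hk => ?_⟩
      · split_ifs with hkF
        · exact H k hkF
        · trivial
      · simpa [hk] using H k (hK k hk)
    simp only
    rw [e]
    refine h K s _ hs fun k => ?_
    split_ifs
    · exact ht k (Set.mem_univ k)
    · exact MeasurableSet.univ
  · simpa using h 0 Set.univ (fun _ => Set.univ) MeasurableSet.univ fun _ => MeasurableSet.univ

section Sample

variable {Ω : Type*} [MeasurableSpace Ω] {P : Measure Ω} [IsProbabilityMeasure P] {d p : ℕ}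
  {X : Ω → RVec d} {Y : Ω → RVec p} {Xs : ℕ → Ω → RVec d} {Ys : ℕ → ℕ → Ω → RVec p}

namespace IsNestedSample

theorem measurable_sample (h : IsNestedSample P X Y Xs Ys) (i : ℕ) :
    Measurable fun ω => (Xs i ω, fun k => Ys i k ω) :=
  (h.measurable_Xs i).prodMk (measurable_pi_iff.2 fun k => h.measurable_Ys i k)

/-- The prescribed probabilities of boxes do not depend on `i`, and boxes determine the law of the
whole sequence; hence the samples are identically distributed. -/
theorem measurePreserving_sample (h : IsNestedSample P X Y Xs Ys) (i : ℕ) :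
    MeasurePreserving (fun ω => (Xs i ω, fun k => Ys i k ω)) P
      (P.map fun ω => (Xs 0 ω, fun k => Ys 0 k ω)) := by
  refine ⟨h.measurable_sample i, ?_⟩
  have := Measure.isProbabilityMeasure_map (μ := P) (h.measurable_sample i).aemeasurable
  refine measure_prod_seq_ext fun K s t hs ht => ?_
  have hm : MeasurableSet {z : RVec d × (ℕ → RVec p) | z.1 ∈ s ∧ ∀ k < K, z.2 k ∈ t k} := by
    have : {z : RVec d × (ℕ → RVec p) | z.1 ∈ s ∧ ∀ k < K, z.2 k ∈ t k} =
        Prod.fst ⁻¹' s ∩ ⋂ k, ⋂ (_ : k < K), (fun z : RVec d × (ℕ → RVec p) => z.2 k) ⁻¹' t k := by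
      ext z; simp
    rw [this]
    refine (measurable_fst hs).inter (MeasurableSet.iInter fun k => MeasurableSet.iInter fun _ => ?_)
    exact measurableSet_preimage ((measurable_pi_apply k).comp measurable_snd) (ht k)
  rw [Measure.map_apply (h.measurable_sample i) hm, Measure.map_apply (h.measurable_sample 0) hm]
  exact (h.law i K s t hs ht).trans (h.law 0 K s t hs ht).symm

theorem map_pair (h : IsNestedSample P X Y Xs Ys) (hY : Measurable Y) (i k : ℕ) :
    P.map (fun ω => (Xs i ω, Ys i k ω)) = P.map (fun ω => (X ω, Y ω)) := by
  classical
  rw [← compProd_map_condDistrib hY.aemeasurable]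
  have hm : Measurable fun ω => (Xs i ω, Ys i k ω) :=
    (h.measurable_Xs i).prodMk (h.measurable_Ys i k)
  have := Measure.isProbabilityMeasure_map (μ := P) hm.aemeasurable
  refine Measure.ext_prod fun {s t} hs ht => ?_
  rw [Measure.map_apply hm (hs.prod ht), Measure.compProd_apply_prod hs ht]
  have hl := h.law i (k + 1) s (fun j => if j = k then t else Set.univ) hs fun j => by
    split_ifs
    · exact ht
    · exact MeasurableSet.univ
  have e : (fun ω => (Xs i ω, Ys i k ω)) ⁻¹' s ×ˢ t = {ω | Xs i ω ∈ s ∧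
      ∀ j < k + 1, Ys i j ω ∈ if j = k then t else Set.univ} := by
    ext ω
    simp only [Set.mem_preimage, Set.mem_prod, Set.mem_ofPred_eq]
    refine and_congr_right fun _ => ⟨fun H j _ => ?_, fun H => by simpa using H k (Nat.lt_succ_self k)⟩
    split_ifs with hj
    · rwa [hj]
    · trivial
  rw [e, hl]
  refine lintegral_congr fun x => ?_
  rw [Finset.prod_eq_single k]
  · simp
  · intro j _ hj
    simp [hj]
  · simp

/-- The product kernel expresses the conditional independence, given `X_i`, of two distinct inner
samples. It is read off from boxes with `k + l + 1` inner factors, enough to include both indices.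
-/
theorem map_triple (h : IsNestedSample P X Y Xs Ys) (i : ℕ) {k l : ℕ} (hkl : k ≠ l) :
    P.map (fun ω => (Xs i ω, Ys i k ω, Ys i l ω)) =
      (P.map X) ⊗ₘ (condDistrib Y X P ×ₖ condDistrib Y X P) := by
  classical
  have hm : Measurable fun ω => (Xs i ω, Ys i k ω, Ys i l ω) :=
    (h.measurable_Xs i).prodMk ((h.measurable_Ys i k).prodMk (h.measurable_Ys i l))
  have := Measure.isProbabilityMeasure_map (μ := P) hm.aemeasurable
  refine Measure.ext_prod₃ fun {s t u} hs ht hu => ?_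
  rw [Measure.map_apply hm (hs.prod (ht.prod hu)), Measure.compProd_apply_prod hs (ht.prod hu)]
  set T : ℕ → Set (RVec p) := fun j => if j = k then t else if j = l then u else Set.univ
  have hTk : T k = t := by simp [T]
  have hTl : T l = u := by simp [T, hkl.symm]
  have hl := h.law i (k + l + 1) s T hs fun j => by
    simp only [T]
    split_ifs
    · exact ht
    · exact hu
    · exact MeasurableSet.univ
  have e : (fun ω => (Xs i ω, Ys i k ω, Ys i l ω)) ⁻¹' s ×ˢ t ×ˢ u = {ω | Xs i ω ∈ s ∧
      ∀ j < k + l + 1, Ys i j ω ∈ T j} := by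
    ext ω
    simp only [Set.mem_preimage, Set.mem_prod, Set.mem_ofPred_eq]
    refine and_congr_right fun _ => ⟨fun H j _ => ?_, fun H => ⟨?_, ?_⟩⟩
    · simp only [T]
      split_ifs with hj hj'
      · rw [hj]; exact H.1
      · rw [hj']; exact H.2
      · trivial
    · simpa [hTk] using H k (by omega)
    · simpa [hTl] using H l (by omega)
  rw [e, hl]
  refine lintegral_congr fun x => ?_
  rw [Kernel.prod_apply_prod, ← Finset.prod_subset (s₁ := {k, l}), Finset.prod_pair hkl, hTk, hTl]
  · intro j hj
    simp only [Finset.mem_insert, Finset.mem_singleton] at hj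
    rw [Finset.mem_range]
    omega
  · intro j _ hj
    simp only [Finset.mem_insert, Finset.mem_singleton, not_or] at hj
    simp [T, hj.1, hj.2]

theorem map_fst (h : IsNestedSample P X Y Xs Ys) (hX : Measurable X) (hY : Measurable Y) (i : ℕ) :
    P.map (Xs i) = P.map X := by
  have h1 := congrArg (Measure.map Prod.fst) (h.map_pair hY i 0)
  rw [Measure.map_map measurable_fst ((h.measurable_Xs i).prodMk (h.measurable_Ys i 0)),
    Measure.map_map measurable_fst (hX.prodMk hY)] at h1
  exact h1

end IsNestedSample

/-- The regression function `x ↦ E[f(Y) | X = x]`. -/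
noncomputable def regFun (P : Measure Ω) [IsProbabilityMeasure P] (X : Ω → RVec d) (Y : Ω → RVec p)
    (f : RVec p → ℝ) (x : RVec d) : ℝ := ∫ y, f y ∂condDistrib Y X P x

variable {f : RVec p → ℝ}

theorem measurable_regFun (hf : Measurable f) : Measurable (regFun P X Y f) :=
  (StronglyMeasurable.integral_condDistrib (X := X) (Y := Y) (μ := P)
    (hf.comp (measurable_snd (α := RVec d))).stronglyMeasurable).measurable

theorem aestronglyMeasurable_comp_fst_compProd {α β : Type*} [MeasurableSpace α]
    [MeasurableSpace β] {ρ : Measure α} [SFinite ρ] {κ : Kernel α β} [IsMarkovKernel κ] {a : α → ℝ}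
    (ha : AEStronglyMeasurable a ρ) : AEStronglyMeasurable (fun z : α × β => a z.1) (ρ ⊗ₘ κ) := by
  refine AEStronglyMeasurable.comp_measurable (f := Prod.fst) ?_ measurable_fst
  change AEStronglyMeasurable a (ρ ⊗ₘ κ).fst
  rwa [Measure.fst_compProd]

theorem condMean_ae_eq (hX : Measurable X) (hY : Measurable Y) (hf : Measurable f)
    (hfi : Integrable (fun ω => f (Y ω)) P) :
    condMean P X Y f =ᵐ[P] fun ω => regFun P X Y f (X ω) :=
  condExp_ae_eq_integral_condDistrib hX hY.aemeasurable hf.stronglyMeasurable hfi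

theorem ae_integrable_condDistrib (hX : Measurable X) (hY : Measurable Y) (hf : Measurable f)
    (hfi : Integrable (fun ω => f (Y ω)) P) :
    ∀ᵐ x ∂P.map X, Integrable f (condDistrib Y X P x) := by
  have : Integrable (fun z : RVec d × RVec p => f z.2) (P.map fun ω => (X ω, Y ω)) := by
    exact (integrable_map_measure (hf.comp measurable_snd).aestronglyMeasurable
      (hX.prodMk hY).aemeasurable).2 hfi
  exact this.condDistrib_ae_map hY.aemeasurable

theorem ae_integral_sub_regFun (hX : Measurable X) (hY : Measurable Y) (hf : Measurable f)
    (hfi : Integrable (fun ω => f (Y ω)) P) :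
    ∀ᵐ x ∂P.map X, ∫ y, (f y - regFun P X Y f x) ∂condDistrib Y X P x = 0 := by
  filter_upwards [ae_integrable_condDistrib hX hY hf hfi] with x hx
  rw [integral_sub hx (integrable_const _)]
  simp [regFun]

namespace IsNestedSample

/-- Integrals against the law of one inner sample. -/
theorem integral_pair (h : IsNestedSample P X Y Xs Ys) (hX : Measurable X) (hY : Measurable Y)
    (i k : ℕ) {F : RVec d × RVec p → ℝ}
    (hF : AEStronglyMeasurable F (P.map fun ω => (X ω, Y ω))) :
    ∫ ω, F (Xs i ω, Ys i k ω) ∂P = ∫ ω, F (X ω, Y ω) ∂P := by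
  rw [← integral_map (hX.prodMk hY).aemeasurable hF, ← h.map_pair hY i k, integral_map]
  · exact ((h.measurable_Xs i).prodMk (h.measurable_Ys i k)).aemeasurable
  · rwa [h.map_pair hY i k]

theorem integrable_pair_iff (h : IsNestedSample P X Y Xs Ys) (hX : Measurable X)
    (hY : Measurable Y) (i k : ℕ) {F : RVec d × RVec p → ℝ}
    (hF : AEStronglyMeasurable F (P.map fun ω => (X ω, Y ω))) :
    Integrable (fun ω => F (Xs i ω, Ys i k ω)) P ↔ Integrable (fun ω => F (X ω, Y ω)) P := by
  rw [← Function.comp_def F, ← Function.comp_def F (fun ω => (X ω, Y ω)),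
    ← integrable_map_measure hF (hX.prodMk hY).aemeasurable, ← h.map_pair hY i k,
    integrable_map_measure]
  · rwa [h.map_pair hY i k]
  · exact ((h.measurable_Xs i).prodMk (h.measurable_Ys i k)).aemeasurable

/-- Integrating the inner sample first, under the conditional law, the centered factor has mean zero
for almost every `x`. -/
theorem integral_mul_sub_regFun (h : IsNestedSample P X Y Xs Ys) (hX : Measurable X)
    (hY : Measurable Y) (hf : Measurable f) (hfi : Integrable (fun ω => f (Y ω)) P) (k : ℕ)
    {a : RVec d → ℝ} (ha : AEStronglyMeasurable a (P.map X))
    (hint : Integrable (fun ω => a (Xs 0 ω) * (f (Ys 0 k ω) - regFun P X Y f (Xs 0 ω))) P) :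
    ∫ ω, a (Xs 0 ω) * (f (Ys 0 k ω) - regFun P X Y f (Xs 0 ω)) ∂P = 0 := by
  have hm : Measurable fun ω => (Xs 0 ω, Ys 0 k ω) :=
    (h.measurable_Xs 0).prodMk (h.measurable_Ys 0 k)
  set F : RVec d × RVec p → ℝ := fun z => a z.1 * (f z.2 - regFun P X Y f z.1) with hFdef
  have hmap : P.map (fun ω => (Xs 0 ω, Ys 0 k ω)) = P.map X ⊗ₘ condDistrib Y X P := by
    rw [h.map_pair hY 0 k, compProd_map_condDistrib hY.aemeasurable]
  have hF : AEStronglyMeasurable F (P.map X ⊗ₘ condDistrib Y X P) :=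
    (aestronglyMeasurable_comp_fst_compProd ha).mul
      ((hf.comp measurable_snd).sub ((measurable_regFun hf).comp measurable_fst)).aestronglyMeasurable
  have hFi : Integrable F (P.map X ⊗ₘ condDistrib Y X P) := by
    rw [← hmap] at hF ⊢
    exact (integrable_map_measure hF hm.aemeasurable).2 hint
  have e : ∫ ω, a (Xs 0 ω) * (f (Ys 0 k ω) - regFun P X Y f (Xs 0 ω)) ∂P =
      ∫ z, F z ∂(P.map X ⊗ₘ condDistrib Y X P) := by
    rw [← hmap] at hF ⊢
    exact (integral_map hm.aemeasurable hF).symm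
  rw [e, Measure.integral_compProd hFi]
  refine integral_eq_zero_of_ae ?_
  filter_upwards [ae_integral_sub_regFun hX hY hf hfi] with x hx
  simp only [hFdef, integral_const_mul, hx, mul_zero, Pi.zero_apply]

/-- Given `X`, the two centered factors are independent, so the inner integral is a product of two
vanishing integrals. -/
theorem integral_mul_sub_mul_sub (h : IsNestedSample P X Y Xs Ys) (hX : Measurable X)
    (hY : Measurable Y) (hf : Measurable f) (hfi : Integrable (fun ω => f (Y ω)) P) {k l : ℕ}
    (hkl : k ≠ l) {a : RVec d → ℝ} (ha : AEStronglyMeasurable a (P.map X))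
    (hint : Integrable (fun ω => a (Xs 0 ω) * ((f (Ys 0 k ω) - regFun P X Y f (Xs 0 ω)) *
      (f (Ys 0 l ω) - regFun P X Y f (Xs 0 ω)))) P) :
    ∫ ω, a (Xs 0 ω) * ((f (Ys 0 k ω) - regFun P X Y f (Xs 0 ω)) *
      (f (Ys 0 l ω) - regFun P X Y f (Xs 0 ω))) ∂P = 0 := by
  have hm : Measurable fun ω => (Xs 0 ω, Ys 0 k ω, Ys 0 l ω) :=
    (h.measurable_Xs 0).prodMk ((h.measurable_Ys 0 k).prodMk (h.measurable_Ys 0 l))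
  set F : RVec d × RVec p × RVec p → ℝ := fun z => a z.1 * ((f z.2.1 - regFun P X Y f z.1) *
    (f z.2.2 - regFun P X Y f z.1)) with hFdef
  have hmap := h.map_triple 0 hkl
  set ρ := P.map X ⊗ₘ (condDistrib Y X P ×ₖ condDistrib Y X P) with hρ
  have hr : Measurable fun z : RVec d × RVec p × RVec p => regFun P X Y f z.1 :=
    (measurable_regFun hf).comp measurable_fst
  have hF : AEStronglyMeasurable F ρ :=
    (aestronglyMeasurable_comp_fst_compProd ha).mul
      (((hf.comp (measurable_fst.comp measurable_snd)).sub hr).mul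
        ((hf.comp (measurable_snd.comp measurable_snd)).sub hr)).aestronglyMeasurable
  have hFi : Integrable F ρ := by
    rw [← hmap] at hF ⊢
    exact (integrable_map_measure hF hm.aemeasurable).2 hint
  have e : ∫ ω, a (Xs 0 ω) * ((f (Ys 0 k ω) - regFun P X Y f (Xs 0 ω)) *
      (f (Ys 0 l ω) - regFun P X Y f (Xs 0 ω))) ∂P = ∫ z, F z ∂ρ := by
    rw [← hmap] at hF ⊢
    exact (integral_map hm.aemeasurable hF).symm
  rw [e, hρ, Measure.integral_compProd hFi]
  refine integral_eq_zero_of_ae ?_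
  filter_upwards [ae_integral_sub_regFun hX hY hf hfi] with x hx
  simp only [hFdef, integral_const_mul, Kernel.prod_apply, Pi.zero_apply]
  rw [integral_prod_mul (fun y => f y - regFun P X Y f x) fun y => f y - regFun P X Y f x, hx]
  simp

end IsNestedSample

end Sample

/-! ### Weighted bias-variance decomposition. -/

section BiasVariance

variable {Ω : Type*} [MeasurableSpace Ω] {P : Measure Ω} [IsProbabilityMeasure P] {d p : ℕ}
  {X : Ω → RVec d} {Y : Ω → RVec p} {Xs : ℕ → Ω → RVec d} {Ys : ℕ → ℕ → Ω → RVec p}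
  {f : RVec p → ℝ}

/-- From `|u v| ≤ u² + v²`. The weight `w` may change sign, as a product of two partial derivatives
does. -/
theorem integrable_mul_mul_of_sq_mul {Ω : Type*} [MeasurableSpace Ω] {P : Measure Ω}
    {u v w : Ω → ℝ} (hu : AEStronglyMeasurable u P) (hv : AEStronglyMeasurable v P)
    (hw : AEStronglyMeasurable w P) (hui : Integrable (fun ω => u ω ^ 2 * w ω) P)
    (hvi : Integrable (fun ω => v ω ^ 2 * w ω) P) : Integrable (fun ω => w ω * (u ω * v ω)) P := by
  refine (hui.abs.add hvi.abs).mono' (hw.mul (hu.mul hv)) (ae_of_all _ fun ω => ?_)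
  simp only [Pi.add_apply, Real.norm_eq_abs, abs_mul, abs_pow, sq_abs]
  have h1 : |u ω| * |v ω| ≤ u ω ^ 2 + v ω ^ 2 := by
    rw [← sq_abs (u ω), ← sq_abs (v ω)]
    nlinarith [sq_nonneg (|u ω| - |v ω|), sq_nonneg |u ω|, sq_nonneg |v ω|]
  calc |w ω| * (|u ω| * |v ω|) ≤ |w ω| * (u ω ^ 2 + v ω ^ 2) := by gcongr
    _ = _ := by ring

/-- The weighted bias-variance decomposition of the squared error with `K` inner samples. -/
theorem IsNestedSample.integral_sq_sub_mean (h : IsNestedSample P X Y Xs Ys) (hX : Measurable X)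
    (hY : Measurable Y) (hf : Measurable f) (hfi : Integrable (fun ω => f (Y ω)) P) {K : ℕ}
    (hK : 1 ≤ K) {u w : RVec d → ℝ} (hu : AEStronglyMeasurable u (P.map X))
    (hw : AEStronglyMeasurable w (P.map X))
    (hui : Integrable (fun ω => (u (X ω) - regFun P X Y f (X ω)) ^ 2 * w (X ω)) P)
    (hvi : Integrable (fun ω => (f (Y ω) - regFun P X Y f (X ω)) ^ 2 * w (X ω)) P) :
    Integrable (fun ω => (u (Xs 0 ω) - 1 / (K : ℝ) * ∑ k ∈ Finset.range K, f (Ys 0 k ω)) ^ 2 *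
      w (Xs 0 ω)) P ∧
    ∫ ω, (u (Xs 0 ω) - 1 / (K : ℝ) * ∑ k ∈ Finset.range K, f (Ys 0 k ω)) ^ 2 * w (Xs 0 ω) ∂P =
      ∫ ω, (u (X ω) - regFun P X Y f (X ω)) ^ 2 * w (X ω) ∂P +
        1 / (K : ℝ) * ∫ ω, (f (Y ω) - regFun P X Y f (X ω)) ^ 2 * w (X ω) ∂P := by
  set m := regFun P X Y f with hm
  have hmm : Measurable m := measurable_regFun hf
  have hXY : Measurable fun ω => (X ω, Y ω) := hX.prodMk hY
  have hfst : (P.map fun ω => (X ω, Y ω)).map Prod.fst = P.map X := by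
    rw [Measure.map_map measurable_fst hXY]; rfl
  have hlift : ∀ {a : RVec d → ℝ}, AEStronglyMeasurable a (P.map X) →
      AEStronglyMeasurable (fun z : RVec d × RVec p => a z.1) (P.map fun ω => (X ω, Y ω)) :=
    fun ha => AEStronglyMeasurable.comp_measurable (f := Prod.fst) (by rwa [hfst]) measurable_fst
  set U : Ω → ℝ := fun ω => u (Xs 0 ω) - m (Xs 0 ω) with hU
  set V : ℕ → Ω → ℝ := fun k ω => f (Ys 0 k ω) - m (Xs 0 ω) with hV
  set W : Ω → ℝ := fun ω => w (Xs 0 ω) with hW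
  have hFU : AEStronglyMeasurable (fun z : RVec d × RVec p => (u z.1 - m z.1) ^ 2 * w z.1)
      (P.map fun ω => (X ω, Y ω)) :=
    hlift (((hu.sub hmm.aestronglyMeasurable).pow 2).mul hw)
  have hFV : AEStronglyMeasurable (fun z : RVec d × RVec p => (f z.2 - m z.1) ^ 2 * w z.1)
      (P.map fun ω => (X ω, Y ω)) :=
    (((hf.comp measurable_snd).sub (hmm.comp measurable_fst)).pow_const 2).aestronglyMeasurable.mul
      (hlift hw)
  have hUi : Integrable (fun ω => U ω ^ 2 * W ω) P := (h.integrable_pair_iff hX hY 0 0 hFU).2 hui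
  have hUE : ∫ ω, U ω ^ 2 * W ω ∂P = ∫ ω, (u (X ω) - m (X ω)) ^ 2 * w (X ω) ∂P :=
    h.integral_pair hX hY 0 0 hFU
  have hVi : ∀ k, Integrable (fun ω => V k ω ^ 2 * W ω) P :=
    fun k => (h.integrable_pair_iff hX hY 0 k hFV).2 hvi
  have hVE : ∀ k, ∫ ω, V k ω ^ 2 * W ω ∂P = ∫ ω, (f (Y ω) - m (X ω)) ^ 2 * w (X ω) ∂P :=
    fun k => h.integral_pair hX hY 0 k hFV
  have hXs : ∀ {a : RVec d → ℝ}, AEStronglyMeasurable a (P.map X) →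
      AEStronglyMeasurable (fun ω => a (Xs 0 ω)) P :=
    fun ha => AEStronglyMeasurable.comp_measurable (by rwa [h.map_fst hX hY 0]) (h.measurable_Xs 0)
  have hUm : AEStronglyMeasurable U P := hXs (hu.sub hmm.aestronglyMeasurable)
  have hWm : AEStronglyMeasurable W P := hXs hw
  have hVm : ∀ k, AEStronglyMeasurable (V k) P := fun k =>
    ((hf.comp (h.measurable_Ys 0 k)).sub (hmm.comp (h.measurable_Xs 0))).aestronglyMeasurable
  have hUVi : ∀ k, Integrable (fun ω => W ω * (U ω * V k ω)) P :=
    fun k => integrable_mul_mul_of_sq_mul hUm (hVm k) hWm hUi (hVi k)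
  have hVVi : ∀ k l, Integrable (fun ω => W ω * (V k ω * V l ω)) P :=
    fun k l => integrable_mul_mul_of_sq_mul (hVm k) (hVm l) hWm (hVi k) (hVi l)
  have hUV0 : ∀ k, ∫ ω, W ω * (U ω * V k ω) ∂P = 0 := by
    intro k
    have e : (fun ω => W ω * (U ω * V k ω)) = fun ω =>
        (w (Xs 0 ω) * (u (Xs 0 ω) - m (Xs 0 ω))) * (f (Ys 0 k ω) - m (Xs 0 ω)) := by
      ext ω; simp only [hW, hU, hV]; ring
    have hi := hUVi k
    rw [e] at hi ⊢
    exact h.integral_mul_sub_regFun hX hY hf hfi k (a := fun x => w x * (u x - m x))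
      (hw.mul (hu.sub hmm.aestronglyMeasurable)) hi
  have hVV0 : ∀ k l, ∫ ω, W ω * (V k ω * V l ω) ∂P =
      if k = l then ∫ ω, (f (Y ω) - m (X ω)) ^ 2 * w (X ω) ∂P else 0 := by
    intro k l
    split_ifs with hkl
    · subst hkl
      rw [← hVE k]
      exact integral_congr_ae (ae_of_all _ fun ω => by ring)
    · exact h.integral_mul_sub_mul_sub hX hY hf hfi hkl hw (hVVi k l)
  have hK0 : (K : ℝ) ≠ 0 := by positivity
  -- The error is `U − (1/K) ∑ V_k`. After expanding the square, the cross terms `U V_k` and `V_k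
  -- V_l` with `k ≠ l` integrate to zero, and the `K` diagonal terms carry `1 / K²`, leaving `1 /
  -- K`.
  have e : ∀ ω, (u (Xs 0 ω) - 1 / (K : ℝ) * ∑ k ∈ Finset.range K, f (Ys 0 k ω)) ^ 2 * w (Xs 0 ω) =
      U ω ^ 2 * W ω - 2 / K * ∑ k ∈ Finset.range K, W ω * (U ω * V k ω) +
        1 / (K : ℝ) ^ 2 * ∑ k ∈ Finset.range K, ∑ l ∈ Finset.range K, W ω * (V k ω * V l ω) := by
    intro ω
    simp_rw [← Finset.mul_sum, ← Finset.sum_mul]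
    have : ∑ k ∈ Finset.range K, V k ω = ∑ k ∈ Finset.range K, f (Ys 0 k ω) - K * m (Xs 0 ω) := by
      simp [hV, Finset.sum_sub_distrib]
    rw [this]
    simp only [hU, hW]
    field_simp
    ring
  have hi1 : Integrable (fun ω => 2 / K * ∑ k ∈ Finset.range K, W ω * (U ω * V k ω)) P :=
    (integrable_finsetSum _ fun k _ => hUVi k).const_mul _
  have hi2 : Integrable (fun ω => 1 / (K : ℝ) ^ 2 * ∑ k ∈ Finset.range K,
      ∑ l ∈ Finset.range K, W ω * (V k ω * V l ω)) P :=
    (integrable_finsetSum _ fun k _ => integrable_finsetSum _ fun l _ => hVVi k l).const_mul _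
  simp_rw [e]
  have hi3 : Integrable (fun ω => U ω ^ 2 * W ω -
      2 / K * ∑ k ∈ Finset.range K, W ω * (U ω * V k ω)) P := hUi.sub hi1
  refine ⟨hi3.add hi2, ?_⟩
  rw [integral_add hi3 hi2, integral_sub hUi hi1, integral_const_mul, integral_const_mul,
    integral_finsetSum _ fun k _ => hUVi k,
    integral_finsetSum _ fun k _ => integrable_finsetSum _ fun l _ => hVVi k l, hUE]
  have : ∀ k ∈ Finset.range K, ∫ ω, ∑ l ∈ Finset.range K, W ω * (V k ω * V l ω) ∂P =
      ∫ ω, (f (Y ω) - m (X ω)) ^ 2 * w (X ω) ∂P := by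
    intro k hk
    rw [integral_finsetSum _ fun l _ => hVVi k l]
    simp_rw [hVV0]
    rw [Finset.sum_ite_eq, if_pos hk]
  rw [Finset.sum_congr rfl this]
  simp only [hUV0, Finset.sum_const_zero, mul_zero, sub_zero, Finset.sum_const, Finset.card_range,
    nsmul_eq_mul]
  field_simp

/-- Conditioning on `X` decreases the weighted second moment. -/
theorem integrable_sq_sub_regFun_mul (hX : Measurable X) (hY : Measurable Y) (hf : Measurable f)
    (hf2 : MemLp (fun ω => f (Y ω)) 2 P) {u g : RVec d → ℝ}
    (hu : AEStronglyMeasurable u (P.map X)) (hg : AEStronglyMeasurable g (P.map X))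
    (hg0 : ∀ x, 0 ≤ g x) (hi : Integrable (fun ω => (u (X ω) - f (Y ω)) ^ 2 * g (X ω)) P) :
    Integrable (fun ω => (u (X ω) - regFun P X Y f (X ω)) ^ 2 * g (X ω)) P := by
  set m := regFun P X Y f with hm
  have hmm : Measurable m := measurable_regFun hf
  have hXY : Measurable fun ω => (X ω, Y ω) := hX.prodMk hY
  set κ := condDistrib Y X P with hκ
  have hmap : P.map (fun ω => (X ω, Y ω)) = P.map X ⊗ₘ κ :=
    (compProd_map_condDistrib hY.aemeasurable).symm
  have hF : AEStronglyMeasurable (fun z : RVec d × RVec p => (u z.1 - f z.2) ^ 2 * g z.1)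
      (P.map X ⊗ₘ κ) :=
    (((aestronglyMeasurable_comp_fst_compProd hu).sub
      (hf.comp measurable_snd).aestronglyMeasurable).pow 2).mul
      (aestronglyMeasurable_comp_fst_compProd hg)
  have hFi : Integrable (fun z : RVec d × RVec p => (u z.1 - f z.2) ^ 2 * g z.1)
      (P.map X ⊗ₘ κ) := by
    rw [← hmap] at hF ⊢
    exact (integrable_map_measure hF hXY.aemeasurable).2 hi
  have h1 := ((Measure.integrable_compProd_iff hF).1 hFi).2
  have hf2i : ∀ᵐ x ∂P.map X, Integrable (fun y => f y ^ 2) (κ x) := by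
    have := ae_integrable_condDistrib (P := P) hX hY (hf.pow_const 2) hf2.integrable_sq
    exact this
  have hres : Integrable (fun x => (u x - m x) ^ 2 * g x) (P.map X) := by
    -- Conditional Jensen inequality, fibre by fibre: the conditional mean of `(u − f)²` is `(u −
    -- m)²` plus the conditional variance of `f`.
    refine h1.mono' (((hu.sub hmm.aestronglyMeasurable).pow 2).mul hg) ?_
    filter_upwards [ae_integrable_condDistrib hX hY hf (hf2.integrable (by norm_num)), hf2i]
      with x hx hx2
    rw [Real.norm_eq_abs, abs_of_nonneg (mul_nonneg (sq_nonneg _) (hg0 x))]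
    have e : ∀ y, ‖(u x - f y) ^ 2 * g x‖ = (u x - f y) ^ 2 * g x := fun y => by
      rw [Real.norm_eq_abs, abs_of_nonneg (mul_nonneg (sq_nonneg _) (hg0 x))]
    simp_rw [e]
    rw [integral_mul_const]
    refine mul_le_mul_of_nonneg_right ?_ (hg0 x)
    replace hx : Integrable f (κ x) := hx
    have hi2 : Integrable (fun y => (f y - m x) ^ 2) (κ x) := by
      have : (fun y => (f y - m x) ^ 2) = fun y => (f y ^ 2 - 2 * m x * f y) + m x ^ 2 := by
        ext y; ring
      rw [this]
      exact (hx2.sub (hx.const_mul _)).add (integrable_const _)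
    have e3 : ∀ y, (u x - f y) ^ 2 = ((u x - m x) ^ 2 - 2 * (u x - m x) * (f y - m x)) +
        (f y - m x) ^ 2 := fun y => by ring
    simp_rw [e3]
    have hfm : Integrable (fun y => f y - m x) (κ x) := hx.sub (integrable_const _)
    have hi3 : Integrable (fun y => (u x - m x) ^ 2 - 2 * (u x - m x) * (f y - m x)) (κ x) :=
      (integrable_const _).sub (hfm.const_mul _)
    rw [integral_add hi3 hi2,
      integral_sub (integrable_const _) (hfm.const_mul _), integral_const_mul,
      integral_sub hx (integrable_const _)]
    have h0 : ∫ y, f y ∂κ x = m x := rfl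
    have h2 : 0 ≤ ∫ y, (f y - m x) ^ 2 ∂κ x := integral_nonneg fun y => sq_nonneg _
    simp only [integral_const, probReal_univ, smul_eq_mul, one_mul, h0, sub_self, mul_zero, sub_zero]
    linarith
  exact hres.comp_measurable hX

end BiasVariance

/-! ### The squared regression loss as a smooth loss. -/

section SquaredLoss

variable {E : Type*} [NormedAddCommGroup E] [NormedSpace ℝ E] {g : E → ℝ} {U : Set E}

theorem hasFDerivAt_sq_sub_const {θ : E} (hg : DifferentiableAt ℝ g θ) (c : ℝ) :
    HasFDerivAt (fun η => (g η - c) ^ 2) ((2 * (g θ - c)) • fderiv ℝ g θ) θ := by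
  have h := (hg.hasFDerivAt.sub_const c).pow 2
  refine h.congr_fderiv ?_
  ext v
  simp

/-- Product rule: the Hessian is `2 (g − c) ∇²g + 2 ∇g ⊗ ∇g`. Each term is a product of two factors
with square integrable bounds, so the Hessian of the loss has an integrable bound. -/
theorem norm_fderiv_fderiv_sq_sub_const_le (hg : ContDiffOn ℝ 2 g U) (hU : IsOpen U) {θ : E}
    (hθ : θ ∈ U) (c : ℝ) : ‖fderiv ℝ (fderiv ℝ fun η => (g η - c) ^ 2) θ‖ ≤
      2 * (|g θ - c| * ‖fderiv ℝ (fderiv ℝ g) θ‖) + 2 * ‖fderiv ℝ g θ‖ ^ 2 := by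
  have h1 : HasFDerivAt (fun η => 2 * (g η - c)) ((2 : ℝ) • fderiv ℝ g θ) θ :=
    ((hg.differentiableAt_of_two hU hθ).hasFDerivAt.sub_const c).const_mul 2
  have h2 := (hg.differentiableAt_fderiv_of_two hU hθ).hasFDerivAt
  have h3 := h1.fun_smul h2
  have h4 : fderiv ℝ (fun η => (g η - c) ^ 2) =ᶠ[𝓝 θ]
      fun η => (2 * (g η - c)) • fderiv ℝ g η := by
    filter_upwards [hU.mem_nhds hθ] with η hη using
      (hasFDerivAt_sq_sub_const (hg.differentiableAt_of_two hU hη) c).fderiv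
  rw [(h3.congr_of_eventuallyEq h4).fderiv]
  refine le_trans (ContinuousLinearMap.opNorm_add_le _ _) (le_of_eq ?_)
  rw [norm_smul, ContinuousLinearMap.norm_smulRight_apply, norm_smul]
  simp only [Real.norm_eq_abs, abs_mul, Nat.abs_ofNat]
  ring

end SquaredLoss

/-- The loss of a parameter at a sample with `K` inner draws. -/
noncomputable def nestedLoss {d p q : ℕ} (f : RVec p → ℝ) (φ : RVec q → RVec d → ℝ) (K : ℕ)
    (θ : RVec q) (z : RVec d × (ℕ → RVec p)) : ℝ :=
  (φ θ z.1 - 1 / (K : ℝ) * ∑ k ∈ Finset.range K, f (z.2 k)) ^ 2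

section Regression

variable {Ω : Type*} [MeasurableSpace Ω] {P : Measure Ω} {d p q : ℕ}
  {X : Ω → RVec d} {Y : Ω → RVec p} {f : RVec p → ℝ} {φ : RVec q → RVec d → ℝ}
  {S : Set (RVec q)} {θs : RVec q} {Xs : ℕ → Ω → RVec d} {Ys : ℕ → ℕ → Ω → RVec p}

theorem norm_gradPhi (θ : RVec q) (x : RVec d) :
    ‖gradPhi φ θ x‖ = ‖fderiv ℝ (fun η => φ η x) θ‖ := by
  unfold gradPhi gradient
  exact LinearIsometryEquiv.norm_map _ _

theorem fderiv_single_eq_gradPhi (θ : RVec q) (x : RVec d) (i : Fin q) :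
    fderiv ℝ (fun η => φ η x) θ (EuclideanSpace.single i 1) = gradPhi φ θ x i := by
  have h := InnerProductSpace.toDual_symm_apply (𝕜 := ℝ) (x := EuclideanSpace.single i (1 : ℝ))
    (y := fderiv ℝ (fun η => φ η x) θ)
  rw [← h, EuclideanSpace.inner_single_right]
  simp [gradPhi, gradient]

namespace RegressionAssumptions

theorem aestronglyMeasurable_fderiv (h : RegressionAssumptions P X Y f φ S θs) {θ : RVec q}
    (hθ : θ ∈ interior S) :
    AEStronglyMeasurable (fun x => fderiv ℝ (fun η => φ η x) θ) (P.map X) := by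
  refine aestronglyMeasurable_fderiv_param (U := Set.univ)
    (fun θ _ => (h.measurable_phi θ).aestronglyMeasurable) univ_mem ?_
  filter_upwards [h.contDiffOn_phi] with x hx using hx.differentiableAt_of_two isOpen_interior hθ

theorem aestronglyMeasurable_fderiv_fderiv (h : RegressionAssumptions P X Y f φ S θs)
    {θ : RVec q} (hθ : θ ∈ interior S) :
    AEStronglyMeasurable (fun x => fderiv ℝ (fderiv ℝ fun η => φ η x) θ) (P.map X) := by
  refine aestronglyMeasurable_fderiv_param (G := fun θ x => fderiv ℝ (fun η => φ η x) θ)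
    (U := interior S) (fun θ hθ => h.aestronglyMeasurable_fderiv hθ)
    (isOpen_interior.mem_nhds hθ) ?_
  filter_upwards [h.contDiffOn_phi] with x hx using
    hx.differentiableAt_fderiv_of_two isOpen_interior hθ

theorem aestronglyMeasurable_gradPhi (h : RegressionAssumptions P X Y f φ S θs) (i : Fin q) :
    AEStronglyMeasurable (fun x => gradPhi φ θs x i) (P.map X) := by
  have h1 := h.aestronglyMeasurable_fderiv h.mem_interior
  have := (ContinuousLinearMap.apply ℝ ℝ (EuclideanSpace.single i (1 : ℝ) : RVec q)).continuous.comp_aestronglyMeasurable h1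
  refine this.congr (ae_of_all _ fun x => ?_)
  exact fderiv_single_eq_gradPhi θs x i

theorem aestronglyMeasurable_norm_gradPhi (h : RegressionAssumptions P X Y f φ S θs) :
    AEStronglyMeasurable (fun x => ‖gradPhi φ θs x‖) (P.map X) := by
  simp_rw [norm_gradPhi]
  exact (h.aestronglyMeasurable_fderiv h.mem_interior).norm

theorem abs_gradPhi_mul_le (θ : RVec q) (x : RVec d) (i j : Fin q) :
    |gradPhi φ θ x i * gradPhi φ θ x j| ≤ ‖gradPhi φ θ x‖ ^ 2 := by
  have h : ∀ i, |gradPhi φ θ x i| ≤ ‖gradPhi φ θ x‖ := fun i =>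
    PiLp.norm_apply_le (gradPhi φ θ x) i
  rw [abs_mul, sq]
  exact mul_le_mul (h i) (h j) (abs_nonneg _) (norm_nonneg _)

theorem integrable_sq_mul_gradPhi (h : RegressionAssumptions P X Y f φ S θs) {u : Ω → ℝ}
    (hu : AEStronglyMeasurable u P)
    (hi : Integrable (fun ω => u ω ^ 2 * ‖gradPhi φ θs (X ω)‖ ^ 2) P) (i j : Fin q) :
    Integrable (fun ω => u ω ^ 2 * (gradPhi φ θs (X ω) i * gradPhi φ θs (X ω) j)) P := by
  have hg : ∀ i, AEStronglyMeasurable (fun ω => gradPhi φ θs (X ω) i) P := fun i =>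
    (h.aestronglyMeasurable_gradPhi i).comp_measurable h.measurable_X
  refine hi.mono' ((hu.pow 2).mul ((hg i).mul (hg j))) (ae_of_all _ fun ω => ?_)
  rw [norm_mul, norm_pow, Real.norm_eq_abs, Real.norm_eq_abs, sq_abs]
  exact mul_le_mul_of_nonneg_left (abs_gradPhi_mul_le θs (X ω) i j) (sq_nonneg _)

/-- Square integrable bounds on the regression family and its derivatives near `θs`. -/
theorem exists_bounds (h : RegressionAssumptions P X Y f φ S θs) :
    ∃ δ > 0, Metric.closedBall θs δ ⊆ interior S ∧ ∃ b₀ b₁ b₂ : RVec d → ℝ,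
      (MemLp b₀ 2 (P.map X) ∧ ∀ᵐ x ∂P.map X, ∀ θ ∈ S, ‖φ θ x‖ ≤ b₀ x) ∧
      (MemLp b₁ 2 (P.map X) ∧ ∀ᵐ x ∂P.map X, ∀ θ ∈ Metric.closedBall θs δ,
        ‖fderiv ℝ (fun η => φ η x) θ‖ ≤ b₁ x) ∧
      (MemLp b₂ 2 (P.map X) ∧ ∀ᵐ x ∂P.map X, ∀ θ ∈ Metric.closedBall θs δ,
        ‖fderiv ℝ (fderiv ℝ fun η => φ η x) θ‖ ≤ b₂ x) := by
  obtain ⟨δ, hδ, hsub⟩ := Metric.nhds_basis_closedBall.mem_iff.1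
    (isOpen_interior.mem_nhds h.mem_interior)
  refine ⟨δ, hδ, hsub, ?_⟩
  obtain ⟨b₀, hb₀⟩ := exists_memLp_two_bound (μ := P.map X) h.isCompact (F := φ)
    (fun θ _ => (h.measurable_phi θ).aestronglyMeasurable) h.continuousOn_phi h.sup_phi
  obtain ⟨b₁, hb₁⟩ := exists_memLp_two_bound (μ := P.map X) (isCompact_closedBall θs δ)
    (F := fun θ x => fderiv ℝ (fun η => φ η x) θ)
    (fun θ hθ => h.aestronglyMeasurable_fderiv (hsub hθ))
    (by
      filter_upwards [h.contDiffOn_phi] with x hx θ hθ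
      exact (hx.differentiableAt_fderiv_of_two isOpen_interior
        (hsub hθ)).continuousAt.continuousWithinAt)
    (by
      refine lt_of_le_of_lt (lintegral_mono fun x => ?_) h.sup_grad
      refine iSup₂_le fun θ hθ => ?_
      refine le_trans (le_of_eq ?_)
        (le_iSup₂ (f := fun θ (_ : θ ∈ interior S) => ‖gradPhi φ θ x‖ₑ ^ 2) θ (hsub hθ))
      rw [← enorm_norm (gradPhi φ θ x), norm_gradPhi, enorm_norm])
  obtain ⟨b₂, hb₂⟩ := exists_memLp_two_bound (μ := P.map X) (isCompact_closedBall θs δ)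
    (F := fun θ x => fderiv ℝ (fderiv ℝ fun η => φ η x) θ)
    (fun θ hθ => h.aestronglyMeasurable_fderiv_fderiv (hsub hθ))
    (by
      filter_upwards [h.contDiffOn_phi] with x hx using
        (hx.continuousOn_fderiv_fderiv_of_two isOpen_interior).mono hsub)
    (by
      refine lt_of_le_of_lt (lintegral_mono fun x => ?_) h.sup_hess
      exact iSup₂_le fun θ hθ => le_iSup₂ (f := fun θ (_ : θ ∈ interior S) =>
        ‖fderiv ℝ (fderiv ℝ fun η => φ η x) θ‖ₑ ^ 2) θ (hsub hθ))
  exact ⟨b₀, b₁, b₂, hb₀, hb₁, hb₂⟩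

/-- The squared loss with `K` inner samples is a smooth loss. -/
theorem exists_smoothLoss [IsProbabilityMeasure P] (h : RegressionAssumptions P X Y f φ S θs)
    (hs : IsNestedSample P X Y Xs Ys) (K : ℕ) :
    ∃ δ, SmoothLoss (P.map fun ω => (Xs 0 ω, fun k => Ys 0 k ω)) (nestedLoss f φ K) S θs δ := by
  obtain ⟨δ, hδ, hsub, b₀, b₁, b₂, ⟨hL₀, hb₀⟩, ⟨hL₁, hb₁⟩, hL₂, hb₂⟩ := h.exists_bounds
  set μ := P.map fun ω => (Xs 0 ω, fun k => Ys 0 k ω) with hμ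
  have hmp := hs.measurePreserving_sample 0
  have hfst : MeasurePreserving Prod.fst μ (P.map X) := by
    refine ⟨measurable_fst, ?_⟩
    rw [hμ, Measure.map_map measurable_fst (hs.measurable_sample 0)]
    exact hs.map_fst h.measurable_X h.measurable_Y 0
  have hae : ∀ {p : RVec d → Prop}, (∀ᵐ x ∂P.map X, p x) → ∀ᵐ z ∂μ, p z.1 :=
    fun hp => hfst.quasiMeasurePreserving.ae hp
  have hcm := hae h.contDiffOn_phi
  set c : RVec d × (ℕ → RVec p) → ℝ := fun z => 1 / (K : ℝ) * ∑ k ∈ Finset.range K, f (z.2 k)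
  have hfm : ∀ k, Measurable fun z : RVec d × (ℕ → RVec p) => f (z.2 k) := fun k =>
    h.measurable_f.comp ((measurable_pi_apply k).comp measurable_snd)
  have hcmeas : Measurable c := (Finset.measurable_fun_sum _ fun k _ => hfm k).const_mul _
  have hfL : ∀ k, MemLp (fun z : RVec d × (ℕ → RVec p) => f (z.2 k)) 2 μ := by
    intro k
    rw [hμ, memLp_map_measure_iff (hfm k).aestronglyMeasurable (hs.measurable_sample 0).aemeasurable]
    have h1 := h.memLp_f
    have h2 : MemLp (fun ω => f (Ys 0 k ω)) 2 P := by
      have e : P.map (Ys 0 k) = P.map Y := by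
        have h3 := congrArg (Measure.map Prod.snd) (hs.map_pair h.measurable_Y 0 k)
        rw [Measure.map_map measurable_snd ((hs.measurable_Xs 0).prodMk (hs.measurable_Ys 0 k)),
          Measure.map_map measurable_snd (h.measurable_X.prodMk h.measurable_Y)] at h3
        exact h3
      have h4 := (memLp_map_measure_iff (p := 2) (g := f) (μ := P) (f := Y)
        h.measurable_f.aestronglyMeasurable h.measurable_Y.aemeasurable).2 h1
      rw [← e] at h4
      exact (memLp_map_measure_iff h.measurable_f.aestronglyMeasurable
        (hs.measurable_Ys 0 k).aemeasurable).1 h4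
    exact h2
  have hcL : MemLp c 2 μ := (memLp_finsetSum _ fun k _ => hfL k).const_mul _
  have hL₀' : MemLp (fun z : RVec d × (ℕ → RVec p) => b₀ z.1) 2 μ := hL₀.comp_measurePreserving hfst
  have hL₁' : MemLp (fun z : RVec d × (ℕ → RVec p) => |b₁ z.1|) 2 μ :=
    (hL₁.comp_measurePreserving hfst).abs
  have hL₂' : MemLp (fun z : RVec d × (ℕ → RVec p) => |b₂ z.1|) 2 μ :=
    (hL₂.comp_measurePreserving hfst).abs
  have haL : MemLp (fun z => |b₀ z.1| + |c z|) 2 μ := hL₀'.abs.add hcL.abs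
  set a : RVec d × (ℕ → RVec p) → ℝ := fun z => |b₀ z.1| + |c z| with ha
  have ha0 : ∀ z, 0 ≤ a z := fun z => by positivity
  have hbd : ∀ᵐ z ∂μ, ∀ θ ∈ S, |φ θ z.1 - c z| ≤ a z := by
    filter_upwards [hae hb₀] with z hz θ hθ
    refine (abs_sub _ _).trans ?_
    exact add_le_add ((hz θ hθ).trans (le_abs_self _)) le_rfl
  have hballS : ∀ θ ∈ Metric.closedBall θs δ, θ ∈ S := fun θ hθ => interior_subset (hsub hθ)
  refine ⟨δ, ⟨fun θ => ?_, h.isCompact, hδ, hsub, ?_, ?_, ?_⟩⟩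
  · exact ((((h.measurable_phi θ).comp measurable_fst).sub hcmeas).pow_const 2).aestronglyMeasurable
  · filter_upwards [hae h.continuousOn_phi] with z hz
    exact (hz.sub continuousOn_const).pow 2
  · filter_upwards [hcm] with z hz
    exact (hz.sub contDiffOn_const).pow 2
  -- One function dominating the loss, its gradient and its Hessian at once: the sum of the separate
  -- bounds, each a product of two functions in `L²`.
  · refine ⟨fun z => a z ^ 2 + 2 * (a z * |b₁ z.1|) + 2 * (a z * |b₂ z.1|) + 2 * |b₁ z.1| ^ 2,
      ?_, ?_, ?_, ?_⟩
    · exact ((haL.integrable_sq.add ((haL.integrable_mul hL₁').const_mul 2)).add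
        ((haL.integrable_mul hL₂').const_mul 2)).add (hL₁'.integrable_sq.const_mul 2)
    · filter_upwards [hbd] with z hz θ hθ
      have h1 := ha0 z
      have h2 : ‖nestedLoss f φ K θ z‖ ≤ a z ^ 2 := by
        unfold nestedLoss
        rw [norm_pow, Real.norm_eq_abs]
        gcongr
        exact hz θ hθ
      have h3 : 0 ≤ 2 * (a z * |b₁ z.1|) + 2 * (a z * |b₂ z.1|) + 2 * |b₁ z.1| ^ 2 := by positivity
      linarith
    · filter_upwards [hbd, hcm, hae hb₁] with z hz hzc hz1 θ hθ
      have h1 := ha0 z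
      have h2 := (hasFDerivAt_sq_sub_const
        (hzc.differentiableAt_of_two isOpen_interior (hsub hθ)) (c z)).fderiv
      have h3 : ‖fderiv ℝ (fun η => nestedLoss f φ K η z) θ‖ ≤ 2 * (a z * |b₁ z.1|) := by
        change ‖fderiv ℝ (fun η => (φ η z.1 - c z) ^ 2) θ‖ ≤ _
        rw [h2, norm_smul, Real.norm_eq_abs, abs_mul, Nat.abs_ofNat, mul_assoc]
        gcongr
        · exact hz θ (hballS θ hθ)
        · exact (hz1 θ hθ).trans (le_abs_self _)
      have h4 : 0 ≤ a z ^ 2 + 2 * (a z * |b₂ z.1|) + 2 * |b₁ z.1| ^ 2 := by positivity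
      linarith
    · filter_upwards [hbd, hcm, hae hb₁, hae hb₂] with z hz hzc hz1 hz2 θ hθ
      have h1 := ha0 z
      have h2 := norm_fderiv_fderiv_sq_sub_const_le hzc isOpen_interior (hsub hθ) (c z)
      have h3 : 2 * (|φ θ z.1 - c z| * ‖fderiv ℝ (fderiv ℝ fun η => φ η z.1) θ‖) +
          2 * ‖fderiv ℝ (fun η => φ η z.1) θ‖ ^ 2 ≤ 2 * (a z * |b₂ z.1|) + 2 * |b₁ z.1| ^ 2 := by
        gcongr
        · exact hz θ (hballS θ hθ)
        · exact (hz2 θ hθ).trans (le_abs_self _)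
        · exact (hz1 θ hθ).trans (le_abs_self _)
      have h4 : 0 ≤ a z ^ 2 + 2 * (a z * |b₁ z.1|) := by positivity
      have h5 : ‖fderiv ℝ (fderiv ℝ fun η => nestedLoss f φ K η z) θ‖ ≤
        2 * (|φ θ z.1 - c z| * ‖fderiv ℝ (fderiv ℝ fun η => φ η z.1) θ‖) +
          2 * ‖fderiv ℝ (fun η => φ η z.1) θ‖ ^ 2 := h2
      linarith

end RegressionAssumptions

end Regression

/-! ### Traces against a positive definite matrix. -/

section Traces

variable {q : ℕ}

/-- Linearity turns `tr(E[r a aᵀ] M)` into `E[r aᵀ M a]`; the symmetry of `a aᵀ` absorbs the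
transposition of indices. -/
theorem integral_mul_sum_sq {Ω : Type*} [MeasurableSpace Ω] {P : Measure Ω} {r : Ω → ℝ}
    {a : Ω → Fin q → ℝ} (hi : ∀ i j, Integrable (fun ω => r ω * (a ω i * a ω j)) P)
    (M : Matrix (Fin q) (Fin q) ℝ) :
    ((Matrix.of fun i j => ∫ ω, r ω * (a ω i * a ω j) ∂P) * M).trace =
      ∫ ω, r ω * ∑ i, ∑ j, M i j * (a ω i * a ω j) ∂P := by
  have e : ∀ ω, r ω * ∑ i, ∑ j, M i j * (a ω i * a ω j) =
      ∑ i, ∑ j, M i j * (r ω * (a ω i * a ω j)) := by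
    intro ω
    simp_rw [Finset.mul_sum]
    exact Finset.sum_congr rfl fun i _ => Finset.sum_congr rfl fun j _ => by ring
  rw [integral_congr_ae (ae_of_all _ e),
    integral_finsetSum (f := fun i ω => ∑ j, M i j * (r ω * (a ω i * a ω j))) _
      fun i _ => integrable_finsetSum _ fun j _ => (hi i j).const_mul _]
  simp only [Matrix.trace, Matrix.diag, Matrix.mul_apply, Matrix.of_apply]
  rw [Finset.sum_comm]
  refine Finset.sum_congr rfl fun i _ => ?_
  rw [integral_finsetSum (f := fun j ω => M i j * (r ω * (a ω i * a ω j))) _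
    fun j _ => (hi i j).const_mul _]
  refine Finset.sum_congr rfl fun j _ => ?_
  rw [integral_const_mul, mul_comm]
  congr 2
  ext ω
  ring

/-- The trace against a positive definite matrix controls the entries of a second moment matrix. -/
theorem trace_secondMoment_nonneg {Ω : Type*} [MeasurableSpace Ω] {P : Measure Ω} {r : Ω → ℝ}
    (hr : ∀ ω, 0 ≤ r ω) {a : Ω → Fin q → ℝ}
    (hi : ∀ i j, Integrable (fun ω => r ω * (a ω i * a ω j)) P)
    {M : Matrix (Fin q) (Fin q) ℝ} (hM : M.PosDef) :
    0 ≤ ((Matrix.of fun i j => ∫ ω, r ω * (a ω i * a ω j) ∂P) * M).trace ∧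
      ((Matrix.of fun i j => ∫ ω, r ω * (a ω i * a ω j) ∂P) ≠ 0 →
        0 < ((Matrix.of fun i j => ∫ ω, r ω * (a ω i * a ω j) ∂P) * M).trace) := by
  have hq : ∀ ω, ∑ i, ∑ j, M i j * (a ω i * a ω j) = star (a ω) ⬝ᵥ M.mulVec (a ω) := by
    intro ω
    simp only [dotProduct, Matrix.mulVec, Finset.mul_sum, Pi.star_apply, star_trivial]
    exact Finset.sum_congr rfl fun i _ => Finset.sum_congr rfl fun j _ => by ring
  have hnn : ∀ ω, 0 ≤ r ω * ∑ i, ∑ j, M i j * (a ω i * a ω j) := by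
    intro ω
    rw [hq]
    exact mul_nonneg (hr ω) (hM.posSemidef.dotProduct_mulVec_nonneg _)
  rw [integral_mul_sum_sq hi]
  -- If the trace vanishes, the nonnegative integrand vanishes almost everywhere; definiteness of
  -- `M` forces `r = 0` or `a = 0`, and every entry of the matrix is zero.
  refine ⟨integral_nonneg hnn, fun hne => (integral_nonneg hnn).lt_of_ne' fun h0 => hne ?_⟩
  have hint : Integrable (fun ω => r ω * ∑ i, ∑ j, M i j * (a ω i * a ω j)) P := by
    have e : ∀ ω, r ω * ∑ i, ∑ j, M i j * (a ω i * a ω j) =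
        ∑ i, ∑ j, M i j * (r ω * (a ω i * a ω j)) := by
      intro ω
      simp_rw [Finset.mul_sum]
      exact Finset.sum_congr rfl fun i _ => Finset.sum_congr rfl fun j _ => by ring
    simp_rw [e]
    exact integrable_finsetSum _ fun i _ => integrable_finsetSum _ fun j _ => (hi i j).const_mul _
  have hae := (integral_eq_zero_iff_of_nonneg hnn hint).1 h0
  ext i j
  simp only [Matrix.of_apply, Matrix.zero_apply]
  refine integral_eq_zero_of_ae ?_
  filter_upwards [hae] with ω hω
  rw [hq] at hω
  simp only [Pi.zero_apply] at hω ⊢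
  rcases mul_eq_zero.1 hω with h | h
  · rw [h, zero_mul]
  · have : a ω = 0 := by
      by_contra hne'
      exact (hM.dotProduct_mulVec_pos hne').ne' h
    simp [this]

end Traces

/-! ### Expected excess risk with `K` inner samples. -/

section Regression

variable {Ω : Type*} [MeasurableSpace Ω] {P : Measure Ω} [IsProbabilityMeasure P] {d p q : ℕ}
  {X : Ω → RVec d} {Y : Ω → RVec p} {f : RVec p → ℝ} {φ : RVec q → RVec d → ℝ}
  {S : Set (RVec q)} {θs : RVec q} {Xs : ℕ → Ω → RVec d} {Ys : ℕ → ℕ → Ω → RVec p}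

namespace RegressionAssumptions

theorem condMean_ae_eq (h : RegressionAssumptions P X Y f φ S θs) :
    condMean P X Y f =ᵐ[P] fun ω => regFun P X Y f (X ω) :=
  _root_.condMean_ae_eq h.measurable_X h.measurable_Y h.measurable_f
    (h.memLp_f.integrable (by norm_num))

/-- With one inner sample, the moment condition bounds the two parts of the score. -/
theorem integrable_sq_mul_norm_gradPhi (h : RegressionAssumptions P X Y f φ S θs)
    (hs : IsNestedSample P X Y Xs Ys)
    (hm : Integrable (fun ω => (φ θs (Xs 0 ω) - f (Ys 0 0 ω)) ^ 2 *
      ‖gradPhi φ θs (Xs 0 ω)‖ ^ 2) P) :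
    Integrable (fun ω => (φ θs (X ω) - regFun P X Y f (X ω)) ^ 2 * ‖gradPhi φ θs (X ω)‖ ^ 2) P ∧
    Integrable (fun ω => (f (Y ω) - regFun P X Y f (X ω)) ^ 2 * ‖gradPhi φ θs (X ω)‖ ^ 2) P := by
  have hXY : Measurable fun ω => (X ω, Y ω) := h.measurable_X.prodMk h.measurable_Y
  have hgm : AEStronglyMeasurable (fun x => ‖gradPhi φ θs x‖ ^ 2) (P.map X) :=
    h.aestronglyMeasurable_norm_gradPhi.pow 2
  have hfst : (P.map fun ω => (X ω, Y ω)).map Prod.fst = P.map X := by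
    rw [Measure.map_map measurable_fst hXY]; rfl
  have hF : AEStronglyMeasurable (fun z : RVec d × RVec p => (φ θs z.1 - f z.2) ^ 2 *
      ‖gradPhi φ θs z.1‖ ^ 2) (P.map fun ω => (X ω, Y ω)) :=
    (((h.measurable_phi θs).comp measurable_fst).sub
      (h.measurable_f.comp measurable_snd)).pow_const 2 |>.aestronglyMeasurable.mul
      (AEStronglyMeasurable.comp_measurable (f := Prod.fst)
        (g := fun x => ‖gradPhi φ θs x‖ ^ 2) (by rwa [hfst]) measurable_fst)
  have h1 := (hs.integrable_pair_iff h.measurable_X h.measurable_Y 0 0 hF).1 hm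
  have h2 := integrable_sq_sub_regFun_mul h.measurable_X h.measurable_Y h.measurable_f h.memLp_f
    (h.measurable_phi θs).aestronglyMeasurable hgm (fun x => sq_nonneg _) h1
  refine ⟨h2, ?_⟩
  -- The bias part is controlled by conditional Jensen; the noise part `f(Y) − m(X)` is the
  -- difference of the other two errors, so its square is at most twice the sum of theirs.
  refine ((h1.const_mul 2).add (h2.const_mul 2)).mono' ?_ (ae_of_all _ fun ω => ?_)
  · exact (((h.measurable_f.comp h.measurable_Y).sub ((measurable_regFun h.measurable_f).comp
      h.measurable_X)).pow_const 2).aestronglyMeasurable.mul (hgm.comp_measurable h.measurable_X)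
  · rw [Real.norm_eq_abs, abs_of_nonneg (by positivity)]
    simp only [Pi.add_apply]
    have : (f (Y ω) - regFun P X Y f (X ω)) ^ 2 ≤ 2 * (φ θs (X ω) - f (Y ω)) ^ 2 +
        2 * (φ θs (X ω) - regFun P X Y f (X ω)) ^ 2 := by
      nlinarith [sq_nonneg ((φ θs (X ω) - f (Y ω)) + (φ θs (X ω) - regFun P X Y f (X ω)))]
    calc _ ≤ (2 * (φ θs (X ω) - f (Y ω)) ^ 2 +
        2 * (φ θs (X ω) - regFun P X Y f (X ω)) ^ 2) * ‖gradPhi φ θs (X ω)‖ ^ 2 := by gcongr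
      _ = _ := by ring

end RegressionAssumptions

/-- The expected excess risk of the estimator with `K` inner samples. -/
theorem tendsto_integral_nested_excess (h : RegressionAssumptions P X Y f φ S θs)
    (hs : IsNestedSample P X Y Xs Ys)
    (hA : Integrable (fun ω => (φ θs (X ω) - regFun P X Y f (X ω)) ^ 2 *
      ‖gradPhi φ θs (X ω)‖ ^ 2) P)
    (hB : Integrable (fun ω => (f (Y ω) - regFun P X Y f (X ω)) ^ 2 *
      ‖gradPhi φ θs (X ω)‖ ^ 2) P) {K : ℕ} (hK : 1 ≤ K) {est : ℕ → Ω → RVec q}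
    (hest : EstimatorAssumptions P X Y f φ S θs Xs Ys K est) :
    Tendsto (fun n : ℕ => ∫ ω, (n : ℝ) * (vInf P X Y f φ (est n ω) - vInf P X Y f φ θs) ∂P) atTop
      (𝓝 (2 * ((matA P X Y f φ θs * (matH P X Y f φ θs)⁻¹).trace +
        1 / (K : ℝ) * (matB P X Y f φ θs * (matH P X Y f φ θs)⁻¹).trace))) := by
  obtain ⟨δ, hL⟩ := h.exists_smoothLoss hs K
  set μ := P.map fun ω => (Xs 0 ω, fun k => Ys 0 k ω) with hμ
  have : IsProbabilityMeasure μ :=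
    Measure.isProbabilityMeasure_map (hs.measurable_sample 0).aemeasurable
  have hfi : Integrable (fun ω => f (Y ω)) P := h.memLp_f.integrable (by norm_num)
  have hcm := h.condMean_ae_eq
  have hmL : MemLp (fun ω => regFun P X Y f (X ω)) 2 P :=
    (MemLp.condExp (by norm_num) h.memLp_f).ae_eq hcm
  have hvL : Integrable (fun ω => (f (Y ω) - regFun P X Y f (X ω)) ^ 2 * 1) P := by
    simpa using (h.memLp_f.sub hmL).integrable_sq
  have hint : ∀ {F : RVec d × (ℕ → RVec p) → ℝ}, AEStronglyMeasurable F μ →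
      ∫ z, F z ∂μ = ∫ ω, F (Xs 0 ω, fun k => Ys 0 k ω) ∂P := fun hF =>
    integral_map (hs.measurable_sample 0).aemeasurable hF
  set v₀ := 1 / (K : ℝ) * ∫ ω, (f (Y ω) - regFun P X Y f (X ω)) ^ 2 * 1 ∂P with hv₀
  -- Bias-variance with weight `1`: the noise contributes a constant in `θ`, so minimizer, Hessian
  -- and excess risk are those of `v^∞` for every `K`.
  have hrisk : ∀ θ, ∫ z, nestedLoss f φ K θ z ∂μ = vInf P X Y f φ θ + v₀ := by
    intro θ
    have hu : Integrable (fun ω => (φ θ (X ω) - regFun P X Y f (X ω)) ^ 2 * 1) P := by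
      simpa using ((h.memLp_phi θ).sub hmL).integrable_sq
    have h1 := (hs.integral_sq_sub_mean h.measurable_X h.measurable_Y h.measurable_f hfi hK
      (u := φ θ) (w := fun _ => 1) (h.measurable_phi θ).aestronglyMeasurable
      aestronglyMeasurable_const hu hvL).2
    rw [hint (hL.aestronglyMeasurable θ)]
    simp only [mul_one] at h1
    unfold nestedLoss
    simp only
    rw [h1, hv₀]
    simp only [mul_one]
    congr 1
    refine integral_congr_ae ?_
    filter_upwards [hcm] with ω hω
    rw [hω]
  have hHess : hessianMatrix (fun θ => ∫ z, nestedLoss f φ K θ z ∂μ) θs = matH P X Y f φ θs := by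
    unfold matH hessianMatrix
    have : fderiv ℝ (fun θ => ∫ z, nestedLoss f φ K θ z ∂μ) = fderiv ℝ (vInf P X Y f φ) := by
      ext1 θ
      simp_rw [hrisk]
      exact fderiv_add_const _
    rw [this]
  have hgood : ∀ᵐ z ∂μ, DifferentiableAt ℝ (fun η => φ η z.1) θs := by
    have h1 : ∀ᵐ x ∂P.map X, DifferentiableAt ℝ (fun η => φ η x) θs := by
      filter_upwards [h.contDiffOn_phi] with x hx using
        hx.differentiableAt_of_two isOpen_interior h.mem_interior
    have hfst : MeasurePreserving Prod.fst μ (P.map X) := by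
      refine ⟨measurable_fst, ?_⟩
      rw [hμ, Measure.map_map measurable_fst (hs.measurable_sample 0)]
      exact hs.map_fst h.measurable_X h.measurable_Y 0
    exact hfst.quasiMeasurePreserving.ae h1
  have hscore : ∀ᵐ z ∂μ, ∀ i, fderiv ℝ (fun η => nestedLoss f φ K η z) θs
      (EuclideanSpace.single i 1) = 2 * (φ θs z.1 - 1 / (K : ℝ) * ∑ k ∈ Finset.range K, f (z.2 k)) *
        gradPhi φ θs z.1 i := by
    filter_upwards [hgood] with z hz i
    have h1 := (hasFDerivAt_sq_sub_const hz
      (1 / (K : ℝ) * ∑ k ∈ Finset.range K, f (z.2 k))).fderiv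
    unfold nestedLoss
    rw [h1, smul_apply, smul_eq_mul, fderiv_single_eq_gradPhi]
  have hum : AEStronglyMeasurable (fun ω => φ θs (X ω) - regFun P X Y f (X ω)) P :=
    (((h.measurable_phi θs).comp h.measurable_X).sub
      ((measurable_regFun h.measurable_f).comp h.measurable_X)).aestronglyMeasurable
  have hvm : AEStronglyMeasurable (fun ω => f (Y ω) - regFun P X Y f (X ω)) P :=
    ((h.measurable_f.comp h.measurable_Y).sub
      ((measurable_regFun h.measurable_f).comp h.measurable_X)).aestronglyMeasurable
  have hAij := h.integrable_sq_mul_gradPhi hum hA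
  have hBij := h.integrable_sq_mul_gradPhi hvm hB
  have hmatA : ∀ i j, ∫ ω, (φ θs (X ω) - regFun P X Y f (X ω)) ^ 2 *
      (gradPhi φ θs (X ω) i * gradPhi φ θs (X ω) j) ∂P = matA P X Y f φ θs i j := by
    intro i j
    simp only [matA, Matrix.of_apply]
    refine integral_congr_ae ?_
    filter_upwards [hcm] with ω hω
    rw [hω]
  have hmatB : ∀ i j, ∫ ω, (f (Y ω) - regFun P X Y f (X ω)) ^ 2 *
      (gradPhi φ θs (X ω) i * gradPhi φ θs (X ω) j) ∂P = matB P X Y f φ θs i j := by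
    intro i j
    simp only [matB, Matrix.of_apply]
    refine integral_congr_ae ?_
    filter_upwards [hcm] with ω hω
    rw [hω]
  -- The same identity with weight `∂ᵢφ ∂ⱼφ` computes the score covariance; the factor `4` below is
  -- the square of the `2` from differentiating a square.
  have hBV := fun i j => hs.integral_sq_sub_mean h.measurable_X h.measurable_Y h.measurable_f hfi hK
      (u := φ θs) (w := fun x => gradPhi φ θs x i * gradPhi φ θs x j)
      (h.measurable_phi θs).aestronglyMeasurable
      ((h.aestronglyMeasurable_gradPhi i).mul (h.aestronglyMeasurable_gradPhi j))
      (hAij i j) (hBij i j)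
  set s : Fin q → RVec d × (ℕ → RVec p) → ℝ := fun i z =>
    fderiv ℝ (fun η => nestedLoss f φ K η z) θs (EuclideanSpace.single i 1) with hsdef
  have hsm : ∀ i, AEStronglyMeasurable (s i) μ := fun i =>
    (ContinuousLinearMap.apply ℝ ℝ
      (EuclideanSpace.single i (1 : ℝ) : RVec q)).continuous.comp_aestronglyMeasurable
      (hL.aestronglyMeasurable_fderiv hL.mem_interior)
  have hss : ∀ i j, ∀ᵐ ω ∂P, s i (Xs 0 ω, fun k => Ys 0 k ω) * s j (Xs 0 ω, fun k => Ys 0 k ω) =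
      4 * ((φ θs (Xs 0 ω) - 1 / (K : ℝ) * ∑ k ∈ Finset.range K, f (Ys 0 k ω)) ^ 2 *
        (gradPhi φ θs (Xs 0 ω) i * gradPhi φ θs (Xs 0 ω) j)) := by
    intro i j
    filter_upwards [ae_of_ae_map (hs.measurable_sample 0).aemeasurable hscore] with ω hω
    rw [hsdef]
    simp only
    rw [hω i, hω j]
    ring
  have hsL : ∀ i, MemLp (s i) 2 μ := by
    intro i
    refine (memLp_two_iff_integrable_sq (hsm i)).2 ((integrable_map_measure ((hsm i).pow 2)
      (hs.measurable_sample 0).aemeasurable).2 ?_)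
    refine (((hBV i i).1).const_mul 4).congr ?_
    filter_upwards [hss i i] with ω hω
    simp only [Function.comp_apply, Pi.pow_apply]
    rw [← hω, sq]
  have hcov : ∀ i j, ∫ z, s i z * s j z ∂μ =
      4 * (matA P X Y f φ θs i j + 1 / (K : ℝ) * matB P X Y f φ θs i j) := by
    intro i j
    refine (hint ((hsm i).mul (hsm j))).trans ?_
    refine (integral_congr_ae (hss i j)).trans ?_
    rw [integral_const_mul, (hBV i j).2, hmatA, hmatB]
  have hexc : ∀ θ, (∫ z, nestedLoss f φ K θ z ∂μ) - ∫ z, nestedLoss f φ K θs z ∂μ =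
      vInf P X Y f φ θ - vInf P X Y f φ θs := by
    intro θ
    rw [hrisk, hrisk]; ring
  have main := tendsto_integral_excess hL hs.measurePreserving_sample hs.indep
    (fun θ hθ hne => by
      rw [hrisk, hrisk]
      linarith [h.unique_min θ hθ hne])
    (by rw [hHess]; exact h.posDef_H) (est := est)
    (fun n hn => by
      filter_upwards [hest.isMin_est n hn] with ω hω
      simpa [vEmp, empRisk, nestedLoss] using hω)
    hsL (by simp_rw [hexc]; exact hest.unifIntegrable)
  simp_rw [hexc] at main
  rw [hHess] at main
  have hcov' : ∀ i j, (matH P X Y f φ θs)⁻¹ i j *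
      ∫ z, fderiv ℝ (fun η => nestedLoss f φ K η z) θs (EuclideanSpace.single i 1) *
        fderiv ℝ (fun η => nestedLoss f φ K η z) θs (EuclideanSpace.single j 1) ∂μ =
      (matH P X Y f φ θs)⁻¹ i j *
        (4 * (matA P X Y f φ θs i j + 1 / (K : ℝ) * matB P X Y f φ θs i j)) := fun i j =>
    congrArg _ (hcov i j)
  rw [Finset.sum_congr rfl fun i _ => Finset.sum_congr rfl fun j _ => hcov' i j] at main
  -- The constants combine as `½ · 4 = 2`, and symmetry of `H⁻¹` identifies the double sum with a
  -- trace.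
  convert main using 2
  have hsym : ∀ i j, (matH P X Y f φ θs)⁻¹ j i = (matH P X Y f φ θs)⁻¹ i j := fun i j =>
    (star_trivial _).symm.trans (h.posDef_H.inv.isHermitian.apply i j)
  simp only [Matrix.trace, Matrix.diag, Matrix.mul_apply, Finset.mul_sum, ← Finset.sum_add_distrib]
  refine Finset.sum_congr rfl fun i _ => Finset.sum_congr rfl fun j _ => ?_
  rw [hsym]
  ring

end Regression

/-! ### From the number of outer samples to the budget. -/

theorem tendsto_sampleSize {c : ℝ} (hc : 0 < c) (K : ℕ) :
    Tendsto (sampleSize c K) atTop atTop :=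
  tendsto_nat_floor_atTop.comp (tendsto_id.atTop_div_const (by positivity))

/-- An error of order `1 / n` in the number of outer samples is of order `1 / b` in the budget. -/
theorem tendsto_mul_sampleSize {c : ℝ} (hc : 0 < c) (K : ℕ) {a : ℕ → ℝ} {l : ℝ}
    (ha : Tendsto (fun n : ℕ => (n : ℝ) * a n) atTop (𝓝 l)) :
    Tendsto (fun b : ℝ => b * a (sampleSize c K b)) atTop (𝓝 ((1 + K * c) * l)) := by
  have hκ : 0 < 1 + K * c := by positivity
  have h1 : Tendsto (fun b : ℝ => (sampleSize c K b : ℝ) / (b / (1 + K * c))) atTop (𝓝 1) :=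
    (tendsto_nat_floor_div_atTop (R := ℝ)).comp (tendsto_id.atTop_div_const hκ)
  have h2 := ((h1.inv₀ one_ne_zero).mul
    (ha.comp (tendsto_sampleSize hc K))).const_mul (1 + K * c)
  rw [inv_one, one_mul] at h2
  refine h2.congr' ?_
  filter_upwards [(tendsto_sampleSize hc K).eventually_ge_atTop 1] with b hb
  have hb' : (sampleSize c K b : ℝ) ≠ 0 := by exact_mod_cast (by omega : sampleSize c K b ≠ 0)
  simp only [Function.comp_apply]
  field_simp

/-- Both products are equivalent to the nonzero constant `l`; multiplying by `1 / b` recovers `u`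
and `v`. -/
theorem isEquivalent_of_tendsto_mul {u v : ℝ → ℝ} {l : ℝ} (hl : l ≠ 0)
    (hu : Tendsto (fun b => b * u b) atTop (𝓝 l)) (hv : Tendsto (fun b => b * v b) atTop (𝓝 l)) :
    Asymptotics.IsEquivalent atTop u v := by
  have h := ((Asymptotics.isEquivalent_const_iff_tendsto hl).2 hu).trans
    ((Asymptotics.isEquivalent_const_iff_tendsto hl).2 hv).symm
  have h' := (Asymptotics.IsEquivalent.refl (u := fun b : ℝ => b⁻¹) (l := atTop)).mul h
  refine (h'.congr_left ?_).congr_right ?_ <;>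
  · filter_upwards [eventually_ne_atTop 0] with b hb
    simp [hb]

section Regression

variable {Ω : Type*} [MeasurableSpace Ω] {P : Measure Ω} [IsProbabilityMeasure P] {d p q : ℕ}
  {X : Ω → RVec d} {Y : Ω → RVec p} {f : RVec p → ℝ} {φ : RVec q → RVec d → ℝ}
  {S : Set (RVec q)} {θs : RVec q} {Xs : ℕ → Ω → RVec d} {Ys : ℕ → ℕ → Ω → RVec p}

theorem EstimatorAssumptions.integral_excess {K : ℕ} {est : ℕ → Ω → RVec q}
    (h : EstimatorAssumptions P X Y f φ S θs Xs Ys K est) (n : ℕ) :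
    ∫ ω, (n : ℝ) * (vInf P X Y f φ (est n ω) - vInf P X Y f φ θs) ∂P =
      n * ((∫ ω, vInf P X Y f φ (est n ω) ∂P) - vInf P X Y f φ θs) := by
  rcases eq_or_ne n 0 with rfl | hn
  · simp
  have hn' : (n : ℝ) ≠ 0 := by exact_mod_cast hn
  have h1 : Integrable (fun ω => (n : ℝ) * (vInf P X Y f φ (est n ω) - vInf P X Y f φ θs)) P :=
    memLp_one_iff_integrable.1 (h.unifIntegrable.memLp n)
  have h2 : Integrable (fun ω => vInf P X Y f φ (est n ω)) P := by
    -- Uniform integrability makes `n` times the excess integrable, and `n ≠ 0` allows dividing.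
    refine ((h1.const_mul (n : ℝ)⁻¹).add (integrable_const (vInf P X Y f φ θs))).congr
      (ae_of_all _ fun ω => ?_)
    simp [hn']
  rw [integral_const_mul, integral_sub h2 (integrable_const _)]
  simp

namespace RegressionAssumptions

/-- This positivity keeps the denominator of `ξ` nonzero and makes the limits of budget times error
nonzero, as asymptotic equivalence requires. -/
theorem trace_matA_pos (h : RegressionAssumptions P X Y f φ S θs)
    (hA : Integrable (fun ω => (φ θs (X ω) - regFun P X Y f (X ω)) ^ 2 *
      ‖gradPhi φ θs (X ω)‖ ^ 2) P) (hne : matA P X Y f φ θs ≠ 0) :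
    0 < (matA P X Y f φ θs * (matH P X Y f φ θs)⁻¹).trace := by
  have hcm := h.condMean_ae_eq
  have hm : AEStronglyMeasurable (fun ω => φ θs (X ω) - condMean P X Y f ω) P :=
    (h.memLp_phi θs).aestronglyMeasurable.sub integrable_condExp.aestronglyMeasurable
  have hi := h.integrable_sq_mul_gradPhi hm (hA.congr (by
    filter_upwards [hcm] with ω hω
    rw [hω]))
  exact (trace_secondMoment_nonneg (fun ω => sq_nonneg _) hi h.posDef_H.inv).2 hne

theorem trace_matB_nonneg (h : RegressionAssumptions P X Y f φ S θs)
    (hB : Integrable (fun ω => (f (Y ω) - regFun P X Y f (X ω)) ^ 2 *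
      ‖gradPhi φ θs (X ω)‖ ^ 2) P) :
    0 ≤ (matB P X Y f φ θs * (matH P X Y f φ θs)⁻¹).trace := by
  have hcm := h.condMean_ae_eq
  have hm : AEStronglyMeasurable (fun ω => f (Y ω) - condMean P X Y f ω) P :=
    h.memLp_f.aestronglyMeasurable.sub integrable_condExp.aestronglyMeasurable
  have hi := h.integrable_sq_mul_gradPhi hm (hB.congr (by
    filter_upwards [hcm] with ω hω
    rw [hω]))
  exact (trace_secondMoment_nonneg (fun ω => sq_nonneg _) hi h.posDef_H.inv).1

end RegressionAssumptions

end Regression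

theorem mainTheorem2 {Ω : Type*} [MeasurableSpace Ω] (P : Measure Ω) [IsProbabilityMeasure P]
    {d p q : ℕ} (X : Ω → RVec d) (Y : Ω → RVec p) (f : RVec p → ℝ)
    (φ : RVec q → RVec d → ℝ) (S : Set (RVec q)) (θs : RVec q)
    (hreg : RegressionAssumptions P X Y f φ S θs)
    (hA : matA P X Y f φ θs ≠ 0)
    (Xs : ℕ → Ω → RVec d) (Ys : ℕ → ℕ → Ω → RVec p)
    (hsample : IsNestedSample P X Y Xs Ys)
    (cY : ℝ) (hcY : 0 < cY)
    (est : ℕ → ℕ → Ω → RVec q)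
    (hest_one : EstimatorAssumptions P X Y f φ S θs Xs Ys 1 (est 1))
    (hest_star : EstimatorAssumptions P X Y f φ S θs Xs Ys
      (optK P X Y f φ θs cY) (est (optK P X Y f φ θs cY))) :
    Asymptotics.IsEquivalent atTop
        (fun c : ℝ =>
          (∫ ω, vInf P X Y f φ (est (optK P X Y f φ θs cY)
            (sampleSize cY (optK P X Y f φ θs cY) c) ω) ∂P) - vInf P X Y f φ θs)
        (fun c : ℝ =>
          rStar cY (xi P X Y f φ θs cY) *
            ((∫ ω, vInf P X Y f φ (est 1 (sampleSize cY 1 c) ω) ∂P) - vInf P X Y f φ θs)) ∧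
      0 < rStar cY (xi P X Y f φ θs cY) ∧
      rStar cY (xi P X Y f φ θs cY) ≤ 1 ∧
      cY / (1 + cY) ≤ rStar cY (xi P X Y f φ θs cY) ∧
      Tendsto (fun x : ℝ => rStar cY x) atTop (𝓝 (cY / (1 + cY))) := by
  obtain ⟨hAi, hBi⟩ := hreg.integrable_sq_mul_norm_gradPhi hsample
    (by simpa using hest_one.moment)
  have htA := hreg.trace_matA_pos hAi hA
  have htB := hreg.trace_matB_nonneg hBi
  have hξ : 0 ≤ xi P X Y f φ θs cY := div_nonneg htB (by positivity)
  refine ⟨?_, rStar_pos hcY hξ, rStar_le_one hcY hξ, div_le_rStar hcY hξ, tendsto_rStar_atTop hcY⟩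
  -- The definition of `ξ` solved for `tr(B H⁻¹)`: the limit for `K` becomes `2 tr(A H⁻¹) (1 + K C)
  -- (1 + ξ C / K)`.
  have hBξ : (matB P X Y f φ θs * (matH P X Y f φ θs)⁻¹).trace =
      xi P X Y f φ θs cY * cY * (matA P X Y f φ θs * (matH P X Y f φ θs)⁻¹).trace := by
    unfold xi
    field_simp
  have key : ∀ K : ℕ, 1 ≤ K → EstimatorAssumptions P X Y f φ S θs Xs Ys K (est K) →
      Tendsto (fun c : ℝ => c * ((∫ ω, vInf P X Y f φ (est K (sampleSize cY K c) ω) ∂P) -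
        vInf P X Y f φ θs)) atTop
        (𝓝 ((1 + K * cY) * (2 * ((matA P X Y f φ θs * (matH P X Y f φ θs)⁻¹).trace +
          1 / (K : ℝ) * (matB P X Y f φ θs * (matH P X Y f φ θs)⁻¹).trace)))) := by
    intro K hK hest
    have h := tendsto_integral_nested_excess hreg hsample hAi hBi hK hest
    simp_rw [hest.integral_excess] at h
    exact tendsto_mul_sampleSize hcY K
      (a := fun n => (∫ ω, vInf P X Y f φ (est K n ω) ∂P) - vInf P X Y f φ θs) h
  have hK : 1 ≤ optK P X Y f φ θs cY := (nu_mem _).1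
  have hK' : (0 : ℝ) < optK P X Y f φ θs cY := by exact_mod_cast hK
  have h1 := (key 1 le_rfl hest_one).const_mul (rStar cY (xi P X Y f φ θs cY))
  refine isEquivalent_of_tendsto_mul (ne_of_gt ?_) (key _ hK hest_star) ?_
  · positivity
  -- The limit for `K = 1` times `r⋆` equals the limit for `K⋆`, the factors `(1 + C)(1 + ξ C)`
  -- cancelling.
  · convert h1 using 2
    · ring
    · rw [hBξ]
      unfold rStar optK at *
      have hx : 0 < 1 + xi P X Y f φ θs cY * cY := by positivity
      simp only [Nat.cast_one]
      field_simp
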